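/- **Setting.** Let $d\ge 1$ and, for $L>0$, $\Lambda_L=[-L/2,L/2)^d$ with dual lattice $\Lambda_L^*=(\tfrac1L\mathbb Z)^d$. For $f\in L^2(\Lambda_L)$ put $\hat f(p)=\int_{\Lambda_L}e^{-2\pi i p\cdot x}f(x)\,dx$, $p\in\Lambda_L^*$, with inverse $\check g(x)=|\Lambda_L|^{-1}\sum_{p\in\Lambda_L^*}e^{2\pi i p\cdot x}g(p)$ on $\ell^2(\Lambda_L^*)$, and let $\nu(p)=\tfrac12|p|^2$. Let $H_0=H_{0,L}$ be the periodic free Hamiltonian $-\frac{1}{2(2\pi)^2}\Delta_L$ on $L^2(\Lambda_L)$, that is $H_0f=(\nu\hat f)^\vee$ on the domain $\{f\in L^2(\Lambda_L):\nu\hat f\in\ell^2(\Lambda_L^*)\}$. For a function $h$ on $\mathbb R^d$ let $h_\#$ be the $L$-periodic extension of $h|_{\Lambda_L}$; for $\psi\in L^2(\mathbb R^d)$, $\psi_\#$ is regarded as an element of $L^2(\Lambda_L)$. Let $B$ be a real-valued Schwartz function on $\mathbb R^d$ which either has compact support or is invariant under each reflection $x_j\mapsto -x_j$, $j=1,\dots,d$.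 Let $M$ be a Poisson variable with mean $|\Lambda_L|$, $y_1,y_2,\dots$ i.i.d. uniform on $\Lambda_L$, and $v_1,v_2,\dots$ i.i.d. real weights, all independent, with joint expectation $\mathbf E_L$; the common law of the weights does not depend on $L$. Put $$V_L(x)=\sum_{\gamma=1}^{M}v_\gamma\,B_\#(x-y_\gamma),\qquad H_\lambda=H_0+\lambda V_L,\qquad R_L(z)=(H_0-z)^{-1}\quad(z\in\mathbb C\setminus[0,\infty)),$$ where $V_L$ acts by multiplication, and, for $\psi_1,\psi_2\in L^2(\mathbb R^d)$ and $n\ge 0$ (inner products being conjugate linear in the first entry), $$T_{n,L}[z;\psi_1,\psi_2]=\mathbf E_L\big\langle\psi_{1,\#},\,R_L(z)\,[V_LR_L(z)]^n\,\psi_{2,\#}\big\rangle_{L^2(\Lambda_L)} .$$ Let $\chi:\mathbb R\to[0,1]$ be $C^\infty$ with $\chi=1$ on $[-1,1]$ and $\chi(t)=0$ for $|t|\ge 2$, let $\chi_a(t)=\chi(at)$ and $\widehat{\chi}_a(\alpha)=\int_{\mathbb R}\chi_a(t)e^{-2\pi i\alpha t}\,dt$. For $\eta,\epsilon>0$ put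 $$a=a(\eta,\epsilon)=\frac{\eta}{|\ln(\eta\epsilon/2)|+1},\qquad S_{n,L}[E+i\eta;\chi;\psi_1,\psi_2;\epsilon]=(-1)^n\int_{\mathbb R}\widehat{\chi}_{a(\eta,\epsilon)}(\alpha)\,T_{n,L}[E+i\eta+2\pi\alpha;\psi_1,\psi_2]\,d\alpha .$$ **Theorem.** Assume that there is a constant $C$ with $\mathbf E|v_\gamma|^n\le C$ for all $n\in\mathbb N$. Let $\eta>0$, $\epsilon>0$ and $\lambda_0>0$. Then there is $N\in\mathbb N$ (for given $d$, $B$ and law of the weights it depends only on $\epsilon,\eta,\lambda_0$) such that for all such $\chi$, all $\psi_1,\psi_2\in L^2(\mathbb R^d)$, $E\in\mathbb R$, $\lambda\in[-\lambda_0,\lambda_0]$ and $L\ge 1$, $$\Big|\mathbf E_L\big\langle\psi_{1,\#},(H_\lambda-(E+i\eta))^{-1}\psi_{2,\#}\big\rangle-\sum_{n=0}^{N}\lambda^nS_{n,L}[E+i\eta;\chi;\psi_1,\psi_2;\epsilon]\Big|\le\epsilon\,\|\psi_{1,\#}\|_{L^2(\Lambda_L)}\,\|\psi_{2,\#}\|_{L^2(\Lambda_L)}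 .$$ Here everything is well defined: almost surely $E+i\eta$ is in the resolvent set of $H_\lambda$; $E+i\eta+2\pi\alpha$ is in the resolvent set of $H_0$ for every $\alpha\in\mathbb R$; and the random variables $\langle\psi_{1,\#},(H_\lambda-(E+i\eta))^{-1}\psi_{2,\#}\rangle$ and $\langle\psi_{1,\#},R_L(z)[V_LR_L(z)]^n\psi_{2,\#}\rangle$ (for $z=E+i\eta+2\pi\alpha$, $\alpha\in\mathbb R$, $n\ge0$) and, for every $n\ge 0$, the function $\alpha\mapsto\widehat{\chi}_a(\alpha)T_{n,L}[E+i\eta+2\pi\alpha;\psi_1,\psi_2]$ are integrable. -/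

import Mathlib

open MeasureTheory
open scoped ENNReal NNReal SchwartzMap FourierTransform

noncomputable section

namespace PoissonSchrodinger

/-- Position space `ℝ^d` with the Euclidean norm. -/
abbrev Space (d : ℕ) : Type := EuclideanSpace ℝ (Fin d)

/-- The box `Λ_L = [-L/2, L/2)^d`. -/
def box (d : ℕ) (L : ℝ) : Set (Space d) := {x | ∀ j, -(L / 2) ≤ x j ∧ x j < L / 2}

/-- The Hilbert space `L²(Λ_L)`. -/
abbrev BoxL2 (d : ℕ) (L : ℝ) : Type := Lp ℂ 2 ((volume : Measure (Space d)).restrict (box d L))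

/-- The volume `|Λ_L|`. -/
def boxVolume (d : ℕ) (L : ℝ) : ℝ := (volume : Measure (Space d)).real (box d L)

lemma box_eq_preimage (d : ℕ) (L : ℝ) :
    box d L = (MeasurableEquiv.toLp 2 (Fin d → ℝ)).symm ⁻¹'
      (Set.univ.pi fun _ => Set.Ico (-(L / 2)) (L / 2)) := by
  ext x
  simp [box, Set.mem_pi]

lemma measurableSet_box (d : ℕ) (L : ℝ) : MeasurableSet (box d L) := by
  rw [box_eq_preimage]
  exact (MeasurableSet.univ_pi fun _ => measurableSet_Ico).preimage (MeasurableEquiv.measurable _)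

/-- Integration over the box, written in coordinates. -/
lemma integral_box (d : ℕ) (L : ℝ) (F : (Fin d → ℝ) → ℂ) :
    ∫ x in box d L, F (fun j => x j) =
      ∫ y, F y ∂(Measure.pi fun _ : Fin d =>
        (volume : Measure ℝ).restrict (Set.Ico (-(L / 2)) (L / 2))) := by
  rw [← Measure.restrict_pi_pi, box_eq_preimage]
  exact (EuclideanSpace.volume_preserving_symm_measurableEquiv_toLp (Fin d)).setIntegral_preimage_emb
    (MeasurableEquiv.measurableEmbedding _) F _

lemma volume_box (d : ℕ) (L : ℝ) : (volume : Measure (Space d)) (box d L) = ENNReal.ofReal L ^ d := by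
  rw [box_eq_preimage,
    (EuclideanSpace.volume_preserving_symm_measurableEquiv_toLp (Fin d)).measure_preimage
      (MeasurableSet.univ_pi fun _ => measurableSet_Ico).nullMeasurableSet, Real.volume_pi_Ico]
  simp

instance isFiniteMeasure_box (d : ℕ) (L : ℝ) :
    IsFiniteMeasure ((volume : Measure (Space d)).restrict (box d L)) := by
  refine ⟨?_⟩
  rw [Measure.restrict_apply_univ, volume_box]
  exact ENNReal.pow_lt_top ENNReal.ofReal_lt_top

/-! ### Fourier series on the box -/

/-- The point `m / L` of the dual lattice `Λ_L^* = ((1/L) ℤ)^d`; the lattice is indexed by `ℤ^d`. -/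
def dualPoint {d : ℕ} (L : ℝ) (m : Fin d → ℤ) : Space d := WithLp.toLp 2 fun j => (m j : ℝ) / L

/-- The plane wave `x ↦ e^{2πi p·x}`. -/
def planeWave {d : ℕ} (p x : Space d) : ℂ :=
  Complex.exp (2 * Real.pi * Complex.I * (inner ℝ p x : ℝ))

lemma continuous_planeWave {d : ℕ} (p : Space d) : Continuous (planeWave p) := by
  unfold planeWave
  fun_prop

lemma norm_planeWave {d : ℕ} (p x : Space d) : ‖planeWave p x‖ = 1 := by
  have h : (2 * Real.pi * Complex.I * (inner ℝ p x : ℝ) : ℂ)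
      = ((2 * Real.pi * inner ℝ p x : ℝ) : ℂ) * Complex.I := by
    push_cast; ring
  rw [planeWave, h, Complex.norm_exp_ofReal_mul_I]

lemma memLp_planeWave {d : ℕ} (L : ℝ) (p : Space d) :
    MemLp (planeWave p) 2 ((volume : Measure (Space d)).restrict (box d L)) :=
  MemLp.of_bound (continuous_planeWave p).aestronglyMeasurable 1
    (Filter.Eventually.of_forall fun x => (norm_planeWave p x).le)

/-- The plane wave as an element of `L²(Λ_L)`. -/
def planeWaveLp {d : ℕ} (L : ℝ) (p : Space d) : BoxL2 d L := (memLp_planeWave L p).toLp _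

/-- The Fourier coefficient `f̂(p) = ∫_{Λ_L} e^{-2πi p·x} f(x) dx`, at `p = m / L`. -/
def fourierCoeff {d : ℕ} {L : ℝ} (f : BoxL2 d L) (m : Fin d → ℤ) : ℂ :=
  ∫ x in box d L,
    Complex.exp (-(2 * Real.pi * Complex.I * (inner ℝ (dualPoint L m) x : ℝ))) * f x

/-- The inverse `ǧ = |Λ_L|⁻¹ ∑_p g(p) e^{2πi p·x}`, the series being taken in `L²(Λ_L)`. -/
def invFourier {d : ℕ} (L : ℝ) (g : (Fin d → ℤ) → ℂ) : BoxL2 d L :=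
  ∑' m, ((boxVolume d L : ℂ)⁻¹ * g m) • planeWaveLp L (dualPoint L m)

lemma conj_planeWave {d : ℕ} (p x : Space d) :
    (starRingEnd ℂ) (planeWave p x)
      = Complex.exp (-(2 * Real.pi * Complex.I * (inner ℝ p x : ℝ))) := by
  rw [planeWave, ← Complex.exp_conj]
  congr 1
  rw [map_mul, map_mul, map_mul, Complex.conj_I, Complex.conj_ofReal, Complex.conj_ofReal,
    Complex.conj_ofNat]
  ring

lemma fourierCoeff_eq_inner {d : ℕ} {L : ℝ} (f : BoxL2 d L) (m : Fin d → ℤ) :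
    fourierCoeff f m = inner ℂ (planeWaveLp L (dualPoint L m)) f := by
  rw [fourierCoeff, L2.inner_def]
  refine integral_congr_ae ?_
  filter_upwards [(memLp_planeWave L (dualPoint L m)).coeFn_toLp] with x hx
  rw [planeWaveLp, hx, ← conj_planeWave, RCLike.inner_apply, mul_comm]

lemma fourierCoeff_add {d : ℕ} {L : ℝ} (f g : BoxL2 d L) :
    fourierCoeff (f + g) = fourierCoeff f + fourierCoeff g := by
  ext m
  simp [fourierCoeff_eq_inner, inner_add_right]

lemma fourierCoeff_smul {d : ℕ} {L : ℝ} (c : ℂ) (f : BoxL2 d L) :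
    fourierCoeff (c • f) = c • fourierCoeff f := by
  ext m
  simp [fourierCoeff_eq_inner, inner_smul_right]

lemma integral_exp_eq_zero {L : ℝ} (hL : 0 < L) {k : ℤ} (hk : k ≠ 0) :
    ∫ x in Set.Ico (-(L / 2)) (L / 2), Complex.exp (2 * Real.pi * Complex.I * (k / L) * (x : ℂ)) = 0 := by
  have hL' : (L : ℂ) ≠ 0 := by exact_mod_cast hL.ne'
  have hk' : (k : ℂ) ≠ 0 := by exact_mod_cast hk
  have hpi : (Real.pi : ℂ) ≠ 0 := by exact_mod_cast Real.pi_ne_zero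
  have hc : (2 * Real.pi * Complex.I * (k / L) : ℂ) ≠ 0 := by
    simp [hL', hk', Complex.I_ne_zero, hpi]
  rw [integral_Ico_eq_integral_Ioc, ← intervalIntegral.integral_of_le (by linarith),
    integral_exp_mul_complex hc, div_eq_zero_iff]
  left
  rw [sub_eq_zero, Complex.exp_eq_exp_iff_exists_int]
  refine ⟨k, ?_⟩
  push_cast
  field_simp
  ring

/-- Different plane waves with momenta in the dual lattice are orthogonal. -/
lemma inner_planeWaveLp {d : ℕ} {L : ℝ} (hL : 0 < L) {m n : Fin d → ℤ} (hmn : m ≠ n) :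
    inner ℂ (planeWaveLp L (dualPoint L m)) (planeWaveLp L (dualPoint L n)) = 0 := by
  obtain ⟨j, hj⟩ := Function.ne_iff.1 hmn
  have h1 : inner ℂ (planeWaveLp L (dualPoint L m)) (planeWaveLp L (dualPoint L n)) =
      ∫ x in box d L, (fun y : Fin d → ℝ => ∏ i, Complex.exp
        (2 * Real.pi * Complex.I * ((n i - m i : ℤ) / L) * (y i : ℂ))) (fun i => x i) := by
    rw [L2.inner_def]
    refine integral_congr_ae ?_
    filter_upwards [(memLp_planeWave L (dualPoint L m)).coeFn_toLp,
      (memLp_planeWave L (dualPoint L n)).coeFn_toLp] with x hx hy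
    rw [planeWaveLp, planeWaveLp, hx, hy, RCLike.inner_apply, conj_planeWave, planeWave,
      ← Complex.exp_add, ← Complex.exp_sum]
    congr 1
    simp only [dualPoint, PiLp.inner_apply, RCLike.inner_apply, conj_trivial, Complex.ofReal_sum,
      Finset.mul_sum, ← Finset.sum_neg_distrib, ← Finset.sum_add_distrib]
    refine Finset.sum_congr rfl fun i _ => ?_
    push_cast
    ring
  rw [h1, integral_box d L (fun y : Fin d → ℝ => ∏ i, Complex.exp
    (2 * Real.pi * Complex.I * ((n i - m i : ℤ) / L) * (y i : ℂ))), integral_fintype_prod_eq_prod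
    (fun i (t : ℝ) => Complex.exp (2 * Real.pi * Complex.I * ((n i - m i : ℤ) / L) * (t : ℂ)))]
  exact Finset.prod_eq_zero (Finset.mem_univ j)
    (integral_exp_eq_zero hL (sub_ne_zero.2 (Ne.symm hj)))

lemma norm_planeWaveLp {d : ℕ} (L : ℝ) (p : Space d) :
    ‖planeWaveLp L p‖ = ‖planeWaveLp L (0 : Space d)‖ := by
  simp only [planeWaveLp, Lp.norm_toLp]
  congr 1
  exact eLpNorm_congr_norm_ae
    (Filter.Eventually.of_forall fun x => by rw [norm_planeWave, norm_planeWave])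

/-- Fourier series with `ℓ²` coefficients converge in `L²(Λ_L)`. -/
lemma summable_fourier {d : ℕ} {L : ℝ} (hL : 0 < L) {g : (Fin d → ℤ) → ℂ} (hg : Memℓp g 2) :
    Summable fun m => ((boxVolume d L : ℂ)⁻¹ * g m) • planeWaveLp L (dualPoint L m) := by
  have horth : OrthogonalFamily ℂ
      (fun m : Fin d → ℤ => Submodule.span ℂ {planeWaveLp L (dualPoint L m)})
      (fun m => (Submodule.span ℂ {planeWaveLp L (dualPoint L m)}).subtypeₗᵢ) := by
    intro m n hmn u v
    obtain ⟨a, ha⟩ := Submodule.mem_span_singleton.1 u.2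
    obtain ⟨b, hb⟩ := Submodule.mem_span_singleton.1 v.2
    change inner ℂ (u : BoxL2 d L) (v : BoxL2 d L) = 0
    rw [← ha, ← hb, inner_smul_left, inner_smul_right, inner_planeWaveLp hL hmn]
    simp
  refine (horth.summable_iff_norm_sq_summable fun m =>
    ⟨((boxVolume d L : ℂ)⁻¹ * g m) • planeWaveLp L (dualPoint L m),
      Submodule.smul_mem _ _ (Submodule.mem_span_singleton_self _)⟩).2 ?_
  have h2 := (memℓp_gen_iff (by norm_num)).1 hg
  refine (h2.mul_left ((‖(boxVolume d L : ℂ)⁻¹‖ * ‖planeWaveLp L (0 : Space d)‖) ^ 2)).congr ?_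
  intro m
  rw [Submodule.coe_norm, norm_smul, norm_mul, norm_planeWaveLp L (dualPoint L m)]
  simp only [ENNReal.toReal_ofNat, Real.rpow_ofNat]
  ring

lemma invFourier_add {d : ℕ} {L : ℝ} (hL : 0 < L) {g h : (Fin d → ℤ) → ℂ}
    (hg : Memℓp g 2) (hh : Memℓp h 2) :
    invFourier L (g + h) = invFourier L g + invFourier L h := by
  rw [invFourier, invFourier, invFourier,
    ← (summable_fourier hL hg).tsum_add (summable_fourier hL hh)]
  exact tsum_congr fun m => by rw [Pi.add_apply, mul_add, add_smul]

lemma invFourier_smul {d : ℕ} {L : ℝ} (hL : 0 < L) (c : ℂ) {g : (Fin d → ℤ) → ℂ}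
    (hg : Memℓp g 2) : invFourier L (c • g) = c • invFourier L g := by
  rw [invFourier, invFourier, ← (summable_fourier hL hg).tsum_const_smul c]
  exact tsum_congr fun m => by rw [Pi.smul_apply, smul_eq_mul, smul_smul]; congr 1; ring

/-! ### The free Hamiltonian -/

/-- The energy function `ν(p) = p² / 2`. -/
def energy {d : ℕ} (p : Space d) : ℝ := ‖p‖ ^ 2 / 2

/-- The sequence `ν f̂` on the dual lattice. -/
def energyCoeff {d : ℕ} {L : ℝ} (f : BoxL2 d L) (m : Fin d → ℤ) : ℂ :=
  (energy (dualPoint L m) : ℂ) * fourierCoeff f m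

lemma energyCoeff_add {d : ℕ} {L : ℝ} (f g : BoxL2 d L) :
    energyCoeff (f + g) = energyCoeff f + energyCoeff g := by
  ext m
  simp [energyCoeff, fourierCoeff_add, mul_add]

lemma energyCoeff_smul {d : ℕ} {L : ℝ} (c : ℂ) (f : BoxL2 d L) :
    energyCoeff (c • f) = c • energyCoeff f := by
  ext m
  simp only [energyCoeff, fourierCoeff_smul, Pi.smul_apply, smul_eq_mul]
  ring

/-- The periodic Laplacian `-Δ_L` on `L²(Λ_L)`: it multiplies `f̂(p)` by `|2πp|² = 2 (2π)² ν(p)`,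
on the domain of all `f` with `ν f̂ ∈ ℓ²(Λ_L^*)`. -/
def negLaplacian (d : ℕ) {L : ℝ} (hL : 0 < L) : BoxL2 d L →ₗ.[ℂ] BoxL2 d L where
  domain :=
    { carrier := {f | Memℓp (energyCoeff f) 2}
      add_mem' := fun {f g} hf hg => by
        simp only [Set.mem_ofPred_eq] at hf hg ⊢
        rw [energyCoeff_add]
        exact hf.add hg
      zero_mem' := by
        have h : energyCoeff (0 : BoxL2 d L) = 0 := by
          simpa using energyCoeff_smul 0 (0 : BoxL2 d L)
        simp only [Set.mem_ofPred_eq]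
        rw [h]
        exact zero_memℓp
      smul_mem' := fun c f hf => by
        simp only [Set.mem_ofPred_eq] at hf ⊢
        rw [energyCoeff_smul]
        exact hf.const_smul c }
  toFun :=
    { toFun := fun f => (2 * (2 * Real.pi) ^ 2 : ℂ) • invFourier L (energyCoeff (f : BoxL2 d L))
      map_add' := fun f g => by
        rw [Submodule.coe_add, energyCoeff_add, invFourier_add hL f.2 g.2, smul_add]
      map_smul' := fun c f => by
        rw [Submodule.coe_smul, energyCoeff_smul, invFourier_smul hL c f.2, RingHom.id_apply,
          smul_comm] }

/-- The free Hamiltonian `-(ħ²/2m) Δ_L` in units with `ħ²/2m = 1 / (2 (2π)²)`; it acts as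
multiplication by `ν` on the Fourier side. -/
def freeHamiltonian (d : ℕ) {L : ℝ} (hL : 0 < L) : BoxL2 d L →ₗ.[ℂ] BoxL2 d L :=
  (1 / (2 * (2 * Real.pi) ^ 2) : ℂ) • negLaplacian d hL

/-! ### The random potential -/

/-- The representative in `Λ_L` of a point modulo the lattice `(Lℤ)^d`. -/
def wrap {d : ℕ} (L : ℝ) (x : Space d) : Space d :=
  WithLp.toLp 2 fun j => x j - L * (⌊x j / L + 1 / 2⌋ : ℤ)

/-- The `L`-periodic extension `h_#` of the restriction of `h` to `Λ_L`. -/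
def periodize {d : ℕ} {β : Type} (L : ℝ) (h : Space d → β) : Space d → β := fun x => h (wrap L x)

/-- Configurations `(M, (y_γ), (v_γ))` of the random points and weights. -/
abbrev Config (d : ℕ) : Type := ℕ × (ℕ → Space d) × (ℕ → ℝ)

/-- The joint law of `(M, (y_γ), (v_γ))`: `M` is Poisson with mean `|Λ_L|`, the points `y_γ` are
i.i.d. uniform on `Λ_L`, the weights `v_γ` are i.i.d. with law `ρ`, and all are independent. -/
def configLaw (d : ℕ) (L : ℝ) (ρ : Measure ℝ) : Measure (Config d) :=
  (ProbabilityTheory.poissonMeasure (boxVolume d L).toNNReal).prod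
    ((Measure.infinitePi fun _ : ℕ =>
        ProbabilityTheory.cond (volume : Measure (Space d)) (box d L)).prod
      (Measure.infinitePi fun _ : ℕ => ρ))

/-- The potential `V_L(x) = ∑_{γ ≤ M} v_γ B_#(x - y_γ)`; the points are numbered from `0`. -/
def randomPotential {d : ℕ} (L : ℝ) (B : 𝓢(Space d, ℝ)) (ω : Config d) (x : Space d) : ℝ :=
  ∑ γ ∈ Finset.range ω.1, ω.2.2 γ * periodize L B (x - ω.2.1 γ)

lemma measurable_wrap {d : ℕ} (L : ℝ) : Measurable (wrap L : Space d → Space d) := by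
  refine (WithLp.measurable_toLp 2 (Fin d → ℝ)).comp (measurable_pi_lambda _ fun j => ?_)
  have hj : Measurable fun x : Space d => x j := by fun_prop
  have hfl : Measurable fun x : Space d => ((⌊x j / L + 1 / 2⌋ : ℤ) : ℝ) :=
    (measurable_from_top (f := fun n : ℤ => (n : ℝ))).comp
      (Int.measurable_floor.comp ((hj.div_const L).add_const _))
  exact hj.sub (hfl.const_mul L)

lemma measurable_randomPotential {d : ℕ} (L : ℝ) (B : 𝓢(Space d, ℝ)) (ω : Config d) :
    Measurable (randomPotential L B ω) := by
  unfold randomPotential periodize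
  refine Finset.measurable_sum _ fun γ _ => Measurable.const_mul ?_ _
  exact B.continuous.measurable.comp ((measurable_wrap L).comp (measurable_id.sub_const _))

lemma memLp_randomPotential {d : ℕ} (L : ℝ) (B : 𝓢(Space d, ℝ)) (ω : Config d) :
    MemLp (fun x => (randomPotential L B ω x : ℂ)) ∞
      ((volume : Measure (Space d)).restrict (box d L)) := by
  obtain ⟨C, hC⟩ : ∃ C : ℝ, ∀ x, ‖B x‖ ≤ C :=
    ⟨_, fun x => B.toBoundedContinuousFunction.norm_coe_le_norm x⟩
  refine memLp_top_of_bound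
    (Complex.measurable_ofReal.comp (measurable_randomPotential L B ω)).aestronglyMeasurable
    (∑ γ ∈ Finset.range ω.1, ‖ω.2.2 γ‖ * C) (Filter.Eventually.of_forall fun x => ?_)
  rw [Complex.norm_real]
  refine (norm_sum_le _ _).trans (Finset.sum_le_sum fun γ _ => ?_)
  rw [norm_mul]
  exact mul_le_mul_of_nonneg_left (hC _) (norm_nonneg _)

/-- Multiplication by the potential `V_L`, as a bounded operator on `L²(Λ_L)`. -/
def potentialOp {d : ℕ} (L : ℝ) (B : 𝓢(Space d, ℝ)) (ω : Config d) : BoxL2 d L →L[ℂ] BoxL2 d L :=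
  (ContinuousLinearMap.mul ℂ ℂ).holderL ((volume : Measure (Space d)).restrict (box d L)) ∞ 2 2
    ((memLp_randomPotential L B ω).toLp _)

/-- The random Schrödinger operator `H_λ = -(ħ²/2m) Δ_L + λ V_L` on the domain of `Δ_L`. -/
def hamiltonian {d : ℕ} {L : ℝ} (hL : 0 < L) (B : 𝓢(Space d, ℝ)) (lam : ℝ) (ω : Config d) :
    BoxL2 d L →ₗ.[ℂ] BoxL2 d L :=
  ((lam : ℂ) • potentialOp L B ω : BoxL2 d L →L[ℂ] BoxL2 d L).toLinearMap +ᵥ freeHamiltonian d hL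

/-! ### Resolvents -/

section Resolvent

variable {X : Type} [NormedAddCommGroup X] [NormedSpace ℂ X]

/-- `R` is a bounded two-sided inverse of `A - z : D(A) → X`. -/
def IsResolvent (A : X →ₗ.[ℂ] X) (z : ℂ) (R : X →L[ℂ] X) : Prop :=
  (∀ f : A.domain, R (A f - z • (f : X)) = f) ∧
    ∀ g : X, ∃ h : R g ∈ A.domain, A ⟨R g, h⟩ - z • R g = g

/-- `z` lies in the resolvent set of `A`. -/
def InResolventSet (A : X →ₗ.[ℂ] X) (z : ℂ) : Prop := ∃ R : X →L[ℂ] X, IsResolvent A z R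

open Classical in
/-- The resolvent `(A - z)⁻¹`, for `z` in the resolvent set (and `0` otherwise). -/
def resolventOp (A : X →ₗ.[ℂ] X) (z : ℂ) : X →L[ℂ] X :=
  if h : InResolventSet A z then h.choose else 0

lemma IsResolvent.unique {A : X →ₗ.[ℂ] X} {z : ℂ} {R S : X →L[ℂ] X}
    (hR : IsResolvent A z R) (hS : IsResolvent A z S) : R = S := by
  ext g
  obtain ⟨h, hg⟩ := hS.2 g
  have := hR.1 ⟨S g, h⟩
  rwa [hg] at this

lemma IsResolvent.resolventOp_eq {A : X →ₗ.[ℂ] X} {z : ℂ} {R : X →L[ℂ] X}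
    (hR : IsResolvent A z R) : resolventOp A z = R := by
  have h : InResolventSet A z := ⟨R, hR⟩
  rw [resolventOp, dif_pos h]
  exact h.choose_spec.unique hR

end Resolvent

/-! ### The expansion coefficients -/

/-- The element `ψ_#` of `L²(Λ_L)` given by the restriction to `Λ_L` of `ψ ∈ L²(ℝ^d)`. -/
def toBox {d : ℕ} (L : ℝ) (ψ : Lp ℂ 2 (volume : Measure (Space d))) : BoxL2 d L :=
  LpToLpRestrictCLM (Space d) ℂ ℂ volume 2 (box d L) ψ

/-- The matrix element `⟨ψ_{1,#}, R_L(z) [V_L R_L(z)]^n ψ_{2,#}⟩` for a given configuration. -/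
def neumannElement {d : ℕ} {L : ℝ} (hL : 0 < L) (B : 𝓢(Space d, ℝ)) (n : ℕ) (z : ℂ)
    (ψ₁ ψ₂ : Lp ℂ 2 (volume : Measure (Space d))) (ω : Config d) : ℂ :=
  inner ℂ (toBox L ψ₁)
    ((resolventOp (freeHamiltonian d hL) z *
      (potentialOp L B ω * resolventOp (freeHamiltonian d hL) z) ^ n) (toBox L ψ₂))

/-- `T_{n,L}[z; ψ₁, ψ₂] = E_L ⟨ψ_{1,#}, R_L(z) [V_L R_L(z)]^n ψ_{2,#}⟩`. -/
def coeffT {d : ℕ} {L : ℝ} (hL : 0 < L) (B : 𝓢(Space d, ℝ)) (ρ : Measure ℝ) (n : ℕ) (z : ℂ)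
    (ψ₁ ψ₂ : Lp ℂ 2 (volume : Measure (Space d))) : ℂ :=
  ∫ ω, neumannElement hL B n z ψ₁ ψ₂ ω ∂(configLaw d L ρ)

/-- A regularization function: smooth with values in `[0,1]`, equal to `1` on `[-1,1]` and
vanishing for `|t| ≥ 2`. -/
structure IsCutoff (χ : ℝ → ℝ) : Prop where
  smooth : ContDiff ℝ ((⊤ : ℕ∞) : WithTop ℕ∞) χ
  mem_Icc : ∀ t, χ t ∈ Set.Icc (0 : ℝ) 1
  eq_one : ∀ t ∈ Set.Icc (-1 : ℝ) 1, χ t = 1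
  eq_zero : ∀ t, 2 ≤ |t| → χ t = 0

/-- `a(η, ε) = η / (|ln(ηε/2)| + 1)`. -/
def cutoffScale (η ε : ℝ) : ℝ := η / (|Real.log (η * ε / 2)| + 1)

/-- The Fourier transform of `χ_a(t) = χ(a t)`, that is
`α ↦ ∫ χ(a t) e^{-2πi α t} dt`. -/
def cutoffHat (χ : ℝ → ℝ) (a : ℝ) : ℝ → ℂ := 𝓕 fun t : ℝ => (χ (a * t) : ℂ)

/-- The integrand `α ↦ χ̂_a(α) T_{n,L}[E + iη + 2πα; ψ₁, ψ₂]`, with `a = a(η, ε)`. -/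
def smearedIntegrand {d : ℕ} {L : ℝ} (hL : 0 < L) (B : 𝓢(Space d, ℝ)) (ρ : Measure ℝ)
    (χ : ℝ → ℝ) (n : ℕ) (E η ε : ℝ) (ψ₁ ψ₂ : Lp ℂ 2 (volume : Measure (Space d))) (α : ℝ) : ℂ :=
  cutoffHat χ (cutoffScale η ε) α *
    coeffT hL B ρ n (E + η * Complex.I + 2 * Real.pi * α) ψ₁ ψ₂

/-- `S_{n,L}[E + iη; χ; ψ₁, ψ₂; ε] = (-1)^n ∫ χ̂_a(α) T_{n,L}[E + iη + 2πα; ψ₁, ψ₂] dα`. -/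
def coeffS {d : ℕ} {L : ℝ} (hL : 0 < L) (B : 𝓢(Space d, ℝ)) (ρ : Measure ℝ)
    (χ : ℝ → ℝ) (n : ℕ) (E η ε : ℝ) (ψ₁ ψ₂ : Lp ℂ 2 (volume : Measure (Space d))) : ℂ :=
  (-1) ^ n * ∫ α : ℝ, smearedIntegrand hL B ρ χ n E η ε ψ₁ ψ₂ α

/-- The matrix element `⟨ψ_{1,#}, (H_λ - z)⁻¹ ψ_{2,#}⟩` for a given configuration. -/
def resolventElement {d : ℕ} {L : ℝ} (hL : 0 < L) (B : 𝓢(Space d, ℝ)) (lam : ℝ) (z : ℂ)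
    (ψ₁ ψ₂ : Lp ℂ 2 (volume : Measure (Space d))) (ω : Config d) : ℂ :=
  inner ℂ (toBox L ψ₁) (resolventOp (hamiltonian hL B lam ω) z (toBox L ψ₂))

/-! ### Hypotheses -/

/-- The reflection `x_j ↦ -x_j`. -/
def reflectCoord {d : ℕ} (j : Fin d) (x : Space d) : Space d :=
  WithLp.toLp 2 fun i => if i = j then -x i else x i

/-- The single site profile has compact support, or is symmetric under all the reflections of the
coordinate axes. -/
def IsAdmissibleProfile {d : ℕ} (B : 𝓢(Space d, ℝ)) : Prop :=
  HasCompactSupport (B : Space d → ℝ) ∨ ∀ (j : Fin d) (x : Space d), B (reflectCoord j x) = B x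

/-- All absolute moments of the law `ρ` of the weights exist and are bounded by one constant. -/
def HasUniformlyBoundedMoments (ρ : Measure ℝ) : Prop :=
  ∃ C : ℝ, ∀ n : ℕ, Integrable (fun v : ℝ => |v| ^ n) ρ ∧ ∫ v, |v| ^ n ∂ρ ≤ C

end PoissonSchrodinger

end

open PoissonSchrodinger

/-!
Expansion of the averaged resolvent of a periodic Schrödinger operator with Poisson obstacles.

For a fixed configuration the resolvent at `z = E + iη` is `i ∫_0^∞ e^{izt} e^{-itH_λ} dt`
(`IsDiagonal.exists_isResolvent_vadd`). Multiplying the integrand by the cutoff `χ(at)` costs at most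
`e^{-η/a} / η`, since `e^{-itH_λ}` is unitary, and `a(η, ε)` is chosen such that this is at most
`ε / 2` (`exp_div_cutoffScale_le`). Only times `t ≤ 2 / a` are left, on which the Dyson series of
`e^{-itH_λ}` converges in operator norm, however large the potential is. By Fourier inversion the
cutoff amounts to smearing the spectral parameter with `χ̂_a`, and the `n`-th term of the cut-off
Dyson series is the smeared `n`-th term of the Neumann series (`IsCutoff.smear_laplace`,
`laplace_dyson`, `exists_hasSum_smeared`). As a function of the potentials `V_1, …, V_n` in the `n`
places this smeared term is multilinear, and the time ordering bounds it by
`(2/a)^{n+1} / n! ∏ ‖V_i‖` (`norm_integral_smearedProdIntegrand_le`). Taking expectations yields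
`E ⟨ψ₁, (H_λ - z)⁻¹ ψ₂⟩ = ∑_n λⁿ S_n` up to `ε / 2`, and it remains to bound the tail of the series
uniformly in the size `L` of the box.

The operator norm of `V_L` is of no use for large `L`, as the number of points is of order `|Λ_L|`.
Instead `V_L = ∑_k β_k Φ(k) e_k` is expanded in plane waves `e_k`, with `β_k` the Fourier coefficients
of the periodized profile and `Φ(k) = ∑_γ v_γ e_k(-y_γ)`. As plane waves have norm one, the `n`-th
term is at most `(2/a)^{n+1} / n!` times `∑_κ ∏_i |β_{κ_i}| |E ∏_i Φ(κ_i)|`. Bounded moments force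
`|v_γ| ≤ 1` almost surely (`HasUniformlyBoundedMoments.ae_abs_le_one`), and the correlations of the
modes of the unweighted points are nonnegative and dominate those of `Φ`
(`exists_integral_prod_mode`). Hence the sum is at most the `n`-th moment of `Y = ∑_γ b(y_γ)` with
`b = ∑_k |β_k| e_k(-·)`, and all moments of `Y` are nonnegative, so
`sⁿ / n! E Yⁿ ≤ E e^{sY} = exp (|Λ_L| (⟨e^{sb}⟩ - 1))` by the generating functional of the Poisson
process, with `⟨·⟩` the mean over the box (`sum_norm_integral_weightedMode_le`). The exponent is
bounded uniformly in `L`, because `∑_k |β_k| ≤ K` and `|β_k| ≤ K / |Λ_L|`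
(`IsAdmissibleProfile.exists_bounds`). This last estimate is where the profile has to be admissible:
in a large box its values on opposite faces agree, so integration by parts with `∏_j (1 + ∂_j)`
produces no boundary terms, and Bessel's inequality applies. Boxes of bounded size are covered by the
operator norm. As `s` is arbitrary, the `n`-th term decays like `2⁻ⁿ`, with a constant that does not
depend on `L` (`exists_norm_integral_smearedTerm_le`).
-/

noncomputable section

namespace PoissonSchrodinger

/-! ### Diagonal operators in a Hilbert basis -/

section Diagonal

variable {X ι : Type*} [NormedAddCommGroup X] [InnerProductSpace ℂ X]

lemma hilbertBasis_ext (b : HilbertBasis ι ℂ X) {x y : X}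
    (h : ∀ i, inner ℂ (b i) x = inner ℂ (b i) y) : x = y := by
  apply b.repr.injective
  ext i
  simpa [b.repr_apply_apply] using h i

lemma hasSum_normSq_coord (b : HilbertBasis ι ℂ X) (x : X) :
    HasSum (fun i => ‖inner ℂ (b i) x‖ ^ 2) (‖x‖ ^ 2) := by
  have h := lp.hasSum_norm (p := 2) (by norm_num) (b.repr x)
  simpa [b.repr_apply_apply] using h

lemma memℓp_mul_coord (b : HilbertBasis ι ℂ X) {m : ι → ℂ} {C : ℝ} (hm : ∀ i, ‖m i‖ ≤ C) (x : X) :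
    Memℓp (fun i => m i * inner ℂ (b i) x) 2 := by
  refine (memℓp_gen_iff (by norm_num)).2 ?_
  simp only [ENNReal.toReal_ofNat, Real.rpow_ofNat, norm_mul, mul_pow]
  refine Summable.of_nonneg_of_le (fun i => by positivity) (fun i => ?_)
    ((hasSum_normSq_coord b x).summable.mul_left (C ^ 2))
  gcongr
  exact hm i

open Classical in
/-- The vector with the square summable coordinates `g` in the Hilbert basis `b`; it is `0` when `g`
is not square summable. -/
def ofCoord (b : HilbertBasis ι ℂ X) (g : ι → ℂ) : X :=
  if hg : Memℓp g 2 then b.repr.symm ⟨g, hg⟩ else 0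

lemma inner_ofCoord (b : HilbertBasis ι ℂ X) {g : ι → ℂ} (hg : Memℓp g 2) (i : ι) :
    inner ℂ (b i) (ofCoord b g) = g i := by
  rw [ofCoord, dif_pos hg, ← b.repr_apply_apply, LinearIsometryEquiv.apply_symm_apply]

lemma norm_le_of_coord_le (b : HilbertBasis ι ℂ X) {x y : X} {C : ℝ} (hC : 0 ≤ C)
    (h : ∀ i, ‖inner ℂ (b i) x‖ ≤ C * ‖inner ℂ (b i) y‖) : ‖x‖ ≤ C * ‖y‖ := by
  have h2 : ‖x‖ ^ 2 ≤ (C * ‖y‖) ^ 2 := by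
    rw [mul_pow]
    refine hasSum_le (fun i => ?_) (hasSum_normSq_coord b x)
      ((hasSum_normSq_coord b y).mul_left (C ^ 2))
    rw [← mul_pow]
    exact pow_le_pow_left₀ (norm_nonneg _) (h i) 2
  exact le_of_sq_le_sq h2 (by positivity)

open Classical in
/-- The bounded operator which is multiplication by the bounded sequence `m` in the Hilbert basis
`b`; it is `0` when `m` is unbounded. -/
def diagOp (b : HilbertBasis ι ℂ X) (m : ι → ℂ) : X →L[ℂ] X :=
  if hm : ∃ C, 0 ≤ C ∧ ∀ i, ‖m i‖ ≤ C then
    LinearMap.mkContinuous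
      { toFun := fun x => ofCoord b fun i => m i * inner ℂ (b i) x
        map_add' := fun x y => hilbertBasis_ext b fun i => by
          rw [inner_add_right, inner_ofCoord b (memℓp_mul_coord b hm.choose_spec.2 _),
            inner_ofCoord b (memℓp_mul_coord b hm.choose_spec.2 _),
            inner_ofCoord b (memℓp_mul_coord b hm.choose_spec.2 _), inner_add_right, mul_add]
        map_smul' := fun c x => hilbertBasis_ext b fun i => by
          rw [RingHom.id_apply, inner_smul_right,
            inner_ofCoord b (memℓp_mul_coord b hm.choose_spec.2 _),
            inner_ofCoord b (memℓp_mul_coord b hm.choose_spec.2 _), inner_smul_right]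
          ring }
      hm.choose fun x => norm_le_of_coord_le b hm.choose_spec.1 fun i => by
        simp only [LinearMap.coe_mk, AddHom.coe_mk]
        rw [inner_ofCoord b (memℓp_mul_coord b hm.choose_spec.2 _), norm_mul]
        exact mul_le_mul_of_nonneg_right (hm.choose_spec.2 i) (norm_nonneg _)
  else 0

lemma inner_diagOp (b : HilbertBasis ι ℂ X) {m : ι → ℂ} {C : ℝ} (hm : ∀ i, ‖m i‖ ≤ C)
    (x : X) (i : ι) : inner ℂ (b i) (diagOp b m x) = m i * inner ℂ (b i) x := by
  have h : ∃ C, 0 ≤ C ∧ ∀ i, ‖m i‖ ≤ C :=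
    ⟨C, (norm_nonneg _).trans (hm i), hm⟩
  rw [diagOp, dif_pos h]
  simp only [LinearMap.mkContinuous_apply, LinearMap.coe_mk, AddHom.coe_mk]
  exact inner_ofCoord b (memℓp_mul_coord b h.choose_spec.2 x) i

lemma norm_diagOp_apply_le (b : HilbertBasis ι ℂ X) {m : ι → ℂ} {C : ℝ} (hC : 0 ≤ C)
    (hm : ∀ i, ‖m i‖ ≤ C) (x : X) : ‖diagOp b m x‖ ≤ C * ‖x‖ :=
  norm_le_of_coord_le b hC fun i => by
    rw [inner_diagOp b hm, norm_mul]
    exact mul_le_mul_of_nonneg_right (hm i) (norm_nonneg _)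

lemma norm_diagOp_le (b : HilbertBasis ι ℂ X) {m : ι → ℂ} {C : ℝ} (hC : 0 ≤ C)
    (hm : ∀ i, ‖m i‖ ≤ C) : ‖diagOp b m‖ ≤ C :=
  ContinuousLinearMap.opNorm_le_bound _ hC (norm_diagOp_apply_le b hC hm)

/-! ### The free evolution and the free resolvent -/

/-- The unitary evolution `e^{-itA}` of the operator `A` with eigenbasis `b` and eigenvalues `ν`. -/
def evolution (b : HilbertBasis ι ℂ X) (ν : ι → ℝ) (t : ℝ) : X →L[ℂ] X :=
  diagOp b fun i => Complex.exp (((-(t * ν i) : ℝ) : ℂ) * Complex.I)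

/-- The resolvent `(A - w)⁻¹` of the operator `A` with eigenbasis `b` and eigenvalues `ν`, for
non-real `w`. -/
def diagResolvent (b : HilbertBasis ι ℂ X) (ν : ι → ℝ) (w : ℂ) : X →L[ℂ] X :=
  diagOp b fun i => ((ν i : ℂ) - w)⁻¹

variable (b : HilbertBasis ι ℂ X) (ν : ι → ℝ)

lemma inner_evolution (t : ℝ) (x : X) (i : ι) : inner ℂ (b i) (evolution b ν t x)
    = Complex.exp (((-(t * ν i) : ℝ) : ℂ) * Complex.I) * inner ℂ (b i) x :=
  inner_diagOp b (fun _ => (Complex.norm_exp_ofReal_mul_I _).le) x i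

@[simp]
lemma evolution_zero (x : X) : evolution b ν 0 x = x :=
  hilbertBasis_ext b fun i => by simp [inner_evolution]

lemma evolution_add (s t : ℝ) (x : X) :
    evolution b ν (s + t) x = evolution b ν s (evolution b ν t x) :=
  hilbertBasis_ext b fun i => by
    rw [inner_evolution, inner_evolution, inner_evolution, ← mul_assoc, ← Complex.exp_add]
    congr 2
    push_cast
    ring

@[simp]
lemma norm_evolution (t : ℝ) (x : X) : ‖evolution b ν t x‖ = ‖x‖ := by
  have h : ∀ (t : ℝ) (x : X), ‖evolution b ν t x‖ ≤ ‖x‖ := fun t x => by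
    rw [← one_mul ‖x‖]
    exact norm_diagOp_apply_le b zero_le_one
      (fun j => (Complex.norm_exp_ofReal_mul_I (-(t * ν j))).le) x
  refine le_antisymm (h t x) ?_
  have := h (-t) (evolution b ν t x)
  rwa [← evolution_add, neg_add_cancel, evolution_zero] at this

lemma inner_evolution_evolution (t : ℝ) (x y : X) :
    inner ℂ (evolution b ν t x) (evolution b ν t y) = inner ℂ x y := by
  let T : X →ₗᵢ[ℂ] X := ⟨(evolution b ν t).toLinearMap, norm_evolution b ν t⟩
  exact T.inner_map_map x y

lemma continuous_evolution_apply (x : X) : Continuous fun t => evolution b ν t x := by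
  refine TendstoUniformly.continuous (p := Filter.atTop)
    (F := fun (s : Finset ι) t => ∑ i ∈ s, evolution b ν t (b.repr x i • b i)) ?_ ?_
  · rw [Metric.tendstoUniformly_iff]
    intro r hr
    filter_upwards [(Metric.tendsto_nhds.1 (b.hasSum_repr x)) r hr] with s hs t
    rw [← map_sum, dist_eq_norm, ← map_sub, norm_evolution, ← dist_eq_norm, dist_comm]
    exact hs
  · refine Filter.Frequently.of_forall fun s => continuous_finsetSum _ fun i _ => ?_
    have h : (fun t => evolution b ν t (b.repr x i • b i)) = fun t : ℝ =>
        (Complex.exp (((-(t * ν i) : ℝ) : ℂ) * Complex.I)) • (b.repr x i • b i) := by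
      funext t
      refine hilbertBasis_ext b fun j => ?_
      rw [inner_evolution, inner_smul_right, inner_smul_right]
      by_cases hij : j = i
      · rw [hij, inner_smul_right]
      · rw [inner_smul_right, b.orthonormal.2 hij]; simp
    rw [h]
    fun_prop

lemma continuous_evolution : Continuous fun p : ℝ × X => evolution b ν p.1 p.2 := by
  refine continuous_prod_of_continuous_lipschitzWith' _ 1 (fun t => ?_)
    (fun x => continuous_evolution_apply b ν x)
  refine LipschitzWith.of_dist_le_mul fun x y => ?_
  simp [dist_eq_norm, ← map_sub]

lemma Continuous.evolution {Y : Type*} [TopologicalSpace Y] {f : Y → ℝ} {g : Y → X}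
    (hf : Continuous f) (hg : Continuous g) :
    Continuous fun y => PoissonSchrodinger.evolution b ν (f y) (g y) :=
  (continuous_evolution b ν).comp (hf.prodMk hg)

lemma norm_inv_ofReal_sub_le {w : ℂ} (hw : 0 < w.im) (x : ℝ) : ‖((x : ℂ) - w)⁻¹‖ ≤ w.im⁻¹ := by
  rw [norm_inv]
  refine inv_anti₀ hw ?_
  have := Complex.abs_im_le_norm ((x : ℂ) - w)
  simpa [abs_of_pos hw] using this

lemma ofReal_sub_ne_zero {w : ℂ} (hw : 0 < w.im) (x : ℝ) : (x : ℂ) - w ≠ 0 := fun h => by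
  have := congrArg Complex.im h
  simp at this
  exact hw.ne' this

lemma inner_diagResolvent {w : ℂ} (hw : 0 < w.im) (x : X) (i : ι) :
    inner ℂ (b i) (diagResolvent b ν w x) = ((ν i : ℂ) - w)⁻¹ * inner ℂ (b i) x :=
  inner_diagOp b (fun j => norm_inv_ofReal_sub_le hw (ν j)) x i

lemma norm_diagResolvent_le {w : ℂ} (hw : 0 < w.im) : ‖diagResolvent b ν w‖ ≤ w.im⁻¹ :=
  norm_diagOp_le b (inv_nonneg.2 hw.le) fun j => norm_inv_ofReal_sub_le hw (ν j)

lemma diagResolvent_sub {w w' : ℂ} (hw : 0 < w.im) (hw' : 0 < w'.im) :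
    diagResolvent b ν w - diagResolvent b ν w'
      = (w - w') • (diagResolvent b ν w * diagResolvent b ν w') := by
  ext x
  refine hilbertBasis_ext b fun i => ?_
  simp only [sub_apply, smul_apply, inner_sub_right,
    inner_smul_right, mul_apply_eq_comp, inner_diagResolvent b ν hw,
    inner_diagResolvent b ν hw']
  have h1 := ofReal_sub_ne_zero hw (ν i)
  have h2 := ofReal_sub_ne_zero hw' (ν i)
  field_simp
  ring

lemma continuous_diagResolvent {z : ℂ} (hz : 0 < z.im) :
    Continuous fun α : ℝ => diagResolvent b ν (z + 2 * Real.pi * α) := by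
  have him : ∀ α : ℝ, (z + 2 * Real.pi * α).im = z.im := fun α => by simp
  refine LipschitzWith.continuous (K := (2 * Real.pi * z.im⁻¹ * z.im⁻¹).toNNReal)
    (LipschitzWith.of_dist_le_mul fun α β => ?_)
  have hα : 0 < (z + 2 * Real.pi * α).im := by rw [him]; exact hz
  have hβ : 0 < (z + 2 * Real.pi * β).im := by rw [him]; exact hz
  rw [dist_eq_norm, diagResolvent_sub b ν hα hβ, norm_smul]
  have h1 : ‖(z + 2 * Real.pi * α) - (z + 2 * Real.pi * β)‖ = 2 * Real.pi * dist α β := by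
    have : (z + 2 * Real.pi * α) - (z + 2 * Real.pi * β) = ((2 * Real.pi * (α - β) : ℝ) : ℂ) := by
      push_cast; ring
    rw [this, Complex.norm_real, norm_mul, Real.norm_of_nonneg (by positivity), ← dist_eq_norm]
  have h2 : ‖diagResolvent b ν (z + 2 * Real.pi * α) * diagResolvent b ν (z + 2 * Real.pi * β)‖
      ≤ z.im⁻¹ * z.im⁻¹ := by
    refine (norm_mul_le _ _).trans ?_
    have a1 := norm_diagResolvent_le b ν hα
    have a2 := norm_diagResolvent_le b ν hβ
    rw [him] at a1 a2
    gcongr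
  rw [h1]
  calc 2 * Real.pi * dist α β * _ ≤ 2 * Real.pi * dist α β * (z.im⁻¹ * z.im⁻¹) := by gcongr
    _ = _ := by rw [Real.coe_toNNReal _ (by positivity)]; ring

end Diagonal

section Dyson

variable {X ι : Type*} [NormedAddCommGroup X] [InnerProductSpace ℂ X]
  (b : HilbertBasis ι ℂ X) (ν : ι → ℝ)

/-! ### The time-ordered Duhamel integrals -/

/-- The time-ordered integral, in the interaction picture, of a list of bounded operators:
`∫_{t ≥ s₁ ≥ … ≥ s_n ≥ 0} A₁(s₁) ⋯ A_n(s_n) y ds` with `A(s) = e^{isH₀} A e^{-isH₀}`. -/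
def dyson : List (X →L[ℂ] X) → X → ℝ → X
  | [], y => fun _ => y
  | A :: l, y => fun t =>
      ∫ s in (0 : ℝ)..t, evolution b ν (-s) (A (evolution b ν s (dyson l y s)))

lemma continuous_interaction (A : X →L[ℂ] X) {f : ℝ → X} (hf : Continuous f) :
    Continuous fun s => evolution b ν (-s) (A (evolution b ν s (f s))) :=
  Continuous.evolution b ν continuous_neg
    (A.continuous.comp (Continuous.evolution b ν continuous_id hf))

lemma continuous_dyson (l : List (X →L[ℂ] X)) (y : X) : Continuous (dyson b ν l y) := by
  induction l with
  | nil => exact continuous_const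
  | cons A l ih =>
    exact intervalIntegral.continuous_primitive
      (fun a c => (continuous_interaction b ν A ih).intervalIntegrable a c) 0

lemma norm_integral_le_pow {f : ℝ → X} {C : ℝ} (n : ℕ)
    (hf : ∀ s, ‖f s‖ ≤ |s| ^ n / n.factorial * C) (t : ℝ) :
    ‖∫ s in (0 : ℝ)..t, f s‖ ≤ |t| ^ (n + 1) / (n + 1).factorial * C := by
  rw [intervalIntegral.norm_intervalIntegral_eq]
  refine (norm_integral_le_of_norm_le (g := fun s => |s| ^ n * (C / n.factorial)) ?_
    (Filter.Eventually.of_forall fun s => (hf s).trans_eq (by ring))).trans_eq ?_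
  · exact (by fun_prop : Continuous fun s : ℝ => |s| ^ n * (C / n.factorial)).integrableOn_uIoc
  · rw [integral_mul_const]
    have := integral_pow_abs_sub_uIoc (a := 0) (b := t) (n := n)
    simp only [sub_zero] at this
    rw [this, Nat.factorial_succ]
    push_cast
    field_simp

lemma norm_dyson_le (l : List (X →L[ℂ] X)) (y : X) (t : ℝ) :
    ‖dyson b ν l y t‖ ≤ |t| ^ l.length / l.length.factorial * ((l.map norm).prod * ‖y‖) := by
  induction l generalizing t with
  | nil => simp [dyson]
  | cons A l ih =>
    refine norm_integral_le_pow l.length (fun s => ?_) t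
    rw [norm_evolution]
    refine (A.le_opNorm _).trans ?_
    rw [norm_evolution]
    refine (mul_le_mul_of_nonneg_left (ih s) (norm_nonneg A)).trans_eq ?_
    rw [List.map_cons, List.prod_cons]
    ring

/-! ### Laplace transforms -/

/-- The Laplace transform `∫_0^∞ e^{iwt} g(t) dt`. -/
def laplace (g : ℝ → X) (w : ℂ) : X :=
  ∫ t in Set.Ioi (0 : ℝ), Complex.exp (Complex.I * w * t) • g t

/-- The integrand of `laplace g w` is integrable. -/
def LaplaceIntegrable (g : ℝ → X) (w : ℂ) : Prop :=
  IntegrableOn (fun t : ℝ => Complex.exp (Complex.I * w * t) • g t) (Set.Ioi 0)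

lemma norm_exp_I_mul (w : ℂ) (t : ℝ) : ‖Complex.exp (Complex.I * w * t)‖ = Real.exp (-w.im * t) := by
  rw [Complex.norm_exp]
  congr 1
  simp

lemma integrableOn_pow_mul_exp_neg {η : ℝ} (hη : 0 < η) (n : ℕ) :
    IntegrableOn (fun t : ℝ => t ^ n * Real.exp (-η * t)) (Set.Ioi 0) := by
  have := integrableOn_rpow_mul_exp_neg_mul_rpow (p := 1) (s := n) (b := η)
    (by have : (0 : ℝ) ≤ n := n.cast_nonneg
        linarith) one_pos hη
  simpa using this

lemma laplaceIntegrable_of_norm_le {g : ℝ → X} (hg : Continuous g) {w : ℂ} (hw : 0 < w.im) (n : ℕ)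
    (C : ℝ) (h : ∀ t, 0 < t → ‖g t‖ ≤ t ^ n * C) : LaplaceIntegrable g w := by
  refine Integrable.mono' ((integrableOn_pow_mul_exp_neg hw n).mul_const C)
    (Continuous.aestronglyMeasurable (by fun_prop)) ?_
  filter_upwards [ae_restrict_mem measurableSet_Ioi] with t ht
  rw [norm_smul, norm_exp_I_mul]
  refine (mul_le_mul_of_nonneg_left (h t ht) (Real.exp_pos _).le).trans_eq (by ring)

lemma LaplaceIntegrable.clm {g : ℝ → X} {w : ℂ} (hg : LaplaceIntegrable g w) (A : X →L[ℂ] X) :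
    LaplaceIntegrable (fun t => A (g t)) w := by
  have := A.integrable_comp hg
  simpa [LaplaceIntegrable, IntegrableOn] using this

lemma laplaceIntegrable_dyson (l : List (X →L[ℂ] X)) (y : X) {w : ℂ} (hw : 0 < w.im) :
    LaplaceIntegrable (fun t => evolution b ν t (dyson b ν l y t)) w :=
  laplaceIntegrable_of_norm_le (Continuous.evolution b ν continuous_id (continuous_dyson b ν l y))
    hw l.length (((l.map norm).prod * ‖y‖) / l.length.factorial) fun t ht => by
      rw [norm_evolution]
      refine (norm_dyson_le b ν l y t).trans_eq ?_
      rw [abs_of_pos ht]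
      ring

variable [CompleteSpace X]

lemma laplace_clm {g : ℝ → X} {w : ℂ} (hg : LaplaceIntegrable g w) (A : X →L[ℂ] X) :
    laplace (fun t => A (g t)) w = A (laplace g w) := by
  rw [laplace, laplace, ← A.integral_comp_comm hg]
  simp

lemma inner_laplace {g : ℝ → X} {w : ℂ} (hg : LaplaceIntegrable g w) (x : X) :
    inner ℂ x (laplace g w)
      = ∫ t in Set.Ioi (0 : ℝ), Complex.exp (Complex.I * w * t) * inner ℂ x (g t) := by
  rw [laplace, ← integral_inner hg]
  simp [inner_smul_right]

lemma integral_exp_energy {w : ℂ} (hw : 0 < w.im) (e : ℝ) :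
    IntegrableOn (fun t : ℝ => Complex.exp (Complex.I * w * t)
      * Complex.exp (((-(t * e) : ℝ) : ℂ) * Complex.I)) (Set.Ioi 0) ∧
    ∫ t in Set.Ioi (0 : ℝ), Complex.exp (Complex.I * w * t)
      * Complex.exp (((-(t * e) : ℝ) : ℂ) * Complex.I) = -Complex.I * ((e : ℂ) - w)⁻¹ := by
  have h : (fun t : ℝ => Complex.exp (Complex.I * w * t)
      * Complex.exp (((-(t * e) : ℝ) : ℂ) * Complex.I))
      = fun t : ℝ => Complex.exp ((Complex.I * (w - e)) * t) := by
    funext t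
    rw [← Complex.exp_add]
    congr 1
    push_cast
    ring
  have hre : (Complex.I * (w - e)).re < 0 := by simpa using hw
  rw [h]
  refine ⟨integrableOn_exp_mul_complex_Ioi hre 0, ?_⟩
  rw [integral_exp_mul_complex_Ioi hre 0]
  have h1 := ofReal_sub_ne_zero hw e
  have h2 : w - (e : ℂ) ≠ 0 := by rw [← neg_sub]; exact neg_ne_zero.2 h1
  have h3 : ((e : ℂ) - w)⁻¹ = -(w - e)⁻¹ := by rw [← neg_sub, inv_neg]
  rw [h3]
  simp only [Complex.ofReal_zero, mul_zero, Complex.exp_zero]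
  field_simp
  simp

/-- The Laplace transform of the free evolution is the free resolvent. -/
lemma laplace_evolution {w : ℂ} (hw : 0 < w.im) (y : X) :
    LaplaceIntegrable (fun t => evolution b ν t y) w ∧
      Complex.I • laplace (fun t => evolution b ν t y) w = diagResolvent b ν w y := by
  have hint : LaplaceIntegrable (fun t => evolution b ν t y) w :=
    laplaceIntegrable_of_norm_le (continuous_evolution_apply b ν y) hw 0 ‖y‖
      fun t _ => by simp
  refine ⟨hint, hilbertBasis_ext b fun i => ?_⟩
  rw [inner_smul_right, inner_laplace hint, inner_diagResolvent b ν hw]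
  simp only [inner_evolution, ← mul_assoc]
  rw [integral_mul_const, (integral_exp_energy hw (ν i)).2]
  linear_combination (-(((ν i : ℂ) - w)⁻¹ * inner ℂ (b i) y)) * Complex.I_mul_I

/-- The Laplace transform turns the Duhamel convolution with the free evolution into the free
resolvent. -/
lemma laplace_duhamel {w : ℂ} (hw : 0 < w.im) {g : ℝ → X} (hg : Continuous g)
    (hgi : LaplaceIntegrable g w)
    (hui : LaplaceIntegrable
      (fun t => evolution b ν t (∫ s in (0 : ℝ)..t, evolution b ν (-s) (g s))) w) :
    Complex.I • laplace (fun t => evolution b ν t (∫ s in (0 : ℝ)..t, evolution b ν (-s) (g s))) w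
      = diagResolvent b ν w (laplace g w) := by
  -- in each coordinate this is the Laplace transform of a scalar convolution
  refine hilbertBasis_ext b fun i => ?_
  rw [inner_smul_right, inner_laplace hui, inner_diagResolvent b ν hw, inner_laplace hgi]
  have hf : IntegrableOn (fun t : ℝ => Complex.exp (Complex.I * w * t) * inner ℂ (b i) (g t))
      (Set.Ioi 0) := by
    have := Integrable.const_inner (𝕜 := ℂ) (b i) hgi
    simpa [IntegrableOn, inner_smul_right] using this
  obtain ⟨he, he'⟩ := integral_exp_energy hw (ν i)
  have hconv := integral_posConvolution hf he (ContinuousLinearMap.mul ℝ ℂ)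
  have key : ∀ t : ℝ, Complex.exp (Complex.I * w * t) * inner ℂ (b i)
      (evolution b ν t (∫ s in (0 : ℝ)..t, evolution b ν (-s) (g s)))
      = ∫ s in (0 : ℝ)..t, (ContinuousLinearMap.mul ℝ ℂ)
          (Complex.exp (Complex.I * w * s) * inner ℂ (b i) (g s))
          (Complex.exp (Complex.I * w * (t - s : ℝ))
            * Complex.exp (((-((t - s) * ν i) : ℝ) : ℂ) * Complex.I)) := by
    intro t
    have hc : Continuous fun s => evolution b ν (-s) (g s) :=
      Continuous.evolution b ν continuous_neg hg
    have h1 := (innerSL ℂ (b i)).intervalIntegral_comp_comm (hc.intervalIntegrable (μ := volume) 0 t)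
    simp only [innerSL_apply_apply] at h1
    rw [inner_evolution, ← h1, ← mul_assoc, ← intervalIntegral.integral_const_mul]
    refine intervalIntegral.integral_congr fun s _ => ?_
    simp only [inner_evolution, ContinuousLinearMap.mul_apply']
    have e1 : Complex.exp (Complex.I * w * t) = Complex.exp (Complex.I * w * s)
        * Complex.exp (Complex.I * w * (t - s : ℝ)) := by
      rw [← Complex.exp_add]; congr 1; push_cast; ring
    have e2 : Complex.exp (((-((t - s) * ν i) : ℝ) : ℂ) * Complex.I)
        = Complex.exp (((-(t * ν i) : ℝ) : ℂ) * Complex.I)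
          * Complex.exp (((-(-s * ν i) : ℝ) : ℂ) * Complex.I) := by
      rw [← Complex.exp_add]; congr 1; push_cast; ring
    rw [e1, e2]
    ring
  simp only [key]
  rw [hconv, he']
  simp only [ContinuousLinearMap.mul_apply']
  linear_combination (-((∫ t in Set.Ioi (0 : ℝ), Complex.exp (Complex.I * w * t)
    * inner ℂ (b i) (g t)) * ((ν i : ℂ) - w)⁻¹)) * Complex.I_mul_I

/-- The product `R A₁ R A₂ ⋯ A_n R`. -/
def resolventProd (R : X →L[ℂ] X) : List (X →L[ℂ] X) → X →L[ℂ] X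
  | [] => R
  | A :: l => R * (A * resolventProd R l)

/-- The Laplace transforms of the time-ordered integrals are the terms of the Neumann series. -/
lemma laplace_dyson (l : List (X →L[ℂ] X)) (y : X) {w : ℂ} (hw : 0 < w.im) :
    Complex.I • laplace (fun t => evolution b ν t (dyson b ν l y t)) w
      = (-Complex.I) ^ l.length • resolventProd (diagResolvent b ν w) l y := by
  induction l with
  | nil => simpa [dyson, resolventProd] using (laplace_evolution b ν hw y).2
  | cons A l ih =>
    have hu := laplaceIntegrable_dyson b ν l y hw
    have h := laplace_duhamel b ν hw (A.continuous.comp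
      (Continuous.evolution b ν continuous_id (continuous_dyson b ν l y))) (hu.clm A)
      (laplaceIntegrable_dyson b ν (A :: l) y hw)
    have h2 := laplace_clm hu A
    have h3 : laplace (fun t => evolution b ν t (dyson b ν l y t)) w
        = (-Complex.I) • (-Complex.I) ^ l.length • resolventProd (diagResolvent b ν w) l y := by
      rw [← ih, smul_smul]; simp
    refine h.trans ?_
    simp only [Function.comp_def, id_eq]
    rw [h2, h3, List.length_cons, pow_succ', mul_smul]
    simp [resolventProd]

end Dyson

/-! ### The perturbed evolution -/

section Perturbed

variable {X ι : Type*} [NormedAddCommGroup X] [InnerProductSpace ℂ X]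
  (b : HilbertBasis ι ℂ X) (ν : ι → ℝ)

/-- The Dyson series `e^{itA} e^{-it(A + lam V)} y`, where `A` has eigenbasis `b` and eigenvalues
`ν`. -/
def dysonSeries (V : X →L[ℂ] X) (lam : ℝ) (y : X) (t : ℝ) : X :=
  ∑' n : ℕ, (-Complex.I * lam) ^ n • dyson b ν (List.replicate n V) y t

lemma norm_dysonSeries_term_le (V : X →L[ℂ] X) (lam : ℝ) (y : X) (n : ℕ) (t : ℝ) :
    ‖(-Complex.I * lam) ^ n • dyson b ν (List.replicate n V) y t‖
      ≤ (|lam| * ‖V‖ * |t|) ^ n / n.factorial * ‖y‖ := by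
  rw [norm_smul, norm_pow, norm_mul, norm_neg, Complex.norm_I, one_mul, Complex.norm_real,
    Real.norm_eq_abs]
  refine (mul_le_mul_of_nonneg_left (norm_dyson_le b ν _ y t) (by positivity)).trans_eq ?_
  simp only [List.length_replicate, List.map_replicate, List.prod_replicate]
  ring

lemma summable_pow_div_factorial_mul (x C : ℝ) :
    Summable fun n : ℕ => x ^ n / n.factorial * C :=
  (Real.summable_pow_div_factorial x).mul_right C

variable [CompleteSpace X]

lemma hasSum_dysonSeries (V : X →L[ℂ] X) (lam : ℝ) (y : X) (t : ℝ) :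
    HasSum (fun n : ℕ => (-Complex.I * lam) ^ n • dyson b ν (List.replicate n V) y t)
      (dysonSeries b ν V lam y t) :=
  (Summable.of_norm_bounded (summable_pow_div_factorial_mul _ _)
    fun n => norm_dysonSeries_term_le b ν V lam y n t).hasSum

lemma continuous_dysonSeries (V : X →L[ℂ] X) (lam : ℝ) (y : X) :
    Continuous (dysonSeries b ν V lam y) := by
  rw [continuous_iff_continuousAt]
  intro t₀
  have hmem : Metric.ball (0 : ℝ) (|t₀| + 1) ∈ nhds t₀ :=
    Metric.isOpen_ball.mem_nhds (by simp)
  refine ContinuousOn.continuousAt (continuousOn_tsum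
    (u := fun n : ℕ => (|lam| * ‖V‖ * (|t₀| + 1)) ^ n / n.factorial * ‖y‖)
    (fun n => ((continuous_dyson b ν _ y).const_smul _).continuousOn)
    (summable_pow_div_factorial_mul _ _) fun n t ht => ?_) hmem
  refine (norm_dysonSeries_term_le b ν V lam y n t).trans ?_
  have : |t| ≤ |t₀| + 1 := by
    rw [mem_ball_zero_iff, Real.norm_eq_abs] at ht
    exact ht.le
  gcongr

/-- The integral equation for the Dyson series. -/
lemma dysonSeries_eq (V : X →L[ℂ] X) (lam : ℝ) (y : X) (t : ℝ) :
    dysonSeries b ν V lam y t = y + ∫ s in (0 : ℝ)..t, evolution b ν (-s)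
      ((-Complex.I * lam) • V (evolution b ν s (dysonSeries b ν V lam y s))) := by
  have h0 := (hasSum_nat_add_iff' 1).2 (hasSum_dysonSeries b ν V lam y t)
  simp only [Finset.range_one, Finset.sum_singleton, pow_zero, one_smul, List.replicate_zero,
    dyson] at h0
  rw [add_comm, ← sub_eq_iff_eq_add]
  refine h0.unique ?_
  have hterm : ∀ n : ℕ, (-Complex.I * lam) ^ (n + 1) • dyson b ν (List.replicate (n + 1) V) y t
      = ∫ s in (0 : ℝ)..t, evolution b ν (-s) ((-Complex.I * lam) • V (evolution b ν s
          ((-Complex.I * lam) ^ n • dyson b ν (List.replicate n V) y s))) := by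
    intro n
    rw [List.replicate_succ, dyson, ← intervalIntegral.integral_smul]
    refine intervalIntegral.integral_congr fun s _ => ?_
    simp only [map_smul, smul_smul]
    rw [pow_succ']
  simp only [hterm]
  refine intervalIntegral.hasSum_integral_of_dominated_convergence
    (fun n _ => |lam| * ‖V‖ * ((|lam| * ‖V‖ * |t|) ^ n / n.factorial * ‖y‖)) (fun n => ?_)
    (fun n => ?_) ?_ ?_ ?_
  · refine Continuous.aestronglyMeasurable ?_
    exact continuous_interaction b ν ((-Complex.I * lam : ℂ) • V)
      ((continuous_dyson b ν (List.replicate n V) y).const_smul ((-Complex.I * lam : ℂ) ^ n))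
  · refine Filter.Eventually.of_forall fun s hs => ?_
    rw [norm_evolution, norm_smul, norm_mul, norm_neg, Complex.norm_I, one_mul, Complex.norm_real,
      Real.norm_eq_abs, mul_assoc]
    refine mul_le_mul_of_nonneg_left ((V.le_opNorm _).trans
      (mul_le_mul_of_nonneg_left ?_ (norm_nonneg V))) (abs_nonneg _)
    rw [norm_evolution]
    refine (norm_dysonSeries_term_le b ν V lam y n s).trans ?_
    have : |s| ≤ |t| := by
      rcases Set.mem_uIoc.1 hs with h | h
      · rw [abs_of_pos h.1, abs_of_pos (h.1.trans_le h.2)]; exact h.2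
      · rw [abs_of_nonpos h.2, abs_of_neg (h.1.trans_le h.2)]; linarith
    gcongr
  · exact Filter.Eventually.of_forall fun s _ =>
      (summable_pow_div_factorial_mul _ _).mul_left _
  · exact intervalIntegrable_const
  · refine Filter.Eventually.of_forall fun s _ => ?_
    exact (((hasSum_dysonSeries b ν V lam y s).mapL (evolution b ν s)).mapL
      ((-Complex.I * lam : ℂ) • V)).mapL (evolution b ν (-s))

/-- For symmetric `V` the interaction picture generator is skew-adjoint, so that the Dyson series
preserves the norm. -/
lemma norm_dysonSeries {V : X →L[ℂ] X} (hV : ∀ x y, inner ℂ (V x) y = inner ℂ x (V y))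
    (lam : ℝ) (y : X) (t : ℝ) : ‖dysonSeries b ν V lam y t‖ = ‖y‖ := by
  set w := dysonSeries b ν V lam y with hw
  have hcw : Continuous w := continuous_dysonSeries b ν V lam y
  set g : ℝ → X := fun s => evolution b ν (-s) ((-Complex.I * lam) • V (evolution b ν s (w s)))
    with hg
  have hcg : Continuous g := continuous_interaction b ν ((-Complex.I * lam : ℂ) • V) hcw
  have hd : ∀ s, HasDerivAt w (g s) s := by
    intro s
    have h1 : w = fun t => y + ∫ s in (0 : ℝ)..t, g s :=
      funext fun t => dysonSeries_eq b ν V lam y t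
    rw [h1]
    exact (intervalIntegral.integral_hasDerivAt_right (hcg.intervalIntegrable 0 s)
      (hcg.stronglyMeasurableAtFilter _ _) hcg.continuousAt).const_add y
  -- the inner product `⟨w, w⟩` has derivative zero
  have hzero : ∀ s, HasDerivAt (fun s => inner ℂ (w s) (w s)) 0 s := by
    intro s
    have h := (hd s).inner ℂ (hd s)
    have h2 : inner ℂ (w s) (g s) + inner ℂ (g s) (w s) = 0 := by
      set x := evolution b ν s (w s)
      have hx : w s = evolution b ν (-s) x := by
        rw [← evolution_add, neg_add_cancel, evolution_zero]
      have hgs : g s = evolution b ν (-s) ((-Complex.I * lam) • V x) := rfl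
      rw [hgs, hx, inner_evolution_evolution, inner_evolution_evolution, inner_smul_left,
        inner_smul_right, hV]
      simp
    rwa [h2] at h
  have hconst := is_const_of_deriv_eq_zero (fun s => (hzero s).differentiableAt)
    (fun s => (hzero s).deriv) t 0
  have h0 : w 0 = y := by
    rw [hw, dysonSeries_eq]
    simp
  simp only [h0, inner_self_eq_norm_sq_to_K] at hconst
  have : ‖w t‖ ^ 2 = ‖y‖ ^ 2 := by exact_mod_cast hconst
  exact (pow_left_inj₀ (norm_nonneg _) (norm_nonneg _) two_ne_zero).1 this

/-- The vector `i ∫_0^∞ e^{izt} e^{-it(A + lam V)} y dt`. -/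
def perturbedLaplace (V : X →L[ℂ] X) (lam : ℝ) (z : ℂ) (y : X) : X :=
  Complex.I • laplace (fun t => evolution b ν t (dysonSeries b ν V lam y t)) z

lemma laplaceIntegrable_dysonSeries {V : X →L[ℂ] X}
    (hV : ∀ x y, inner ℂ (V x) y = inner ℂ x (V y)) (lam : ℝ) {z : ℂ} (hz : 0 < z.im) (y : X) :
    LaplaceIntegrable (fun t => evolution b ν t (dysonSeries b ν V lam y t)) z :=
  laplaceIntegrable_of_norm_le
    (Continuous.evolution b ν continuous_id (continuous_dysonSeries b ν V lam y)) hz 0 ‖y‖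
    fun t _ => by rw [norm_evolution, norm_dysonSeries b ν hV]; simp

/-- The second resolvent identity for the Laplace transform of the perturbed evolution. -/
lemma perturbedLaplace_eq {V : X →L[ℂ] X} (hV : ∀ x y, inner ℂ (V x) y = inner ℂ x (V y))
    (lam : ℝ) {z : ℂ} (hz : 0 < z.im) (y : X) :
    perturbedLaplace b ν V lam z y
      = diagResolvent b ν z (y - (lam : ℂ) • V (perturbedLaplace b ν V lam z y)) := by
  have hu := laplaceIntegrable_dysonSeries b ν hV lam hz y
  set u := fun t => evolution b ν t (dysonSeries b ν V lam y t) with hu'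
  have hcu : Continuous u :=
    Continuous.evolution b ν continuous_id (continuous_dysonSeries b ν V lam y)
  have hgi := hu.clm ((-Complex.I * lam : ℂ) • V)
  obtain ⟨h0i, h0⟩ := laplace_evolution b ν hz y
  have hsplit : ∀ t, u t = evolution b ν t y + evolution b ν t (∫ s in (0 : ℝ)..t,
      evolution b ν (-s) (((-Complex.I * lam : ℂ) • V) (u s))) := by
    intro t
    simp only [hu']
    rw [← map_add]
    exact congrArg _ (dysonSeries_eq b ν V lam y t)
  have h1i : LaplaceIntegrable (fun t => evolution b ν t (∫ s in (0 : ℝ)..t,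
      evolution b ν (-s) (((-Complex.I * lam : ℂ) • V) (u s)))) z := by
    refine (Integrable.sub hu h0i).congr (Filter.Eventually.of_forall fun t => ?_)
    simp only [Pi.sub_apply]
    rw [← smul_sub, hsplit t, add_sub_cancel_left]
  have h1 := laplace_duhamel b ν hz
    (((-Complex.I * lam : ℂ) • V).continuous.comp hcu) hgi h1i
  have hsum : laplace u z = laplace (fun t => evolution b ν t y) z + laplace (fun t =>
      evolution b ν t (∫ s in (0 : ℝ)..t,
        evolution b ν (-s) (((-Complex.I * lam : ℂ) • V) (u s)))) z := by
    rw [laplace, laplace, laplace, ← integral_add h0i h1i]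
    exact integral_congr_ae (Filter.Eventually.of_forall fun t => by
      simp only [hsplit t, smul_add])
  change Complex.I • laplace u z = diagResolvent b ν z (y - (lam : ℂ) • V (Complex.I • laplace u z))
  conv_lhs => rw [hsum, smul_add, h0]
  refine (congrArg (diagResolvent b ν z y + ·) h1).trans ?_
  simp only [Function.comp_def]
  rw [laplace_clm hu, ← map_add]
  congr 1
  simp only [smul_apply, map_smul, smul_smul]
  rw [sub_eq_add_neg, ← neg_smul]
  congr 2
  ring

lemma norm_perturbedLaplace_le {V : X →L[ℂ] X} (hV : ∀ x y, inner ℂ (V x) y = inner ℂ x (V y))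
    (lam : ℝ) {z : ℂ} (hz : 0 < z.im) (y : X) :
    ‖perturbedLaplace b ν V lam z y‖ ≤ z.im⁻¹ * ‖y‖ := by
  rw [perturbedLaplace, norm_smul, Complex.norm_I, one_mul, laplace]
  refine (norm_integral_le_of_norm_le (g := fun t => Real.exp (-z.im * t) * ‖y‖) ?_ ?_).trans_eq ?_
  · exact (integrableOn_exp_mul_Ioi (neg_lt_zero.2 hz) 0).mul_const _
  · refine Filter.Eventually.of_forall fun t => ?_
    rw [norm_smul, norm_exp_I_mul, norm_evolution, norm_dysonSeries b ν hV]
  · rw [integral_mul_const, integral_exp_mul_Ioi (neg_lt_zero.2 hz)]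
    simp

end Perturbed

/-! ### Resolvents of diagonal operators and of their bounded symmetric perturbations -/

section Unbounded

variable {X : Type} {ι : Type*} [NormedAddCommGroup X] [InnerProductSpace ℂ X]
  (b : HilbertBasis ι ℂ X) (ν : ι → ℝ)

/-- The operator `A` is the maximal operator with eigenbasis `b` and eigenvalues `ν`. -/
structure IsDiagonal (A : X →ₗ.[ℂ] X) : Prop where
  mem_domain_iff : ∀ f, f ∈ A.domain ↔ Memℓp (fun i => (ν i : ℂ) * inner ℂ (b i) f) 2
  inner_apply : ∀ (f : A.domain) i, inner ℂ (b i) (A f) = ν i * inner ℂ (b i) (f : X)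

variable {b ν} {A : X →ₗ.[ℂ] X} (hA : IsDiagonal b ν A)
include hA

lemma IsDiagonal.mem_domain_diagResolvent {w : ℂ} (hw : 0 < w.im) (g : X) :
    diagResolvent b ν w g ∈ A.domain := by
  rw [hA.mem_domain_iff]
  have h : (fun i => (ν i : ℂ) * inner ℂ (b i) (diagResolvent b ν w g))
      = fun i => (1 + w * ((ν i : ℂ) - w)⁻¹) * inner ℂ (b i) g := by
    funext i
    rw [inner_diagResolvent b ν hw]
    have := ofReal_sub_ne_zero hw (ν i)
    field_simp
    ring
  rw [h]
  refine memℓp_mul_coord b (C := 1 + ‖w‖ * w.im⁻¹) (fun i => ?_) g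
  refine (norm_add_le _ _).trans ?_
  rw [norm_one, norm_mul]
  gcongr
  exact norm_inv_ofReal_sub_le hw (ν i)

lemma IsDiagonal.isResolvent {w : ℂ} (hw : 0 < w.im) : IsResolvent A w (diagResolvent b ν w) := by
  refine ⟨fun f => hilbertBasis_ext b fun i => ?_, fun g =>
    ⟨hA.mem_domain_diagResolvent hw g, hilbertBasis_ext b fun i => ?_⟩⟩
  · have := ofReal_sub_ne_zero hw (ν i)
    rw [inner_diagResolvent b ν hw, inner_sub_right, inner_smul_right, hA.inner_apply]
    field_simp
  · have := ofReal_sub_ne_zero hw (ν i)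
    rw [inner_sub_right, inner_smul_right, hA.inner_apply]
    simp only [inner_diagResolvent b ν hw]
    field_simp

lemma IsDiagonal.im_inner_apply (f : A.domain) : (inner ℂ (f : X) (A f)).im = 0 := by
  have h := b.hasSum_inner_mul_inner (f : X) (A f)
  have h2 := Complex.hasSum_im h
  refine h2.unique ?_
  convert hasSum_zero using 1
  funext i
  rw [hA.inner_apply, ← inner_conj_symm, mul_left_comm, Complex.conj_mul']
  norm_cast

/-- The resolvent of a bounded symmetric perturbation of a diagonal operator is the Laplace
transform of the perturbed evolution. -/
lemma IsDiagonal.exists_isResolvent_vadd [CompleteSpace X] {V : X →L[ℂ] X}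
    (hV : ∀ x y, inner ℂ (V x) y = inner ℂ x (V y)) (lam : ℝ) {z : ℂ} (hz : 0 < z.im) :
    ∃ S : X →L[ℂ] X, IsResolvent (((lam : ℂ) • V).toLinearMap +ᵥ A) z S ∧
      ∀ y, S y = perturbedLaplace b ν V lam z y := by
  set H : X →ₗ.[ℂ] X := ((lam : ℂ) • V).toLinearMap +ᵥ A with hH
  have happ : ∀ f : H.domain, H f = (lam : ℂ) • V f + A f := fun f => rfl
  -- symmetry makes `H - z` injective
  have hinj : ∀ f : H.domain, H f - z • (f : X) = 0 → (f : X) = 0 := by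
    intro f hf
    have h1 : inner ℂ (f : X) (H f - z • (f : X)) = 0 := by rw [hf, inner_zero_right]
    rw [happ, inner_sub_right, inner_add_right, inner_smul_right, inner_smul_right] at h1
    have h2 : (inner ℂ (f : X) (V f)).im = 0 := by
      rw [← Complex.conj_eq_iff_im, inner_conj_symm, hV]
    have h3 := hA.im_inner_apply f
    have h4 := congrArg Complex.im h1
    rw [inner_self_eq_norm_sq_to_K] at h4
    have h5 : ((‖(f : X)‖ : ℂ) ^ 2) = ((‖(f : X)‖ ^ 2 : ℝ) : ℂ) := by push_cast; rfl
    simp only [Complex.coe_algebraMap, h5, Complex.sub_im, Complex.add_im, Complex.mul_im,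
      Complex.ofReal_re, Complex.ofReal_im, Complex.zero_im, h2] at h4
    have h6 : (inner ℂ (f : X) (A f)).im = 0 := h3
    rw [h6] at h4
    have h7 : z.im * ‖(f : X)‖ ^ 2 = 0 := by linarith
    have h8 := (mul_eq_zero.1 h7).resolve_left hz.ne'
    exact norm_eq_zero.1 (pow_eq_zero_iff two_ne_zero |>.1 h8)
  -- the resolvent equation shows that the Laplace transform solves `(H - z) u = y`
  have hsol : ∀ y, ∃ h : perturbedLaplace b ν V lam z y ∈ H.domain,
      H ⟨perturbedLaplace b ν V lam z y, h⟩ - z • perturbedLaplace b ν V lam z y = y := by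
    intro y
    have he := perturbedLaplace_eq b ν hV lam hz y
    set G := perturbedLaplace b ν V lam z y
    obtain ⟨h, h'⟩ := (hA.isResolvent hz).2 (y - (lam : ℂ) • V G)
    have hG : G ∈ A.domain := by rw [he]; exact h
    refine ⟨hG, ?_⟩
    rw [happ]
    have h2 : A ⟨G, hG⟩ - z • G = y - (lam : ℂ) • V G := by
      have : (⟨G, hG⟩ : A.domain) = ⟨_, h⟩ := Subtype.ext he
      rw [this]
      exact (congrArg (fun x => A ⟨_, h⟩ - z • x) he).trans h'
    have h3 : A ⟨G, hG⟩ = y - (lam : ℂ) • V G + z • G := sub_eq_iff_eq_add.1 h2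
    change (lam : ℂ) • V G + A ⟨G, hG⟩ - z • G = y
    rw [h3]
    abel
  -- linearity of the Laplace transform in `y` follows from uniqueness of the solution
  have huniq : ∀ (f : H.domain) (y : X), H f - z • (f : X) = y →
      (f : X) = perturbedLaplace b ν V lam z y := by
    intro f y hf
    obtain ⟨h, h'⟩ := hsol y
    have := hinj (f - ⟨_, h⟩) (by
      rw [H.map_sub, Submodule.coe_sub, smul_sub, sub_sub_sub_comm, hf, h', sub_self])
    exact sub_eq_zero.1 this
  let S : X →L[ℂ] X := LinearMap.mkContinuous
    { toFun := perturbedLaplace b ν V lam z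
      map_add' := fun x y => by
        obtain ⟨h, h'⟩ := hsol x
        obtain ⟨k, k'⟩ := hsol y
        refine (huniq (⟨_, h⟩ + ⟨_, k⟩) (x + y) ?_).symm
        rw [H.map_add, Submodule.coe_add, smul_add, add_sub_add_comm, h', k']
      map_smul' := fun c x => by
        obtain ⟨h, h'⟩ := hsol x
        refine (huniq (c • ⟨_, h⟩) (c • x) ?_).symm
        rw [H.map_smul, Submodule.coe_smul, smul_comm z c, ← smul_sub, h'] }
    z.im⁻¹ fun y => norm_perturbedLaplace_le b ν hV lam hz y
  refine ⟨S, ⟨fun f => ?_, fun g => hsol g⟩, fun y => rfl⟩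
  exact (huniq f _ rfl).symm

end Unbounded

/-! ### The regularized Laplace transform -/

section Cutoff

variable {χ : ℝ → ℝ}

lemma IsCutoff.norm_cutoff_le (hχ : IsCutoff χ) (a t : ℝ) : ‖(χ (a * t) : ℂ)‖ ≤ 1 := by
  rw [Complex.norm_real, Real.norm_of_nonneg (hχ.mem_Icc _).1]
  exact (hχ.mem_Icc _).2

variable (hχ : IsCutoff χ) {a : ℝ} (ha : 0 < a)
include hχ ha

/-- The rescaled cutoff as a complex Schwartz function. -/
lemma IsCutoff.exists_schwartz : ∃ f : 𝓢(ℝ, ℂ), ∀ t, f t = (χ (a * t) : ℂ) := by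
  have hs : ContDiff ℝ ((⊤ : ℕ∞) : WithTop ℕ∞) fun t : ℝ => (χ (a * t) : ℂ) :=
    Complex.ofRealCLM.contDiff.comp (hχ.smooth.comp (contDiff_const.mul contDiff_id))
  have hc : HasCompactSupport fun t : ℝ => (χ (a * t) : ℂ) := by
    refine HasCompactSupport.intro (isCompact_Icc (a := -(2 / a)) (b := 2 / a)) fun t ht => ?_
    rw [hχ.eq_zero, Complex.ofReal_zero]
    rw [abs_mul, abs_of_pos ha]
    by_contra! h
    rw [← lt_div_iff₀' ha, abs_lt] at h
    exact ht ⟨h.1.le, h.2.le⟩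
  exact ⟨hc.toSchwartzMap hs, fun t => rfl⟩

lemma IsCutoff.integrable_cutoffHat : Integrable (cutoffHat χ a) := by
  obtain ⟨f, hf⟩ := hχ.exists_schwartz ha
  have h : cutoffHat χ a = 𝓕 f := by
    rw [cutoffHat, SchwartzMap.fourier_coe]
    congr 1
    exact funext fun t => (hf t).symm
  rw [h]
  exact (𝓕 f).integrable

/-- Fourier inversion for the cutoff. -/
lemma IsCutoff.integral_cutoffHat_mul_exp (t : ℝ) :
    ∫ α : ℝ, cutoffHat χ a α * Complex.exp (2 * Real.pi * Complex.I * α * t) = χ (a * t) := by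
  obtain ⟨f, hf⟩ := hχ.exists_schwartz ha
  have h : cutoffHat χ a = 𝓕 (f : ℝ → ℂ) := by
    rw [cutoffHat]
    congr 1
    exact funext fun t => (hf t).symm
  have h2 := f.continuous.fourierInv_fourier_eq f.integrable
    (by rw [← SchwartzMap.fourier_coe]; exact (𝓕 f).integrable)
  rw [← hf t, ← congrFun h2 t, Real.fourierInv_eq', h]
  refine integral_congr_ae (Filter.Eventually.of_forall fun α => ?_)
  simp only [smul_eq_mul]
  rw [mul_comm]
  congr 2
  simp
  ring

/-- Smearing the spectral parameter with the Fourier transform of a cutoff inserts the cutoff into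
the Laplace transform. -/
lemma IsCutoff.smear_laplace {z : ℂ} {g : ℝ → ℂ} (hg : LaplaceIntegrable g z) :
    ∫ α : ℝ, cutoffHat χ a α * laplace g (z + 2 * Real.pi * α)
      = ∫ t in Set.Ioi (0 : ℝ), Complex.exp (Complex.I * z * t) * (χ (a * t) * g t) := by
  have hint : Integrable (Function.uncurry fun (α t : ℝ) =>
      cutoffHat χ a α * (Complex.exp (Complex.I * (z + 2 * Real.pi * α) * t) * g t))
      (volume.prod (volume.restrict (Set.Ioi 0))) := by
    have h1 := (hχ.integrable_cutoffHat ha).mul_prod hg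
    have h2 := h1.bdd_mul (f := fun p : ℝ × ℝ =>
      Complex.exp (((2 * Real.pi * p.1 * p.2 : ℝ) : ℂ) * Complex.I)) (c := 1)
      (Continuous.aestronglyMeasurable (by fun_prop))
      (Filter.Eventually.of_forall fun p => (Complex.norm_exp_ofReal_mul_I _).le)
    refine h2.congr (Filter.Eventually.of_forall fun p => ?_)
    simp only [Function.uncurry, smul_eq_mul]
    have : Complex.exp (Complex.I * (z + 2 * Real.pi * p.1) * p.2)
        = Complex.exp (((2 * Real.pi * p.1 * p.2 : ℝ) : ℂ) * Complex.I)
          * Complex.exp (Complex.I * z * p.2) := by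
      rw [← Complex.exp_add]; congr 1; push_cast; ring
    rw [this]
    ring
  have h1 : ∀ α : ℝ, cutoffHat χ a α * laplace g (z + 2 * Real.pi * α)
      = ∫ t in Set.Ioi (0 : ℝ), cutoffHat χ a α
          * (Complex.exp (Complex.I * (z + 2 * Real.pi * α) * t) * g t) := by
    intro α
    rw [integral_const_mul, laplace]
    simp only [smul_eq_mul]
  simp only [h1]
  rw [integral_integral_swap hint]
  refine integral_congr_ae (Filter.Eventually.of_forall fun t => ?_)
  simp only
  rw [← hχ.integral_cutoffHat_mul_exp ha t, ← integral_mul_const, ← integral_const_mul]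
  refine integral_congr_ae (Filter.Eventually.of_forall fun α => ?_)
  simp only
  have : Complex.exp (Complex.I * (z + 2 * Real.pi * α) * t)
      = Complex.exp (2 * Real.pi * Complex.I * α * t) * Complex.exp (Complex.I * z * t) := by
    rw [← Complex.exp_add]; congr 1; ring
  rw [this]
  ring

lemma IsCutoff.cutoff_eq_zero {t : ℝ} (ht : 2 / a ≤ t) : χ (a * t) = 0 := by
  refine hχ.eq_zero _ ?_
  rw [div_le_iff₀' ha] at ht
  exact ht.trans (le_abs_self _)

/-- The cutoff restricts the Laplace transform to times at most `2 / a`. -/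
lemma IsCutoff.norm_integral_cutoff_le {z : ℂ} (hz : 0 < z.im) {g : ℝ → ℂ} (n : ℕ) {C : ℝ}
    (h : ∀ t, 0 < t → ‖g t‖ ≤ t ^ n / n.factorial * C) (hC : 0 ≤ C) :
    ‖∫ t in Set.Ioi (0 : ℝ), Complex.exp (Complex.I * z * t) * (χ (a * t) * g t)‖
      ≤ (2 / a) ^ (n + 1) / n.factorial * C := by
  have hsub : ∫ t in Set.Ioi (0 : ℝ), Complex.exp (Complex.I * z * t) * (χ (a * t) * g t)
      = ∫ t in Set.Ioc (0 : ℝ) (2 / a), Complex.exp (Complex.I * z * t) * (χ (a * t) * g t) := by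
    refine (setIntegral_eq_of_subset_of_forall_sdiff_eq_zero measurableSet_Ioi
      (fun t ht => ht.1) fun t ht => ?_)
    have h1 : 2 / a ≤ t := by
      by_contra! hlt
      exact ht.2 ⟨ht.1, hlt.le⟩
    rw [hχ.cutoff_eq_zero ha h1]
    simp
  rw [hsub]
  refine (norm_setIntegral_le_of_norm_le_const (C := (2 / a) ^ n / n.factorial * C) ?_ ?_).trans_eq
    ?_
  · simp
  · intro t ht
    rw [norm_mul, norm_mul, norm_exp_I_mul]
    have h1 : Real.exp (-z.im * t) ≤ 1 := Real.exp_le_one_iff.2 (by nlinarith [ht.1])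
    have h3 : ‖g t‖ ≤ (2 / a) ^ n / n.factorial * C := by
      refine (h t ht.1).trans ?_
      have := ht.1.le
      have := ht.2
      gcongr
    calc _ ≤ 1 * (1 * ((2 / a) ^ n / n.factorial * C)) := by
          gcongr
          exact hχ.norm_cutoff_le a t
      _ = _ := by ring
  · rw [Measure.real, Real.volume_Ioc, sub_zero, ENNReal.toReal_ofReal (by positivity)]
    ring

/-- The cutoff does not affect times at most `1 / a`, and later times are exponentially damped. -/
lemma IsCutoff.norm_integral_one_sub_cutoff_le {z : ℂ} (hz : 0 < z.im) {g : ℝ → ℂ} {C : ℝ}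
    (h : ∀ t, ‖g t‖ ≤ C) :
    ‖∫ t in Set.Ioi (0 : ℝ), Complex.exp (Complex.I * z * t) * ((1 - χ (a * t)) * g t)‖
      ≤ Real.exp (-z.im / a) / z.im * C := by
  have hsub : ∫ t in Set.Ioi (0 : ℝ), Complex.exp (Complex.I * z * t) * ((1 - χ (a * t)) * g t)
      = ∫ t in Set.Ioi (1 / a), Complex.exp (Complex.I * z * t) * ((1 - χ (a * t)) * g t) := by
    refine (setIntegral_eq_of_subset_of_forall_sdiff_eq_zero measurableSet_Ioi
      (fun t ht => lt_trans (by positivity) (Set.mem_Ioi.1 ht)) fun t ht => ?_)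
    have h1 : t ≤ 1 / a := by
      by_contra! hlt
      exact ht.2 hlt
    rw [le_div_iff₀' ha] at h1
    have h2 : 0 < a * t := mul_pos ha ht.1
    rw [hχ.eq_one _ ⟨by linarith, h1⟩]
    simp
  rw [hsub]
  refine (norm_integral_le_of_norm_le (g := fun t => Real.exp (-z.im * t) * C) ?_ ?_).trans_eq ?_
  · exact (integrableOn_exp_mul_Ioi (neg_lt_zero.2 hz) _).mul_const _
  · refine Filter.Eventually.of_forall fun t => ?_
    rw [norm_mul, norm_mul, norm_exp_I_mul]
    have h1 : ‖(1 - χ (a * t) : ℂ)‖ ≤ 1 := by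
      rw [← Complex.ofReal_one, ← Complex.ofReal_sub, Complex.norm_real, Real.norm_eq_abs, abs_le]
      have := hχ.mem_Icc (a * t)
      constructor <;> linarith [this.1, this.2]
    have hC := (norm_nonneg _).trans (h t)
    calc _ ≤ Real.exp (-z.im * t) * (1 * C) := by
          gcongr
          exact h t
      _ = _ := by ring
  · rw [integral_mul_const, integral_exp_mul_Ioi (neg_lt_zero.2 hz)]
    rw [show -z.im * (1 / a) = -z.im / a by ring]
    rw [neg_div_neg_eq]

end Cutoff

/-! ### Smeared terms of the Neumann series -/

section Smeared

variable {X ι : Type*} [NormedAddCommGroup X] [InnerProductSpace ℂ X]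

lemma resolventProd_ofFn (R : X →L[ℂ] X) {n : ℕ} (V : Fin n → X →L[ℂ] X) :
    resolventProd R (List.ofFn V) = R * (List.ofFn fun i => V i * R).prod := by
  induction n with
  | zero => simp [resolventProd]
  | succ n ih =>
    rw [List.ofFn_succ, resolventProd, ih, List.ofFn_succ, List.prod_cons, mul_assoc]

lemma resolventProd_replicate (R V : X →L[ℂ] X) (n : ℕ) :
    resolventProd R (List.replicate n V) = R * (V * R) ^ n := by
  rw [← List.ofFn_const, resolventProd_ofFn, List.ofFn_const, List.prod_replicate]

/-- `resolventProd` as a multilinear map of the operators between the resolvents. -/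
def resolventMultilinear (R : X →L[ℂ] X) (n : ℕ) :
    MultilinearMap ℂ (fun _ : Fin n => X →L[ℂ] X) (X →L[ℂ] X) :=
  (LinearMap.mulLeft ℂ R).compMultilinearMap
    ((MultilinearMap.mkPiAlgebraFin ℂ n (X →L[ℂ] X)).compLinearMap fun _ => LinearMap.mulRight ℂ R)

lemma resolventMultilinear_apply (R : X →L[ℂ] X) {n : ℕ} (V : Fin n → X →L[ℂ] X) :
    resolventMultilinear R n V = resolventProd R (List.ofFn V) := by
  rw [resolventProd_ofFn]
  rfl

lemma norm_resolventProd_le (R : X →L[ℂ] X) (l : List (X →L[ℂ] X)) :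
    ‖resolventProd R l‖ ≤ ‖R‖ ^ (l.length + 1) * (l.map norm).prod := by
  induction l with
  | nil => simp [resolventProd]
  | cons A l ih =>
    rw [resolventProd, List.map_cons, List.prod_cons, List.length_cons]
    refine (norm_mul_le _ _).trans ((mul_le_mul_of_nonneg_left ((norm_mul_le _ _).trans
      (mul_le_mul_of_nonneg_left ih (norm_nonneg A))) (norm_nonneg R)).trans_eq ?_)
    ring

variable (b : HilbertBasis ι ℂ X) (ν : ι → ℝ)

lemma continuous_resolventProd {z : ℂ} (hz : 0 < z.im) (l : List (X →L[ℂ] X)) :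
    Continuous fun α : ℝ => resolventProd (diagResolvent b ν (z + 2 * Real.pi * α)) l := by
  induction l with
  | nil => exact continuous_diagResolvent b ν hz
  | cons A l ih => exact (continuous_diagResolvent b ν hz).mul (continuous_const.mul ih)

lemma norm_resolventProd_diagResolvent_le {z : ℂ} (hz : 0 < z.im) (l : List (X →L[ℂ] X)) (α : ℝ) :
    ‖resolventProd (diagResolvent b ν (z + 2 * Real.pi * α)) l‖
      ≤ z.im⁻¹ ^ (l.length + 1) * (l.map norm).prod := by
  have him : (z + 2 * Real.pi * α).im = z.im := by simp
  have h : ‖diagResolvent b ν (z + 2 * Real.pi * α)‖ ≤ z.im⁻¹ := by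
    have := norm_diagResolvent_le b ν (w := z + 2 * Real.pi * α) (by rwa [him])
    rwa [him] at this
  have h0 : 0 ≤ (l.map norm).prod := List.prod_nonneg fun x hx => by
    obtain ⟨A, -, rfl⟩ := List.mem_map.1 hx
    exact norm_nonneg A
  refine (norm_resolventProd_le _ l).trans ?_
  gcongr

/-- The integrand `α ↦ φ(α) ⟨x, R A₁ R ⋯ A_n R y⟩`, with `R` the resolvent at `z + 2πα`. -/
def smearedProdIntegrand (φ : ℝ → ℂ) (z : ℂ) (x y : X) (l : List (X →L[ℂ] X)) (α : ℝ) : ℂ :=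
  φ α * inner ℂ x (resolventProd (diagResolvent b ν (z + 2 * Real.pi * α)) l y)

lemma norm_inner_resolventProd_le {z : ℂ} (hz : 0 < z.im) (x y : X) (l : List (X →L[ℂ] X)) (α : ℝ) :
    ‖inner ℂ x (resolventProd (diagResolvent b ν (z + 2 * Real.pi * α)) l y)‖
      ≤ ‖x‖ * (z.im⁻¹ ^ (l.length + 1) * (l.map norm).prod * ‖y‖) := by
  refine (norm_inner_le_norm _ _).trans (mul_le_mul_of_nonneg_left ?_ (norm_nonneg x))
  exact (ContinuousLinearMap.le_opNorm _ _).trans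
    (mul_le_mul_of_nonneg_right (norm_resolventProd_diagResolvent_le b ν hz l α) (norm_nonneg y))

lemma continuous_inner_resolventProd {z : ℂ} (hz : 0 < z.im) (x y : X) (l : List (X →L[ℂ] X)) :
    Continuous fun α : ℝ =>
      inner ℂ x (resolventProd (diagResolvent b ν (z + 2 * Real.pi * α)) l y) :=
  continuous_const.inner ((continuous_resolventProd b ν hz l).clm_apply continuous_const)

lemma integrable_smearedProdIntegrand {φ : ℝ → ℂ} (hφ : Integrable φ) {z : ℂ} (hz : 0 < z.im)
    (x y : X) (l : List (X →L[ℂ] X)) : Integrable (smearedProdIntegrand b ν φ z x y l) :=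
  hφ.mul_bdd (c := ‖x‖ * (z.im⁻¹ ^ (l.length + 1) * (l.map norm).prod * ‖y‖))
    (continuous_inner_resolventProd b ν hz x y l).aestronglyMeasurable
    (Filter.Eventually.of_forall (norm_inner_resolventProd_le b ν hz x y l))

/-- The smeared matrix element `∫ φ(α) ⟨x, R A₁ R ⋯ A_n R y⟩ dα`, as a multilinear map of the
operators `A₁, …, A_n`. -/
def smearedMultilinear {φ : ℝ → ℂ} (hφ : Integrable φ) {z : ℂ} (hz : 0 < z.im) (x y : X) (n : ℕ) :
    MultilinearMap ℂ (fun _ : Fin n => X →L[ℂ] X) ℂ where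
  toFun V := ∫ α, smearedProdIntegrand b ν φ z x y (List.ofFn V) α
  map_update_add' V i A A' := by
    rw [← integral_add (integrable_smearedProdIntegrand b ν hφ hz x y _)
      (integrable_smearedProdIntegrand b ν hφ hz x y _)]
    refine integral_congr_ae (Filter.Eventually.of_forall fun α => ?_)
    simp only [smearedProdIntegrand, ← resolventMultilinear_apply, MultilinearMap.map_update_add,
      add_apply, inner_add_right, mul_add]
  map_update_smul' V i c A := by
    rw [smul_eq_mul, ← integral_const_mul]
    refine integral_congr_ae (Filter.Eventually.of_forall fun α => ?_)
    simp only [smearedProdIntegrand, ← resolventMultilinear_apply, MultilinearMap.map_update_smul,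
      smul_apply, inner_smul_right]
    ring

lemma norm_inner_dyson_le (x y : X) (l : List (X →L[ℂ] X)) {t : ℝ} (ht : 0 < t) :
    ‖inner ℂ x (evolution b ν t (dyson b ν l y t))‖
      ≤ t ^ l.length / l.length.factorial * ((l.map norm).prod * (‖x‖ * ‖y‖)) := by
  refine (norm_inner_le_norm _ _).trans ?_
  rw [norm_evolution]
  refine (mul_le_mul_of_nonneg_left (norm_dyson_le b ν l y t) (norm_nonneg x)).trans_eq ?_
  rw [abs_of_pos ht]
  ring

variable [CompleteSpace X] {χ : ℝ → ℝ} (hχ : IsCutoff χ) {a : ℝ} (ha : 0 < a)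
include hχ ha

/-- The smeared terms of the Neumann series as time integrals with a cutoff. -/
lemma integral_smearedProdIntegrand {z : ℂ} (hz : 0 < z.im) (x y : X) (l : List (X →L[ℂ] X)) :
    ∫ α, smearedProdIntegrand b ν (cutoffHat χ a) z x y l α
      = Complex.I ^ (l.length + 1) * ∫ t in Set.Ioi (0 : ℝ), Complex.exp (Complex.I * z * t)
          * (χ (a * t) * inner ℂ x (evolution b ν t (dyson b ν l y t))) := by
  have hl := laplaceIntegrable_dyson b ν l y hz
  have hg : LaplaceIntegrable
      (fun t => inner ℂ x (evolution b ν t (dyson b ν l y t))) z := by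
    have := Integrable.const_inner (𝕜 := ℂ) x hl
    simpa [LaplaceIntegrable, IntegrableOn, inner_smul_right] using this
  rw [← hχ.smear_laplace ha hg, ← integral_const_mul]
  refine integral_congr_ae (Filter.Eventually.of_forall fun α => ?_)
  have hα : 0 < (z + 2 * Real.pi * α).im := by simpa using hz
  have h1 := laplace_dyson b ν l y hα
  have h2 := inner_laplace (laplaceIntegrable_dyson b ν l y hα) x
  have h3 : resolventProd (diagResolvent b ν (z + 2 * Real.pi * α)) l y
      = Complex.I ^ (l.length + 1) • laplace (fun t => evolution b ν t (dyson b ν l y t))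
          (z + 2 * Real.pi * α) := by
    rw [pow_succ, mul_smul, h1, smul_smul, ← mul_pow]
    simp
  simp only [smearedProdIntegrand]
  rw [h3, inner_smul_right, h2]
  simp only [laplace, smul_eq_mul]
  ring

/-- The time ordering yields the factor `1 / n!` in the bound on the smeared terms. -/
lemma norm_integral_smearedProdIntegrand_le {z : ℂ} (hz : 0 < z.im) (x y : X)
    (l : List (X →L[ℂ] X)) :
    ‖∫ α, smearedProdIntegrand b ν (cutoffHat χ a) z x y l α‖
      ≤ (2 / a) ^ (l.length + 1) / l.length.factorial * ((l.map norm).prod * (‖x‖ * ‖y‖)) := by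
  rw [integral_smearedProdIntegrand b ν hχ ha hz, norm_mul, norm_pow, Complex.norm_I, one_pow,
    one_mul]
  refine hχ.norm_integral_cutoff_le ha hz l.length
    (fun t ht => norm_inner_dyson_le b ν x y l ht) ?_
  have h0 : 0 ≤ (l.map norm).prod := List.prod_nonneg fun x hx => by
    obtain ⟨A, -, rfl⟩ := List.mem_map.1 hx
    exact norm_nonneg A
  positivity

/-- The smeared terms of the Neumann series sum up to a cut-off Laplace transform of the perturbed
evolution, which is close to the perturbed resolvent. -/
lemma exists_hasSum_smeared {V : X →L[ℂ] X} (hV : ∀ x y, inner ℂ (V x) y = inner ℂ x (V y))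
    (lam : ℝ) {z : ℂ} (hz : 0 < z.im) (x y : X) :
    ∃ Q : ℂ, HasSum (fun n : ℕ => (-lam : ℂ) ^ n *
        ∫ α, smearedProdIntegrand b ν (cutoffHat χ a) z x y (List.replicate n V) α) Q ∧
      ‖inner ℂ x (perturbedLaplace b ν V lam z y) - Q‖
        ≤ Real.exp (-z.im / a) / z.im * (‖x‖ * ‖y‖) := by
  set u := fun t => evolution b ν t (dysonSeries b ν V lam y t) with hu'
  have hcu : Continuous u :=
    Continuous.evolution b ν continuous_id (continuous_dysonSeries b ν V lam y)
  have hu : LaplaceIntegrable u z := laplaceIntegrable_dysonSeries b ν hV lam hz y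
  have hub : ∀ t, ‖inner ℂ x (u t)‖ ≤ ‖x‖ * ‖y‖ := fun t => by
    refine (norm_inner_le_norm _ _).trans_eq ?_
    rw [norm_evolution, norm_dysonSeries b ν hV]
  have hcχ : Continuous fun t : ℝ => (χ (a * t) : ℂ) :=
    Complex.continuous_ofReal.comp (hχ.smooth.continuous.comp (continuous_const.mul continuous_id))
  refine ⟨Complex.I * ∫ t in Set.Ioi (0 : ℝ), Complex.exp (Complex.I * z * t)
    * (χ (a * t) * inner ℂ x (u t)), ?_, ?_⟩
  · have hterm : ∀ n : ℕ, (-lam : ℂ) ^ n *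
        ∫ α, smearedProdIntegrand b ν (cutoffHat χ a) z x y (List.replicate n V) α
        = Complex.I * ∫ t in Set.Ioi (0 : ℝ), Complex.exp (Complex.I * z * t)
          * (χ (a * t) * inner ℂ x (evolution b ν t
            ((-Complex.I * lam) ^ n • dyson b ν (List.replicate n V) y t))) := by
      intro n
      rw [integral_smearedProdIntegrand b ν hχ ha hz, List.length_replicate]
      simp only [map_smul, inner_smul_right]
      have : ∀ t : ℝ, Complex.exp (Complex.I * z * t) * (χ (a * t) * ((-Complex.I * lam) ^ n
          * inner ℂ x (evolution b ν t (dyson b ν (List.replicate n V) y t))))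
          = (-Complex.I * lam) ^ n * (Complex.exp (Complex.I * z * t) * (χ (a * t)
          * inner ℂ x (evolution b ν t (dyson b ν (List.replicate n V) y t)))) :=
        fun t => by ring
      simp only [this]
      rw [integral_const_mul, pow_succ]
      have h2 : (-Complex.I * lam) ^ n = (-lam : ℂ) ^ n * Complex.I ^ n := by
        rw [← mul_pow]; ring
      rw [h2]
      ring
    simp only [hterm]
    refine HasSum.mul_left _ ?_
    -- only times `t ≤ 2 / a` contribute, where the series converges uniformly
    refine hasSum_integral_of_dominated_convergence
      (fun n t => Real.exp (-z.im * t)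
        * ((|lam| * ‖V‖ * (2 / a)) ^ n / n.factorial * (‖x‖ * ‖y‖))) (fun n => ?_)
      (fun n => ?_) ?_ ?_ ?_
    · have := (Continuous.evolution b ν continuous_id
        ((continuous_dyson b ν (List.replicate n V) y).const_smul ((-Complex.I * lam : ℂ) ^ n)))
      exact (Continuous.mul (by fun_prop)
        (hcχ.mul (continuous_const.inner this))).aestronglyMeasurable
    · filter_upwards [ae_restrict_mem measurableSet_Ioi] with t ht
      rw [norm_mul, norm_exp_I_mul]
      refine mul_le_mul_of_nonneg_left ?_ (Real.exp_pos _).le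
      rcases le_or_gt (2 / a) t with h | h
      · rw [hχ.cutoff_eq_zero ha h]
        simp only [Complex.ofReal_zero, zero_mul, norm_zero]
        positivity
      · rw [norm_mul]
        have h1 : ‖inner ℂ x (evolution b ν t
            ((-Complex.I * lam) ^ n • dyson b ν (List.replicate n V) y t))‖
            ≤ (|lam| * ‖V‖ * (2 / a)) ^ n / n.factorial * (‖x‖ * ‖y‖) := by
          refine (norm_inner_le_norm _ _).trans ?_
          rw [norm_evolution]
          have := norm_dysonSeries_term_le b ν V lam y n t
          have ht0 : 0 < t := ht
          rw [abs_of_pos ht0] at this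
          calc _ ≤ ‖x‖ * ((|lam| * ‖V‖ * t) ^ n / n.factorial * ‖y‖) := by gcongr
            _ ≤ ‖x‖ * ((|lam| * ‖V‖ * (2 / a)) ^ n / n.factorial * ‖y‖) := by gcongr
            _ = _ := by ring
        calc _ ≤ 1 * ((|lam| * ‖V‖ * (2 / a)) ^ n / n.factorial * (‖x‖ * ‖y‖)) := by
              gcongr
              exact hχ.norm_cutoff_le a t
          _ = _ := one_mul _
    · exact Filter.Eventually.of_forall fun t =>
        (summable_pow_div_factorial_mul _ _).mul_left _
    · simp only [tsum_mul_left]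
      exact (integrableOn_exp_mul_Ioi (neg_lt_zero.2 hz) 0).mul_const _
    · refine Filter.Eventually.of_forall fun t => ?_
      refine HasSum.mul_left _ (HasSum.mul_left _ ?_)
      exact ((hasSum_dysonSeries b ν V lam y t).mapL (evolution b ν t)).mapL (innerSL ℂ x)
  · have h1 : inner ℂ x (perturbedLaplace b ν V lam z y)
        = Complex.I * ∫ t in Set.Ioi (0 : ℝ), Complex.exp (Complex.I * z * t)
          * inner ℂ x (u t) := by
      rw [perturbedLaplace, inner_smul_right, inner_laplace hu]
    have hi : IntegrableOn (fun t : ℝ => Complex.exp (Complex.I * z * t) * inner ℂ x (u t))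
        (Set.Ioi 0) := by
      have := Integrable.const_inner (𝕜 := ℂ) x hu
      simpa [IntegrableOn, inner_smul_right] using this
    have hi2 : IntegrableOn (fun t : ℝ => Complex.exp (Complex.I * z * t)
        * (χ (a * t) * inner ℂ x (u t))) (Set.Ioi 0) := by
      have := hi.bdd_mul (f := fun t : ℝ => (χ (a * t) : ℂ)) (c := 1)
        hcχ.aestronglyMeasurable (Filter.Eventually.of_forall fun t => hχ.norm_cutoff_le a t)
      refine Integrable.congr this (Filter.Eventually.of_forall fun t => ?_)
      simp only
      ring
    rw [h1, ← mul_sub, ← integral_sub hi hi2, norm_mul, Complex.norm_I, one_mul]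
    refine le_trans (le_of_eq ?_) (hχ.norm_integral_one_sub_cutoff_le ha hz hub)
    congr 1
    refine integral_congr_ae (Filter.Eventually.of_forall fun t => ?_)
    simp only
    ring

end Smeared

/-! ### The Fourier basis of the box -/

section FourierBasis

-- the measure on the circle is the Haar probability measure
attribute [local instance] instMeasureSpaceUnitAddCircle

variable {d : ℕ} {L : ℝ}

/-- The identification of the unit torus with the box, up to a set of measure zero: a point of the
torus has a representative in `(-1/2, 1/2]^d`, which is multiplied by `L`. -/
def torusToBox (d : ℕ) (L : ℝ) (t : UnitAddTorus (Fin d)) : Space d :=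
  WithLp.toLp 2 (L • fun i => ((UnitAddTorus.measurableEquivPiIoc fun _ => (-(1 / 2) : ℝ)) t).1 i)

lemma measurable_torusToBox : Measurable (torusToBox d L) := by
  refine (WithLp.measurable_toLp 2 (Fin d → ℝ)).comp (Measurable.const_smul ?_ L)
  exact measurable_subtype_coe.comp (MeasurableEquiv.measurable _)

lemma planeWave_torusToBox (hL : 0 < L) (m : Fin d → ℤ) (t : UnitAddTorus (Fin d)) :
    planeWave (dualPoint L m) (torusToBox d L t) = UnitAddTorus.mFourier m t := by
  have ht : ∀ i, t i = ((((UnitAddTorus.measurableEquivPiIoc fun _ => (-(1 / 2) : ℝ)) t).1 i : ℝ) :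
      UnitAddCircle) := fun i => (AddCircle.coe_equivIoc (p := (1 : ℝ)) (a := -(1 / 2))).symm
  have h : UnitAddTorus.mFourier m t = ∏ i, fourier (m i) (t i) := rfl
  rw [h, planeWave, torusToBox]
  set τ := ((UnitAddTorus.measurableEquivPiIoc fun _ => (-(1 / 2) : ℝ)) t).1
  have h2 : ∀ i, fourier (m i) (t i) = Complex.exp (2 * Real.pi * Complex.I * (m i * τ i)) := by
    intro i
    rw [ht i, fourier_coe_apply]
    congr 1
    simp
    ring
  simp only [h2]
  rw [← Complex.exp_sum, ← Finset.mul_sum]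
  congr 2
  simp only [dualPoint, PiLp.inner_apply, RCLike.inner_apply, conj_trivial, Pi.smul_apply,
    smul_eq_mul]
  push_cast
  refine Finset.sum_congr rfl fun i _ => ?_
  have : (L : ℂ) ≠ 0 := by exact_mod_cast hL.ne'
  field_simp

/-- Haar measure on the torus corresponds to a multiple of Lebesgue measure on the box, the two boxes
`(-1/2, 1/2]^d` and `[-1/2, 1/2)^d` being equal almost everywhere. -/
lemma map_torusToBox (hL : 0 < L) : ∃ c : ℝ≥0∞, c ≠ 0 ∧ c ≠ ∞ ∧
    (volume : Measure (UnitAddTorus (Fin d))).map (torusToBox d L)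
      = c • (volume : Measure (Space d)).restrict (box d L) := by
  set a : Fin d → ℝ := fun _ => -(1 / 2)
  have hS : MeasurableSet {x : Fin d → ℝ | ∀ i, x i ∈ Set.Ioc (a i) (a i + 1)} :=
    MeasurableSet.univ_pi' fun i => measurableSet_Ioc
  have h1 := ((measurePreserving_subtype_coe (μa := (volume : Measure (Fin d → ℝ))) hS).comp
    (UnitAddTorus.measurePreserving_equivPiIoc a)).map_eq
  have h2 : (volume : Measure (Fin d → ℝ)).restrict {x | ∀ i, x i ∈ Set.Ioc (a i) (a i + 1)}
      = volume.restrict (Set.univ.pi fun i => Set.Ico (-(1 / 2)) (1 / 2)) := by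
    refine Measure.restrict_congr_set ?_
    have e1 : {x : Fin d → ℝ | ∀ i, x i ∈ Set.Ioc (a i) (a i + 1)}
        = Set.univ.pi fun i => Set.Ioc (a i) (a i + 1) := by
      ext x; simp [Set.mem_pi]
    have e2 : ∀ i, a i + 1 = 1 / 2 := fun i => by norm_num [a]
    rw [e1]
    simp only [e2]
    exact (Measure.univ_pi_Ioc_ae_eq_Icc (μ := fun _ : Fin d => (volume : Measure ℝ))).trans
      (Measure.univ_pi_Ico_ae_eq_Icc (μ := fun _ : Fin d => (volume : Measure ℝ))).symm
  set D : (Fin d → ℝ) → Space d := fun x => WithLp.toLp 2 (L • x)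
  have hD : Measurable D :=
    (WithLp.measurable_toLp 2 (Fin d → ℝ)).comp (measurable_const_smul L)
  have hpre : (Set.univ.pi fun _ : Fin d => Set.Ico (-(1 / 2) : ℝ) (1 / 2)) = D ⁻¹' box d L := by
    ext x
    simp only [Set.mem_pi, Set.mem_univ, true_implies, Set.mem_Ico, box, D, Set.mem_preimage,
      Set.mem_ofPred_eq, Pi.smul_apply, smul_eq_mul]
    refine forall_congr' fun i => and_congr ⟨fun h => ?_, fun h => ?_⟩ ⟨fun h => ?_, fun h => ?_⟩ <;>
      nlinarith
  set c : ℝ≥0∞ := ENNReal.ofReal |(L ^ Module.finrank ℝ (Fin d → ℝ))⁻¹|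
  refine ⟨c, ?_, ENNReal.ofReal_ne_top, ?_⟩
  · simp only [c, ne_eq, ENNReal.ofReal_eq_zero, not_le]
    positivity
  · have h3 : torusToBox d L = D ∘ (Subtype.val ∘ (UnitAddTorus.measurableEquivPiIoc a)) := rfl
    have h5 : (volume : Measure (UnitAddTorus (Fin d))).map (torusToBox d L)
        = (volume.restrict {x : Fin d → ℝ | ∀ i, x i ∈ Set.Ioc (a i) (a i + 1)}).map D := by
      rw [← h1, h3]
      exact (Measure.map_map hD
        (measurable_subtype_coe.comp (MeasurableEquiv.measurable _))).symm
    rw [h5, h2, hpre, ← Measure.restrict_map hD (measurableSet_box d L)]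
    have h4 : (volume : Measure (Fin d → ℝ)).map D = c • (volume : Measure (Space d)) := by
      have : D = (WithLp.toLp 2) ∘ (L • ·) := rfl
      rw [this, ← Measure.map_map (WithLp.measurable_toLp 2 _) (measurable_const_smul L),
        Measure.map_addHaar_smul _ hL.ne', Measure.map_smul,
        (PiLp.volume_preserving_toLp (Fin d)).map_eq]
    rw [h4, Measure.restrict_smul]

/-- The plane waves are complete in `L²(Λ_L)`. -/
lemma eq_zero_of_inner_planeWaveLp (hL : 0 < L) {f : BoxL2 d L}
    (hf : ∀ m, inner ℂ (planeWaveLp L (dualPoint L m)) f = 0) : f = 0 := by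
  obtain ⟨c, hc0, hc, hmap⟩ := map_torusToBox (d := d) hL
  have hm := measurable_torusToBox (d := d) (L := L)
  have hfmem : MemLp f 2 ((volume : Measure (UnitAddTorus (Fin d))).map (torusToBox d L)) := by
    rw [hmap]
    exact (Lp.memLp f).smul_measure hc
  have hF : MemLp (f ∘ torusToBox d L) 2 (volume : Measure (UnitAddTorus (Fin d))) :=
    hfmem.comp_of_map hm.aemeasurable
  have hcoef : ∀ m, UnitAddTorus.mFourierCoeff (hF.toLp _) m = 0 := by
    intro m
    have h1 : UnitAddTorus.mFourierCoeff (hF.toLp _) m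
        = ∫ t, (fun x => (starRingEnd ℂ) (planeWave (dualPoint L m) x) * f x)
            (torusToBox d L t) := by
      refine integral_congr_ae ?_
      filter_upwards [hF.coeFn_toLp] with t ht
      rw [ht, UnitAddTorus.mFourier_neg, ← planeWave_torusToBox hL, smul_eq_mul, Function.comp]
    have h2 := integral_map (μ := (volume : Measure (UnitAddTorus (Fin d)))) hm.aemeasurable
      (f := fun x => (starRingEnd ℂ) (planeWave (dualPoint L m) x) * f x) (by
        refine AEStronglyMeasurable.mul ?_ hfmem.aestronglyMeasurable
        exact (Complex.continuous_conj.comp (continuous_planeWave _)).aestronglyMeasurable)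
    rw [h1, ← h2, hmap, integral_smul_measure]
    have h3 := hf m
    rw [← fourierCoeff_eq_inner, fourierCoeff] at h3
    simp only [conj_planeWave]
    rw [h3, smul_zero]
  have hzero : hF.toLp _ = 0 := by
    have := UnitAddTorus.hasSum_mFourier_series_L2 (hF.toLp _)
    simp only [hcoef, zero_smul] at this
    exact this.unique hasSum_zero
  have h0 : f ∘ torusToBox d L =ᵐ[volume] 0 :=
    hF.coeFn_toLp.symm.trans (by rw [hzero]; exact Lp.coeFn_zero _ _ _)
  have h1 : ∀ᵐ x ∂((volume : Measure (UnitAddTorus (Fin d))).map (torusToBox d L)), f x = 0 := by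
    obtain ⟨g, hg, hfg⟩ := hfmem.aestronglyMeasurable
    have h2 : ∀ᵐ t ∂(volume : Measure (UnitAddTorus (Fin d))), g (torusToBox d L t) = 0 := by
      filter_upwards [ae_of_ae_map hm.aemeasurable hfg, h0] with t ht h0t
      rw [← ht]
      exact h0t
    have h3 := (ae_map_iff hm.aemeasurable
      (hg.measurable (measurableSet_singleton (0 : ℂ)))).2 h2
    filter_upwards [hfg, h3] with x hx hgx
    rw [hx]
    exact hgx
  rw [hmap, ae_iff, Measure.smul_apply, smul_eq_mul, mul_eq_zero, or_iff_right hc0] at h1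
  rw [Lp.eq_zero_iff_ae_eq_zero]
  exact h1

lemma boxVolume_eq (hL : 0 < L) : boxVolume d L = L ^ d := by
  rw [boxVolume, Measure.real, volume_box, ENNReal.toReal_pow, ENNReal.toReal_ofReal hL.le]

lemma boxVolume_pos (hL : 0 < L) : 0 < boxVolume d L := by
  rw [boxVolume_eq hL]
  positivity

lemma inner_planeWaveLp_self (p : Space d) :
    inner ℂ (planeWaveLp L p) (planeWaveLp L p) = boxVolume d L := by
  rw [L2.inner_def]
  have : ∫ x in box d L, inner ℂ (planeWaveLp L p x) (planeWaveLp L p x)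
      = ∫ x in box d L, (1 : ℂ) := by
    refine integral_congr_ae ?_
    filter_upwards [(memLp_planeWave L p).coeFn_toLp] with x hx
    rw [planeWaveLp, hx, RCLike.inner_apply, Complex.mul_conj', norm_planeWave]
    simp
  rw [this, integral_const, boxVolume, Measure.real, Measure.real, Measure.restrict_apply_univ]
  simp

lemma orthonormal_planeWaveLp (d : ℕ) {L : ℝ} (hL : 0 < L) : Orthonormal ℂ
    fun m : Fin d → ℤ => ((√(boxVolume d L))⁻¹ : ℂ) • planeWaveLp L (dualPoint L m) := by
  refine ⟨fun m => ?_, fun m n hmn => ?_⟩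
  · have h2 : ‖planeWaveLp L (dualPoint L m)‖ ^ 2 = boxVolume d L := by
      rw [norm_sq_eq_re_inner (𝕜 := ℂ), inner_planeWaveLp_self]
      rfl
    have h3 : ‖planeWaveLp L (dualPoint L m)‖ = √(boxVolume d L) := by
      rw [← h2, Real.sqrt_sq (norm_nonneg _)]
    rw [norm_smul, h3, norm_inv, Complex.norm_real, Real.norm_of_nonneg (Real.sqrt_nonneg _)]
    exact inv_mul_cancel₀ (Real.sqrt_pos.2 (boxVolume_pos hL)).ne'
  · change inner ℂ (((√(boxVolume d L))⁻¹ : ℂ) • planeWaveLp L (dualPoint L m))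
      (((√(boxVolume d L))⁻¹ : ℂ) • planeWaveLp L (dualPoint L n)) = 0
    rw [inner_smul_left, inner_smul_right, inner_planeWaveLp hL hmn]
    simp

lemma orthogonal_span_planeWaveLp (d : ℕ) {L : ℝ} (hL : 0 < L) :
    (Submodule.span ℂ (Set.range fun m : Fin d → ℤ =>
      ((√(boxVolume d L))⁻¹ : ℂ) • planeWaveLp L (dualPoint L m)))ᗮ = ⊥ := by
  rw [Submodule.eq_bot_iff]
  intro f hf
  refine eq_zero_of_inner_planeWaveLp hL fun m => ?_
  have h := (Submodule.mem_orthogonal _ _).1 hf _ (Submodule.subset_span ⟨m, rfl⟩)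
  rw [inner_smul_left] at h
  refine (mul_eq_zero.1 h).resolve_left ?_
  simpa using (Real.sqrt_pos.2 (boxVolume_pos hL)).ne'

/-- The Hilbert basis `|Λ_L|^{-1/2} e^{2πi p·x}`, `p ∈ Λ_L^*`, of `L²(Λ_L)`. -/
def boxBasis (d : ℕ) {L : ℝ} (hL : 0 < L) : HilbertBasis (Fin d → ℤ) ℂ (BoxL2 d L) :=
  HilbertBasis.mkOfOrthogonalEqBot (orthonormal_planeWaveLp d hL)
    (orthogonal_span_planeWaveLp d hL)

lemma boxBasis_apply (hL : 0 < L) (m : Fin d → ℤ) :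
    boxBasis d hL m = ((√(boxVolume d L))⁻¹ : ℂ) • planeWaveLp L (dualPoint L m) := by
  rw [boxBasis, HilbertBasis.coe_mkOfOrthogonalEqBot]

lemma fourierCoeff_eq_inner_boxBasis (hL : 0 < L) (f : BoxL2 d L) (m : Fin d → ℤ) :
    fourierCoeff f m = (√(boxVolume d L) : ℂ) * inner ℂ (boxBasis d hL m) f := by
  have h0 : (√(boxVolume d L) : ℂ) ≠ 0 := by
    exact_mod_cast (Real.sqrt_pos.2 (boxVolume_pos hL)).ne'
  rw [boxBasis_apply, inner_smul_left, fourierCoeff_eq_inner, ← Complex.ofReal_inv,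
    Complex.conj_ofReal, Complex.ofReal_inv, mul_inv_cancel_left₀ h0]

lemma inner_boxBasis_invFourier (hL : 0 < L) {g : (Fin d → ℤ) → ℂ} (hg : Memℓp g 2)
    (m : Fin d → ℤ) :
    inner ℂ (boxBasis d hL m) (invFourier L g) = ((√(boxVolume d L))⁻¹ : ℂ) * g m := by
  have h := (summable_fourier hL hg).hasSum.mapL (innerSL ℂ (boxBasis d hL m))
  refine h.unique ?_
  have hv : (boxVolume d L : ℂ) ≠ 0 := by exact_mod_cast (boxVolume_pos hL).ne'
  have key : ∀ n, innerSL ℂ (boxBasis d hL m)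
      (((boxVolume d L : ℂ)⁻¹ * g n) • planeWaveLp L (dualPoint L n))
      = if n = m then ((√(boxVolume d L))⁻¹ : ℂ) * g m else 0 := by
    intro n
    rw [innerSL_apply_apply, inner_smul_right, boxBasis_apply, inner_smul_left, map_inv₀,
      Complex.conj_ofReal]
    split_ifs with h
    · rw [h, inner_planeWaveLp_self]
      field_simp
    · rw [inner_planeWaveLp hL (Ne.symm h)]
      simp
  simp only [key]
  exact hasSum_ite_eq m _

lemma memℓp_const_mul_iff {ι : Type*} {c : ℂ} (hc : c ≠ 0) (g : ι → ℂ) :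
    Memℓp (fun i => c * g i) 2 ↔ Memℓp g 2 := by
  refine ⟨fun h => ?_, fun h => h.const_smul c⟩
  have := h.const_smul c⁻¹
  convert this using 1
  funext i
  simp [inv_mul_cancel_left₀ hc]

/-- The free Hamiltonian is diagonal in the Fourier basis. -/
lemma isDiagonal_freeHamiltonian (hL : 0 < L) :
    IsDiagonal (boxBasis d hL) (fun m => energy (dualPoint L m)) (freeHamiltonian d hL) := by
  have h0 : (√(boxVolume d L) : ℂ) ≠ 0 := by
    exact_mod_cast (Real.sqrt_pos.2 (boxVolume_pos hL)).ne'
  have hcoef : ∀ (f : BoxL2 d L) m, energyCoeff f m = (√(boxVolume d L) : ℂ)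
      * ((energy (dualPoint L m) : ℂ) * inner ℂ (boxBasis d hL m) f) := by
    intro f m
    rw [energyCoeff, fourierCoeff_eq_inner_boxBasis hL]
    ring
  refine ⟨fun f => ?_, fun f m => ?_⟩
  · rw [← memℓp_const_mul_iff h0]
    simp only [← hcoef]
    exact Iff.rfl
  · have hf : Memℓp (energyCoeff (f : BoxL2 d L)) 2 := f.2
    have h1 : freeHamiltonian d hL f = (1 / (2 * (2 * Real.pi) ^ 2) : ℂ)
        • (2 * (2 * Real.pi) ^ 2 : ℂ) • invFourier L (energyCoeff (f : BoxL2 d L)) := rfl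
    have hpi : (Real.pi : ℂ) ≠ 0 := by exact_mod_cast Real.pi_ne_zero
    rw [h1, smul_smul, one_div_mul_cancel (by simp [hpi]), one_smul,
      inner_boxBasis_invFourier hL hf, hcoef, inv_mul_cancel_left₀ h0]

end FourierBasis

/-! ### Fourier coefficients of the periodized profile -/

section Profile

open scoped LineDeriv

variable {d : ℕ} {L : ℝ}

/-- The unit vector in direction `j`. -/
def unitVec (d : ℕ) (j : Fin d) : Space d := EuclideanSpace.single j 1

/-- The function `f` takes the same values on the two faces of the box orthogonal to the direction
`j`. -/
def FacesMatch {β : Type*} (L : ℝ) (j : Fin d) (f : Space d → β) : Prop :=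
  ∀ x : Space d, x j = L / 2 → f (x - L • unitVec d j) = f x

/-- A derivative in the direction `j` integrates to zero over the box, if the boundary terms
cancel. -/
lemma integral_box_fderiv_eq_zero (hL : 0 < L) (j : Fin d) {F : Space d → ℂ}
    {F' : Space d → Space d →L[ℝ] ℂ} (hF : ∀ x, HasFDerivAt F (F' x) x)
    (hF' : Continuous fun x => F' x (unitVec d j)) (hj : FacesMatch L j F) :
    ∫ x in box d L, F' x (unitVec d j) = 0 := by
  obtain _ | n := d
  · exact j.elim0
  set e := (PiLp.continuousLinearEquiv 2 ℝ (fun _ : Fin (n + 1) => ℝ)).symm with he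
  have hcF : Continuous F := continuous_iff_continuousAt.2 fun x => (hF x).continuousAt
  have hG : ∀ y : Fin (n + 1) → ℝ, HasFDerivAt (fun y => F (e y)) ((F' (e y)).comp
      (e : (Fin (n + 1) → ℝ) →L[ℝ] Space (n + 1))) y := fun y =>
    (hF (e y)).comp y e.hasFDerivAt
  have hsing : e (Pi.single j 1) = unitVec (n + 1) j := rfl
  have hc : Continuous fun y : Fin (n + 1) → ℝ => F' (e y) (unitVec (n + 1) j) :=
    hF'.comp e.continuous
  have hsum : ∀ x : Fin (n + 1) → ℝ, ∑ i, (if i = j then (F' (e x)).comp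
      (e : (Fin (n + 1) → ℝ) →L[ℝ] Space (n + 1)) else 0) (Pi.single i 1)
      = F' (e x) (unitVec (n + 1) j) := by
    intro x
    rw [Finset.sum_eq_single j]
    · rw [if_pos rfl, ← hsing]; rfl
    · intro i _ hi
      rw [if_neg hi]; rfl
    · simp
  -- the divergence theorem for the vector field `F e_j`
  have hdiv := integral_divergence_of_hasFDerivAt_off_countable' (E := ℂ)
    (fun _ : Fin (n + 1) => -(L / 2)) (fun _ => L / 2) (fun _ => by simp only; linarith)
    (fun i y => if i = j then F (e y) else 0)
    (fun i y => if i = j then (F' (e y)).comp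
      (e : (Fin (n + 1) → ℝ) →L[ℝ] Space (n + 1)) else 0) ∅ Set.countable_empty
    (fun i => by
      by_cases hi : i = j
      · simp only [hi, if_true]
        exact (hcF.comp e.continuous).continuousOn
      · simp only [hi, if_false]
        exact continuousOn_const)
    (fun y _ i => by
      by_cases hi : i = j
      · simp only [hi, if_true]
        exact hG y
      · simp only [hi, if_false]
        exact hasFDerivAt_const _ _)
    (by
      simp only [hsum]
      exact hc.continuousOn.integrableOn_compact isCompact_Icc)
  simp only [hsum] at hdiv
  have hfaces : ∀ x : Fin n → ℝ, F (e (j.insertNth (L / 2) x)) = F (e (j.insertNth (-(L / 2)) x)) := by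
    intro x
    rw [← hj (e (j.insertNth (L / 2) x)) (by simp [he])]
    congr 1
    ext i
    refine Fin.succAboveCases j ?_ (fun k => ?_) i
    · simp [he, unitVec]
      ring
    · simp [he, unitVec]
  rw [Finset.sum_eq_single j] at hdiv
  · simp only [if_true, hfaces, sub_self] at hdiv
    have h1 := integral_box (n + 1) L (fun y => F' (e y) (unitVec (n + 1) j))
    have h2 : ∀ x : Space (n + 1), e (fun j => x j) = x := fun x => rfl
    simp only [h2] at h1
    rw [h1, ← Measure.restrict_pi_pi, ← hdiv]
    exact setIntegral_congr_set
      (Measure.univ_pi_Ico_ae_eq_Icc (μ := fun _ : Fin (n + 1) => (volume : Measure ℝ)))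
  · intro i _ hi
    simp [hi]
  · simp

lemma planeWave_add (p x y : Space d) : planeWave p (x + y) = planeWave p x * planeWave p y := by
  rw [planeWave, planeWave, planeWave, ← Complex.exp_add, inner_add_right]
  congr 1
  push_cast
  ring

lemma planeWave_neg (p x : Space d) : planeWave p (-x) = (starRingEnd ℂ) (planeWave p x) := by
  rw [conj_planeWave, planeWave, inner_neg_right]
  congr 1
  push_cast
  ring

lemma inner_dualPoint (m : Fin d → ℤ) (x : Space d) :
    inner ℝ (dualPoint L m) x = ∑ i, (m i / L) * x i := by
  simp only [dualPoint, PiLp.inner_apply, RCLike.inner_apply, conj_trivial]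
  exact Finset.sum_congr rfl fun i _ => mul_comm _ _

/-- The plane waves with momenta in the dual lattice are periodic. -/
lemma planeWave_lattice (hL : 0 < L) (m k : Fin d → ℤ) :
    planeWave (dualPoint L m) (WithLp.toLp 2 fun i => L * (k i : ℝ)) = 1 := by
  rw [planeWave, inner_dualPoint, Complex.exp_eq_one_iff]
  refine ⟨∑ i, m i * k i, ?_⟩
  push_cast
  rw [mul_comm]
  congr 1
  refine Finset.sum_congr rfl fun i _ => ?_
  have : (L : ℂ) ≠ 0 := by exact_mod_cast hL.ne'
  field_simp

lemma facesMatch_planeWave (hL : 0 < L) (m : Fin d → ℤ) (j : Fin d) :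
    FacesMatch L j (planeWave (dualPoint L m)) := by
  intro x _
  have h := planeWave_lattice hL m (-Pi.single j 1)
  have h2 : (WithLp.toLp 2 fun i => L * (((-Pi.single j 1 : Fin d → ℤ) i : ℤ) : ℝ) : Space d)
      = -(L • unitVec d j) := by
    ext i
    by_cases hi : i = j
    · subst hi; simp [unitVec]
    · simp [unitVec, hi]
  rw [h2] at h
  rw [sub_eq_add_neg, planeWave_add, h, mul_one]

lemma hasFDerivAt_conj_planeWave (p x : Space d) :
    HasFDerivAt (fun x => (starRingEnd ℂ) (planeWave p x))
      ((-(2 * Real.pi * Complex.I) * (starRingEnd ℂ) (planeWave p x)) •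
        Complex.ofRealCLM.comp (innerSL ℝ p)) x := by
  have h1 : HasFDerivAt (fun x : Space d => ((inner ℝ p x : ℝ) : ℂ))
      (Complex.ofRealCLM.comp (innerSL ℝ p)) x :=
    (Complex.ofRealCLM.comp (innerSL ℝ p)).hasFDerivAt
  have h2 := (h1.const_mul (-(2 * Real.pi * Complex.I))).cexp
  have h3 : (fun x => (starRingEnd ℂ) (planeWave p x))
      = fun x => Complex.exp (-(2 * Real.pi * Complex.I) * ((inner ℝ p x : ℝ) : ℂ)) := by
    funext x
    rw [conj_planeWave]
    congr 1
    ring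
  rw [h3]
  refine h2.congr_fderiv ?_
  ext v
  have h4 := congrFun h3 x
  rw [h4]
  simp
  ring

/-- The Fourier coefficient over the box of a function on `ℝ^d`. -/
def boxCoeff (L : ℝ) (f : Space d → ℂ) (m : Fin d → ℤ) : ℂ :=
  ∫ x in box d L, (starRingEnd ℂ) (planeWave (dualPoint L m) x) * f x

lemma integrable_planeWave_mul (L : ℝ) (f : 𝓢(Space d, ℂ)) (m : Fin d → ℤ) :
    IntegrableOn (fun x => (starRingEnd ℂ) (planeWave (dualPoint L m) x) * f x) (box d L) := by
  refine (f.integrable.integrableOn).bdd_mul (c := 1)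
    (Complex.continuous_conj.comp (continuous_planeWave _)).aestronglyMeasurable
    (Filter.Eventually.of_forall fun x => ?_)
  rw [RCLike.norm_conj, norm_planeWave]

/-- Integration by parts over the box. -/
lemma boxCoeff_lineDeriv (hL : 0 < L) (j : Fin d) (f : 𝓢(Space d, ℂ)) (hf : FacesMatch L j f)
    (m : Fin d → ℤ) :
    boxCoeff L (∂_{unitVec d j} f : 𝓢(Space d, ℂ)) m
      = (2 * Real.pi * Complex.I * (m j / L)) * boxCoeff L f m := by
  set p := dualPoint L m
  have hd : ∀ x, HasFDerivAt (fun x => (starRingEnd ℂ) (planeWave p x) * f x)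
      ((starRingEnd ℂ) (planeWave p x) • fderiv ℝ f x
        + f x • ((-(2 * Real.pi * Complex.I) * (starRingEnd ℂ) (planeWave p x)) •
          Complex.ofRealCLM.comp (innerSL ℝ p))) x := fun x =>
    (hasFDerivAt_conj_planeWave p x).mul (f.differentiableAt.hasFDerivAt)
  have hin : inner ℝ p (unitVec d j) = m j / L := by
    rw [inner_dualPoint, Finset.sum_eq_single j]
    · simp [unitVec]
    · intro i _ hi
      simp [unitVec, hi]
    · simp
  have hval : ∀ x, ((starRingEnd ℂ) (planeWave p x) • fderiv ℝ f x
        + f x • ((-(2 * Real.pi * Complex.I) * (starRingEnd ℂ) (planeWave p x)) •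
          Complex.ofRealCLM.comp (innerSL ℝ p))) (unitVec d j)
      = (starRingEnd ℂ) (planeWave p x) * (∂_{unitVec d j} f : 𝓢(Space d, ℂ)) x
        - (2 * Real.pi * Complex.I * (m j / L)) * ((starRingEnd ℂ) (planeWave p x) * f x) := by
    intro x
    rw [SchwartzMap.lineDerivOp_apply_eq_fderiv]
    simp only [add_apply, smul_apply, ContinuousLinearMap.comp_apply, innerSL_apply_apply, hin,
      Complex.ofRealCLM_apply, smul_eq_mul]
    push_cast
    ring
  have hcp : Continuous fun x => (starRingEnd ℂ) (planeWave p x) :=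
    Complex.continuous_conj.comp (continuous_planeWave _)
  have h0 := integral_box_fderiv_eq_zero hL j hd (by
      simp only [hval]
      exact (hcp.mul (SchwartzMap.continuous _)).sub
        (continuous_const.mul (hcp.mul f.continuous))) (by
      intro x hx
      simp only
      rw [hf x hx, facesMatch_planeWave hL m j x hx])
  simp only [hval] at h0
  rw [integral_sub (integrable_planeWave_mul L _ m) ((integrable_planeWave_mul L f m).const_mul _),
    integral_const_mul] at h0
  exact sub_eq_zero.1 h0

/-- The operator `1 + ∂_j`. -/
def oneAddDeriv (j : Fin d) (f : 𝓢(Space d, ℂ)) : 𝓢(Space d, ℂ) := f + ∂_{unitVec d j} f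

/-- Derivatives along the faces preserve the matching of the values on them. -/
lemma FacesMatch.oneAddDeriv {i j : Fin d} (hij : i ≠ j) {f : 𝓢(Space d, ℂ)}
    (hf : FacesMatch L j f) : FacesMatch L j (oneAddDeriv i f) := by
  intro x hx
  have h : (∂_{unitVec d i} f : 𝓢(Space d, ℂ)) (x - L • unitVec d j)
      = (∂_{unitVec d i} f : 𝓢(Space d, ℂ)) x := by
    rw [SchwartzMap.lineDerivOp_apply, SchwartzMap.lineDerivOp_apply, lineDeriv, lineDeriv]
    congr 1
    funext t
    rw [sub_add_eq_add_sub]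
    refine hf _ ?_
    simp [unitVec, hij.symm, hx]
  change f _ + (∂_{unitVec d i} f : 𝓢(Space d, ℂ)) _ = f _ + (∂_{unitVec d i} f : 𝓢(Space d, ℂ)) _
  rw [h, hf x hx]

lemma boxCoeff_oneAddDeriv (hL : 0 < L) (j : Fin d) (f : 𝓢(Space d, ℂ)) (hf : FacesMatch L j f)
    (m : Fin d → ℤ) :
    boxCoeff L (oneAddDeriv j f) m
      = (1 + 2 * Real.pi * Complex.I * (m j / L)) * boxCoeff L f m := by
  rw [add_mul, one_mul, ← boxCoeff_lineDeriv hL j f hf, boxCoeff, boxCoeff, boxCoeff,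
    ← integral_add (integrable_planeWave_mul L _ m) (integrable_planeWave_mul L _ m)]
  refine integral_congr_ae (Filter.Eventually.of_forall fun x => ?_)
  simp only [oneAddDeriv, add_apply]
  ring

/-- The mixed derivative `∏_j (1 + ∂_j) f`, over a list of directions. -/
def mixedDeriv (l : List (Fin d)) (f : 𝓢(Space d, ℂ)) : 𝓢(Space d, ℂ) := l.foldr oneAddDeriv f

lemma FacesMatch.mixedDeriv {j : Fin d} {l : List (Fin d)} (hj : j ∉ l) {f : 𝓢(Space d, ℂ)}
    (hf : FacesMatch L j f) : FacesMatch L j (mixedDeriv l f) := by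
  induction l with
  | nil => exact hf
  | cons i l ih =>
    rw [List.mem_cons, not_or] at hj
    exact (ih hj.2).oneAddDeriv (Ne.symm hj.1)

/-- Each derivative acts on the Fourier coefficients as multiplication. The list must be without
repetition, as matching of `f` on opposite faces says nothing about its normal derivatives. -/
lemma boxCoeff_mixedDeriv (hL : 0 < L) {l : List (Fin d)} (hl : l.Nodup) (f : 𝓢(Space d, ℂ))
    (hf : ∀ j, FacesMatch L j f) (m : Fin d → ℤ) :
    boxCoeff L (mixedDeriv l f) m
      = (l.map fun j => (1 + 2 * Real.pi * Complex.I * (m j / L) : ℂ)).prod * boxCoeff L f m := by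
  induction l with
  | nil => simp [mixedDeriv]
  | cons j l ih =>
    rw [List.nodup_cons] at hl
    rw [List.map_cons, List.prod_cons, mul_assoc, ← ih hl.2]
    exact boxCoeff_oneAddDeriv hL j _ ((hf j).mixedDeriv hl.1) m

end Profile

section ProfileBounds

variable {d : ℕ} {L : ℝ}

/-- The Riemann sum of the Lorentz function over `(1/L)ℤ` is of order `L`. -/
lemma sum_lorentz_le (hL : 1 ≤ L) (N : ℕ) :
    ∑ k ∈ Finset.Icc (-(N : ℤ)) N, (1 + ((k : ℝ) / L) ^ 2)⁻¹ ≤ 5 * L := by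
  have hL0 : 0 < L := one_pos.trans_le hL
  have heven : Function.Even fun k : ℤ => (1 + ((k : ℝ) / L) ^ 2)⁻¹ := by
    intro k
    simp only [Int.cast_neg]
    congr 2
    ring
  rw [Finset.sum_Icc_of_even_eq_range heven, Finset.sum_range_succ']
  have htel : ∑ k ∈ Finset.range N, (1 + ((((k + 1 : ℕ) : ℤ) : ℝ) / L) ^ 2)⁻¹ ≤ 2 * L := by
    -- comparison with a telescoping sum
    have hterm : ∀ k : ℕ, (1 + ((((k + 1 : ℕ) : ℤ) : ℝ) / L) ^ 2)⁻¹
        ≤ 2 * L ^ 2 * ((L + k)⁻¹ - (L + (k + 1 : ℕ))⁻¹) := by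
      intro k
      have hk : (0 : ℝ) ≤ k := k.cast_nonneg
      have e1 : (L + (k : ℝ))⁻¹ - (L + (k + 1 : ℕ))⁻¹ = ((L + k) * (L + k + 1))⁻¹ := by
        push_cast
        have h1 : L + k ≠ 0 := by positivity
        have h2 : L + (k + 1) ≠ 0 := by positivity
        have h3 : L + k + 1 ≠ 0 := by positivity
        field_simp
        ring
      have e2 : (1 + ((((k + 1 : ℕ) : ℤ) : ℝ) / L) ^ 2)⁻¹ = L ^ 2 * (L ^ 2 + (k + 1) ^ 2)⁻¹ := by
        push_cast
        field_simp
      rw [e1, e2]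
      have h4 : (L ^ 2 + ((k : ℝ) + 1) ^ 2)⁻¹ ≤ 2 * ((L + k) * (L + k + 1))⁻¹ := by
        rw [← div_eq_mul_inv, le_div_iff₀ (by positivity), inv_mul_le_iff₀ (by positivity)]
        nlinarith [sq_nonneg (L - k - 1)]
      calc _ ≤ L ^ 2 * (2 * ((L + k) * (L + k + 1))⁻¹) := by gcongr
        _ = _ := by ring
    refine (Finset.sum_le_sum fun k _ => hterm k).trans ?_
    rw [← Finset.mul_sum, Finset.sum_range_sub' (fun k : ℕ => (L + (k : ℝ))⁻¹)]
    have h5 : 0 ≤ (L + (N : ℝ))⁻¹ := by positivity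
    simp only [Nat.cast_zero, add_zero]
    calc _ ≤ 2 * L ^ 2 * L⁻¹ := by gcongr; linarith
      _ = 2 * L := by field_simp
  simp only [Nat.cast_zero, Int.cast_zero, zero_div] at *
  rw [nsmul_eq_mul]
  push_cast at *
  nlinarith

/-- The Riemann sum of a product of Lorentz functions over `((1/L)ℤ)^d` is of the order of the
volume. -/
lemma sum_prod_lorentz_le (hL : 1 ≤ L) (F : Finset (Fin d → ℤ)) :
    ∑ m ∈ F, ∏ j, (1 + ((m j : ℝ) / L) ^ 2)⁻¹ ≤ (5 * L) ^ d := by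
  obtain ⟨N, hN⟩ : ∃ N : ℕ, F ⊆ Fintype.piFinset fun _ : Fin d => Finset.Icc (-(N : ℤ)) N := by
    refine ⟨F.sup fun m => Finset.univ.sup fun j => (m j).natAbs, fun m hm => ?_⟩
    rw [Fintype.mem_piFinset]
    intro j
    have h1 : (m j).natAbs ≤ F.sup fun m => Finset.univ.sup fun j => (m j).natAbs :=
      (Finset.le_sup (f := fun j => (m j).natAbs) (Finset.mem_univ j)).trans
        (Finset.le_sup (f := fun m : Fin d → ℤ => Finset.univ.sup fun j => (m j).natAbs) hm)
    rw [Finset.mem_Icc]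
    omega
  refine (Finset.sum_le_sum_of_subset_of_nonneg hN fun m _ _ =>
    Finset.prod_nonneg fun j _ => by positivity).trans ?_
  rw [← Finset.prod_univ_sum (fun _ : Fin d => Finset.Icc (-(N : ℤ)) N)
    (fun _ k => (1 + ((k : ℝ) / L) ^ 2)⁻¹), Finset.prod_const, Finset.card_univ, Fintype.card_fin]
  exact pow_le_pow_left₀ (Finset.sum_nonneg fun k _ => by positivity) (sum_lorentz_le hL N) d

/-- The restriction of a Schwartz function to the box. -/
def schwartzToBox (L : ℝ) (f : 𝓢(Space d, ℂ)) : BoxL2 d L :=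
  ((f.memLp 2).restrict (box d L)).toLp _

lemma fourierCoeff_schwartzToBox (f : 𝓢(Space d, ℂ)) (m : Fin d → ℤ) :
    fourierCoeff (schwartzToBox L f) m = boxCoeff L f m := by
  refine integral_congr_ae ?_
  filter_upwards [((f.memLp 2).restrict (box d L)).coeFn_toLp] with x hx
  rw [conj_planeWave, schwartzToBox, hx]

/-- Bessel's inequality. -/
lemma sum_norm_boxCoeff_sq_le (hL : 0 < L) (f : 𝓢(Space d, ℂ)) (F : Finset (Fin d → ℤ)) :
    ∑ m ∈ F, ‖boxCoeff L f m‖ ^ 2 ≤ L ^ d * (eLpNorm f 2 volume).toReal ^ 2 := by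
  have h : ∀ m, ‖boxCoeff L f m‖ ^ 2
      = L ^ d * ‖inner ℂ (boxBasis d hL m) (schwartzToBox L f)‖ ^ 2 := by
    intro m
    rw [← fourierCoeff_schwartzToBox, fourierCoeff_eq_inner_boxBasis hL, norm_mul, mul_pow,
      Complex.norm_real, Real.norm_of_nonneg (Real.sqrt_nonneg _),
      Real.sq_sqrt (boxVolume_pos hL).le, boxVolume_eq hL]
  simp only [h]
  rw [← Finset.mul_sum]
  refine mul_le_mul_of_nonneg_left ?_ (by positivity)
  refine ((boxBasis d hL).orthonormal.sum_inner_products_le _).trans ?_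
  have h2 : ‖schwartzToBox L f‖ ≤ (eLpNorm f 2 volume).toReal := by
    have h3 : MemLp f 2 (volume : Measure (Space d)) := f.memLp 2
    have h4 : eLpNorm f 2 ((volume : Measure (Space d)).restrict (box d L))
        ≤ eLpNorm f 2 (volume : Measure (Space d)) := eLpNorm_restrict_le (⇑f) 2 volume (box d L)
    have h5 := ENNReal.toReal_mono h3.eLpNorm_ne_top h4
    rw [schwartzToBox, Lp.norm_toLp]
    exact h5
  exact pow_le_pow_left₀ (norm_nonneg _) h2 2

/-- The Fourier coefficients over the box of a Schwartz function whose values on opposite faces of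
the box match are summable, uniformly in the size of the box. -/
lemma sum_norm_boxCoeff_le (hL : 1 ≤ L) (f : 𝓢(Space d, ℂ)) (hf : ∀ j, FacesMatch L j f)
    (F : Finset (Fin d → ℤ)) :
    ∑ m ∈ F, ‖boxCoeff L f m‖ ≤ L ^ d *
      (√5 ^ d * (eLpNorm (mixedDeriv Finset.univ.toList f) 2 volume).toReal) := by
  have hL0 : 0 < L := one_pos.trans_le hL
  set g := mixedDeriv Finset.univ.toList f
  -- Cauchy–Schwarz with the weights `∏_j (1 + p_j²)⁻¹`, and Bessel's inequality for the mixed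
  -- derivative `g`
  have hg : ∀ m, ‖boxCoeff L f m‖ ≤ √(∏ j, (1 + ((m j : ℝ) / L) ^ 2)⁻¹) * ‖boxCoeff L g m‖ := by
    intro m
    have h1 : ‖boxCoeff L g m‖ = (∏ j, ‖(1 + 2 * Real.pi * Complex.I * (m j / L) : ℂ)‖)
        * ‖boxCoeff L f m‖ := by
      rw [boxCoeff_mixedDeriv hL0 (Finset.nodup_toList _) f hf, norm_mul, Finset.prod_map_toList,
        norm_prod]
    have h2 : ∀ j, 1 + ((m j : ℝ) / L) ^ 2
        ≤ ‖(1 + 2 * Real.pi * Complex.I * (m j / L) : ℂ)‖ ^ 2 := by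
      intro j
      have e : (1 + 2 * Real.pi * Complex.I * (m j / L) : ℂ)
          = ((1 : ℝ) : ℂ) + ((2 * Real.pi * (m j / L) : ℝ) : ℂ) * Complex.I := by
        push_cast; ring
      rw [e, Complex.sq_norm, Complex.normSq_add_mul_I]
      have : (1 : ℝ) ≤ (2 * Real.pi) ^ 2 := by nlinarith [Real.pi_gt_three]
      nlinarith [sq_nonneg ((m j : ℝ) / L)]
    have h3 : 1 ≤ √(∏ j, (1 + ((m j : ℝ) / L) ^ 2)⁻¹)
        * ∏ j, ‖(1 + 2 * Real.pi * Complex.I * (m j / L) : ℂ)‖ := by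
      have h4 : ∏ j, ‖(1 + 2 * Real.pi * Complex.I * (m j / L) : ℂ)‖
          = √(∏ j, ‖(1 + 2 * Real.pi * Complex.I * (m j / L) : ℂ)‖ ^ 2) := by
        rw [Finset.prod_pow, Real.sqrt_sq (Finset.prod_nonneg fun j _ => norm_nonneg _)]
      rw [h4, ← Real.sqrt_mul (Finset.prod_nonneg fun j _ => by positivity),
        ← Finset.prod_mul_distrib]
      refine Real.one_le_sqrt.2 ?_
      have h5 : ∀ j ∈ Finset.univ, (1 : ℝ) ≤ (1 + ((m j : ℝ) / L) ^ 2)⁻¹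
          * ‖(1 + 2 * Real.pi * Complex.I * (m j / L) : ℂ)‖ ^ 2 := by
        intro j _
        rw [← div_eq_inv_mul, le_div_iff₀ (by positivity), one_mul]
        exact h2 j
      simpa using Finset.prod_le_prod (fun _ _ => zero_le_one) h5
    rw [h1, ← mul_assoc]
    exact le_mul_of_one_le_left (norm_nonneg _) h3
  have hcs := Finset.sum_mul_sq_le_sq_mul_sq F
    (fun m => √(∏ j, (1 + ((m j : ℝ) / L) ^ 2)⁻¹)) (fun m => ‖boxCoeff L g m‖)
  have hsq : ∀ m : Fin d → ℤ, √(∏ j, (1 + ((m j : ℝ) / L) ^ 2)⁻¹) ^ 2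
      = ∏ j, (1 + ((m j : ℝ) / L) ^ 2)⁻¹ := fun m =>
    Real.sq_sqrt (Finset.prod_nonneg fun j _ => by positivity)
  simp only [hsq] at hcs
  refine (Finset.sum_le_sum fun m _ => hg m).trans (le_of_sq_le_sq ?_ (by positivity))
  refine hcs.trans ((mul_le_mul (sum_prod_lorentz_le hL F) (sum_norm_boxCoeff_sq_le hL0 g F)
    (Finset.sum_nonneg fun m _ => by positivity) (by positivity)).trans_eq ?_)
  have h5 : (√5 ^ d) ^ 2 = 5 ^ d := by rw [← pow_mul, mul_comm, pow_mul, Real.sq_sqrt (by norm_num)]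
  rw [mul_pow, mul_pow, mul_pow, h5]
  ring

lemma norm_boxCoeff_le (f : 𝓢(Space d, ℂ)) (m : Fin d → ℤ) :
    ‖boxCoeff L f m‖ ≤ ∫ x, ‖f x‖ := by
  refine (norm_integral_le_integral_norm _).trans ?_
  simp only [norm_mul, RCLike.norm_conj, norm_planeWave, one_mul]
  exact setIntegral_le_integral f.integrable.norm (Filter.Eventually.of_forall fun x => norm_nonneg _)

/-- The complexification of a real Schwartz function. -/
def complexify (B : 𝓢(Space d, ℝ)) : 𝓢(Space d, ℂ) :=
  SchwartzMap.postcompCLM (𝕜 := ℝ) Complex.ofRealCLM B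

lemma complexify_apply (B : 𝓢(Space d, ℝ)) (x : Space d) : complexify B x = (B x : ℂ) := rfl

/-- In a large box the values of an admissible profile on opposite faces match: they vanish, or they
agree by reflection symmetry. -/
lemma IsAdmissibleProfile.facesMatch {B : 𝓢(Space d, ℝ)} (hB : IsAdmissibleProfile B) :
    ∃ L₀ : ℝ, 1 ≤ L₀ ∧ ∀ L, L₀ ≤ L → ∀ j, FacesMatch L j (complexify B) := by
  rcases hB with hB | hB
  · obtain ⟨R, hR⟩ := hB.isCompact.isBounded.subset_closedBall 0
    have hzero : ∀ x : Space d, R < ‖x‖ → B x = 0 := fun x hx =>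
      image_eq_zero_of_notMem_tsupport fun h => by
        have := hR h
        rw [mem_closedBall_zero_iff] at this
        linarith
    refine ⟨max 1 (2 * R + 1), le_max_left _ _, fun L hL j x hx => ?_⟩
    have hLR : 2 * R + 1 ≤ L := (le_max_right _ _).trans hL
    have hL1 : 1 ≤ L := (le_max_left _ _).trans hL
    have h1 : R < ‖x‖ := by
      refine lt_of_lt_of_le ?_ (PiLp.norm_apply_le x j)
      rw [hx, Real.norm_of_nonneg (by linarith)]
      linarith
    have h2 : R < ‖x - L • unitVec d j‖ := by
      refine lt_of_lt_of_le ?_ (PiLp.norm_apply_le (x - L • unitVec d j) j)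
      have : (x - L • unitVec d j) j = -(L / 2) := by
        simp [unitVec, hx]
        ring
      rw [this, norm_neg, Real.norm_of_nonneg (by linarith)]
      linarith
    rw [complexify_apply, complexify_apply, hzero _ h1, hzero _ h2]
  · refine ⟨1, le_rfl, fun L _ j x hx => ?_⟩
    rw [complexify_apply, complexify_apply, ← hB j x]
    congr 2
    ext i
    by_cases hi : i = j
    · subst hi
      simp [reflectCoord, unitVec, hx]
      ring
    · simp [reflectCoord, unitVec, hi]

/-- The normalized Fourier coefficient `|Λ_L|⁻¹ ∫_{Λ_L} e^{-2πi p·x} B(x) dx`. -/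
def profileCoeff (L : ℝ) (B : 𝓢(Space d, ℝ)) (m : Fin d → ℤ) : ℂ :=
  (boxVolume d L : ℂ)⁻¹ * boxCoeff L (complexify B) m

/-- The Fourier coefficients of the periodized profile are summable, uniformly in the size of the
box, and of the order of the inverse volume. -/
lemma IsAdmissibleProfile.exists_bounds {B : 𝓢(Space d, ℝ)} (hB : IsAdmissibleProfile B) :
    ∃ L₀ K : ℝ, 1 ≤ L₀ ∧ 0 ≤ K ∧ ∀ L, L₀ ≤ L →
      (∀ F : Finset (Fin d → ℤ), ∑ m ∈ F, ‖profileCoeff L B m‖ ≤ K) ∧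
      ∀ m, ‖profileCoeff L B m‖ ≤ K / boxVolume d L := by
  obtain ⟨L₀, hL₀, hmatch⟩ := hB.facesMatch
  set K₁ := √5 ^ d * (eLpNorm (mixedDeriv Finset.univ.toList (complexify B)) 2 volume).toReal
  set K₂ := ∫ x, ‖complexify B x‖
  refine ⟨L₀, max K₁ K₂, hL₀, le_max_of_le_left (by positivity), fun L hL => ?_⟩
  have hL1 : 1 ≤ L := hL₀.trans hL
  have hv := boxVolume_pos (d := d) (one_pos.trans_le hL1)
  have hn : ∀ m, ‖profileCoeff L B m‖ = (boxVolume d L)⁻¹ * ‖boxCoeff L (complexify B) m‖ := by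
    intro m
    rw [profileCoeff, norm_mul, norm_inv, Complex.norm_real, Real.norm_of_nonneg hv.le]
  refine ⟨fun F => ?_, fun m => ?_⟩
  · simp only [hn]
    rw [← Finset.mul_sum, inv_mul_le_iff₀ hv, boxVolume_eq (one_pos.trans_le hL1)]
    refine (sum_norm_boxCoeff_le hL1 _ (hmatch L hL) F).trans ?_
    gcongr
    exact le_max_left _ _
  · rw [hn, inv_mul_eq_div]
    gcongr
    exact (norm_boxCoeff_le _ m).trans (le_max_right _ _)

/-- The Fourier series of the periodized profile. -/
def profileSeries (L : ℝ) (B : 𝓢(Space d, ℝ)) (x : Space d) : ℂ :=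
  ∑' m, profileCoeff L B m * planeWave (dualPoint L m) x

lemma norm_profileCoeff_mul (L : ℝ) (B : 𝓢(Space d, ℝ)) (m : Fin d → ℤ) (x : Space d) :
    ‖profileCoeff L B m * planeWave (dualPoint L m) x‖ = ‖profileCoeff L B m‖ := by
  rw [norm_mul, norm_planeWave, mul_one]

section

variable {B : 𝓢(Space d, ℝ)}

lemma hasSum_profileSeries (hs : Summable fun m => ‖profileCoeff L B m‖)
    (x : Space d) :
    HasSum (fun m => profileCoeff L B m * planeWave (dualPoint L m) x) (profileSeries L B x) :=
  (Summable.of_norm (by simpa only [norm_profileCoeff_mul] using hs)).hasSum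

lemma continuous_profileSeries (hs : Summable fun m => ‖profileCoeff L B m‖) :
    Continuous (profileSeries L B) :=
  continuous_tsum (fun _ => continuous_const.mul (continuous_planeWave _)) hs
    fun _ x => (norm_profileCoeff_mul L B _ x).le

lemma norm_profileSeries_le (hs : Summable fun m => ‖profileCoeff L B m‖)
    (x : Space d) :
    ‖profileSeries L B x‖ ≤ ∑' m, ‖profileCoeff L B m‖ := by
  refine tsum_of_norm_bounded hs.hasSum fun m => ?_
  rw [norm_profileCoeff_mul]

/-- A function on the box with summable Fourier coefficients is the sum of its Fourier series. -/
lemma ae_box_eq_profileSeries (hs : Summable fun m => ‖profileCoeff L B m‖)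
    (hL : 0 < L) :
    ∀ᵐ x ∂(volume : Measure (Space d)).restrict (box d L), (B x : ℂ) = profileSeries L B x := by
  have hP : MemLp (profileSeries L B) 2 ((volume : Measure (Space d)).restrict (box d L)) :=
    MemLp.of_bound (continuous_profileSeries hs).aestronglyMeasurable _
      (Filter.Eventually.of_forall (norm_profileSeries_le hs))
  have hv : (boxVolume d L : ℂ) ≠ 0 := by exact_mod_cast (boxVolume_pos hL).ne'
  have h0 : (√(boxVolume d L) : ℂ) ≠ 0 := by
    exact_mod_cast (Real.sqrt_pos.2 (boxVolume_pos hL)).ne'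
  have heq : schwartzToBox L (complexify B) = hP.toLp _ := by
    refine hilbertBasis_ext (boxBasis d hL) fun m => mul_left_cancel₀ h0 ?_
    rw [← fourierCoeff_eq_inner_boxBasis, ← fourierCoeff_eq_inner_boxBasis,
      fourierCoeff_schwartzToBox]
    have h1 : fourierCoeff (hP.toLp _) m = ∫ x in box d L,
        ∑' n, (starRingEnd ℂ) (planeWave (dualPoint L m) x)
          * (profileCoeff L B n * planeWave (dualPoint L n) x) := by
      refine integral_congr_ae ?_
      filter_upwards [hP.coeFn_toLp] with x hx
      rw [hx, ← conj_planeWave, profileSeries, tsum_mul_left]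
    have hint : ∀ n, Integrable (fun x => (starRingEnd ℂ) (planeWave (dualPoint L m) x)
        * (profileCoeff L B n * planeWave (dualPoint L n) x))
        ((volume : Measure (Space d)).restrict (box d L)) := by
      intro n
      refine Integrable.of_bound (C := ‖profileCoeff L B n‖) (Continuous.aestronglyMeasurable ?_)
        (Filter.Eventually.of_forall fun x => ?_)
      · exact (Complex.continuous_conj.comp (continuous_planeWave _)).mul
          (continuous_const.mul (continuous_planeWave _))
      · rw [norm_mul, RCLike.norm_conj, norm_planeWave, one_mul, norm_profileCoeff_mul]
    have hterm : ∀ n, ∫ x in box d L, (starRingEnd ℂ) (planeWave (dualPoint L m) x)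
        * (profileCoeff L B n * planeWave (dualPoint L n) x)
        = if n = m then boxCoeff L (complexify B) m else 0 := by
      intro n
      have e1 : ∫ x in box d L, (starRingEnd ℂ) (planeWave (dualPoint L m) x)
          * (profileCoeff L B n * planeWave (dualPoint L n) x)
          = profileCoeff L B n * inner ℂ (planeWaveLp L (dualPoint L m))
            (planeWaveLp L (dualPoint L n)) := by
        rw [L2.inner_def, ← integral_const_mul]
        refine integral_congr_ae ?_
        filter_upwards [(memLp_planeWave L (dualPoint L m)).coeFn_toLp,
          (memLp_planeWave L (dualPoint L n)).coeFn_toLp] with x hx hy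
        rw [planeWaveLp, planeWaveLp, hx, hy, RCLike.inner_apply]
        ring
      rw [e1]
      split_ifs with h
      · rw [h, inner_planeWaveLp_self, profileCoeff]
        field_simp
      · rw [inner_planeWaveLp hL (Ne.symm h), mul_zero]
    have h2 := integral_tsum_of_summable_integral_norm hint (by
      have : ∀ n, ∫ x in box d L, ‖(starRingEnd ℂ) (planeWave (dualPoint L m) x)
          * (profileCoeff L B n * planeWave (dualPoint L n) x)‖
          = boxVolume d L * ‖profileCoeff L B n‖ := by
        intro n
        simp only [norm_mul, RCLike.norm_conj, norm_planeWave, one_mul, mul_one]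
        rw [setIntegral_const, smul_eq_mul]
        rfl
      simp only [this]
      exact hs.mul_left _)
    rw [h1, ← h2]
    simp only [hterm]
    rw [tsum_ite_eq]
  have h3 := ((complexify B).memLp 2).restrict (box d L) |>.coeFn_toLp
  filter_upwards [h3, hP.coeFn_toLp] with x hx hy
  rw [← hy, ← heq, schwartzToBox, hx, complexify_apply]

lemma profileSeries_wrap (hL : 0 < L) (x : Space d) :
    profileSeries L B (wrap L x) = profileSeries L B x := by
  refine tsum_congr fun m => ?_
  congr 1
  have h : x = wrap L x + WithLp.toLp 2 fun j => L * ((⌊x j / L + 1 / 2⌋ : ℤ) : ℝ) := by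
    ext j
    simp [wrap]
  conv_rhs => rw [h, planeWave_add, planeWave_lattice hL, mul_one]

lemma ae_periodize_eq_profileSeries (hs : Summable fun m => ‖profileCoeff L B m‖)
    (hL : 0 < L) :
    ∀ᵐ x : Space d, ((periodize L B x : ℝ) : ℂ) = profileSeries L B x := by
  have h0 := ae_box_eq_profileSeries hs hL
  rw [ae_restrict_iff' (measurableSet_box d L), ae_iff] at h0
  set N := {x | ¬(x ∈ box d L → (B x : ℂ) = profileSeries L B x)}
  rw [ae_iff]
  -- the exceptional set is covered by the translates of the exceptional set in the box
  have hsub : {x : Space d | ¬((periodize L B x : ℝ) : ℂ) = profileSeries L B x}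
      ⊆ ⋃ k : Fin d → ℤ, (fun x => x + (WithLp.toLp 2 fun j => -(L * (k j : ℝ)))) ⁻¹' N := by
    intro x hx
    rw [Set.mem_iUnion]
    refine ⟨fun j => ⌊x j / L + 1 / 2⌋, ?_⟩
    have hw : x + (WithLp.toLp 2 fun j => -(L * ((⌊x j / L + 1 / 2⌋ : ℤ) : ℝ))) = wrap L x := by
      ext j
      simp [wrap]
      ring
    rw [Set.mem_preimage, hw]
    intro h
    refine hx ?_
    rw [periodize, h ?_, profileSeries_wrap hL]
    intro j
    have h1 := Int.floor_le (x j / L + 1 / 2)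
    have h2 := Int.lt_floor_add_one (x j / L + 1 / 2)
    have h3 : L * (x j / L) = x j := by field_simp
    change -(L / 2) ≤ x j - L * ((⌊x j / L + 1 / 2⌋ : ℤ) : ℝ)
      ∧ x j - L * ((⌊x j / L + 1 / 2⌋ : ℤ) : ℝ) < L / 2
    constructor <;> nlinarith
  refine measure_mono_null hsub (measure_iUnion_null fun k => ?_)
  rw [measure_preimage_add_right]
  exact h0

end

end ProfileBounds

/-! ### The law of the random configurations -/

section Law

variable {d : ℕ} {L : ℝ} {ρ : Measure ℝ}

/-- The uniform distribution on the box. -/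
abbrev uniformLaw (d : ℕ) (L : ℝ) : Measure (Space d) :=
  ProbabilityTheory.cond (volume : Measure (Space d)) (box d L)

lemma isProbabilityMeasure_uniformLaw (hL : 0 < L) : IsProbabilityMeasure (uniformLaw d L) := by
  refine ProbabilityTheory.cond_isProbabilityMeasure_of_finite ?_ ?_
  · rw [volume_box]
    exact pow_ne_zero _ (by simpa using hL)
  · rw [volume_box]
    exact (ENNReal.pow_lt_top ENNReal.ofReal_lt_top).ne

lemma isProbabilityMeasure_configLaw (hL : 0 < L) [IsProbabilityMeasure ρ] :
    IsProbabilityMeasure (configLaw d L ρ) := by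
  have := isProbabilityMeasure_uniformLaw (d := d) hL
  unfold configLaw
  infer_instance

lemma measurable_sum_points {E : Type*} [MeasurableSpace E] [AddCommMonoid E] [MeasurableAdd₂ E]
    {Ω : Type*} [MeasurableSpace Ω] {N : Ω → ℕ} (hN : Measurable N)
    {f : ℕ → Ω → E} (hf : ∀ γ, Measurable (f γ)) :
    Measurable fun ω => ∑ γ ∈ Finset.range (N ω), f γ ω := by
  have h : Measurable fun q : ℕ × Ω => ∑ γ ∈ Finset.range q.1, f γ q.2 :=
    measurable_from_prod_countable_right fun n => Finset.measurable_fun_sum (Finset.range n) fun γ _ => hf γ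
  exact h.comp (hN.prodMk measurable_id)

lemma measurable_prod_points {Ω : Type*} [MeasurableSpace Ω] {N : Ω → ℕ} (hN : Measurable N)
    {f : ℕ → Ω → ℂ} (hf : ∀ γ, Measurable (f γ)) :
    Measurable fun ω => ∏ γ ∈ Finset.range (N ω), f γ ω := by
  have h : Measurable fun q : ℕ × Ω => ∏ γ ∈ Finset.range q.1, f γ q.2 :=
    measurable_from_prod_countable_right fun n => Finset.measurable_fun_prod (Finset.range n) fun γ _ => hf γ
  exact h.comp (hN.prodMk measurable_id)

/-- The expectation of a product over finitely many i.i.d. points. -/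
lemma integral_prod_range_infinitePi {S : Type*} [MeasurableSpace S] (τ : Measure S)
    [IsProbabilityMeasure τ] (M : ℕ) (f : ℕ → S → ℂ) (hf : ∀ γ, Measurable (f γ)) :
    ∫ y, ∏ γ ∈ Finset.range M, f γ (y γ) ∂(Measure.infinitePi fun _ : ℕ => τ)
      = ∏ γ ∈ Finset.range M, ∫ s, f γ s ∂τ := by
  have hm : Measurable fun y : (Π _ : Finset.range M, S) =>
      ∏ i : Finset.range M, f i (y i) :=
    Finset.measurable_fun_prod _ fun i _ => (hf i).comp (measurable_pi_apply i)
  have h := integral_restrict_infinitePi (μ := fun _ : ℕ => τ) (s := Finset.range M)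
    (f := fun y => ∏ i : Finset.range M, f i (y i)) hm.aestronglyMeasurable
  rw [integral_fintype_prod_eq_prod (fun (i : Finset.range M) s => f i s)] at h
  rw [← Finset.prod_coe_sort, ← h]
  refine integral_congr_ae (Filter.Eventually.of_forall fun y => ?_)
  exact (Finset.prod_coe_sort (Finset.range M) fun γ => f γ (y γ)).symm

lemma integrable_exp_card (hL : 0 < L) [IsProbabilityMeasure ρ] (c : ℝ) :
    Integrable (fun ω : Config d => Real.exp (c * ω.1)) (configLaw d L ρ) := by
  have := isProbabilityMeasure_uniformLaw (d := d) hL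
  have h : Integrable (fun n : ℕ => Real.exp (c * n))
      (ProbabilityTheory.poissonMeasure (boxVolume d L).toNNReal) := by
    rw [ProbabilityTheory.integrable_poissonMeasure_iff]
    have hs := (Real.summable_pow_div_factorial ((boxVolume d L).toNNReal * Real.exp c)).mul_left
      (Real.exp (-((boxVolume d L).toNNReal : ℝ)))
    refine hs.congr fun n => ?_
    rw [Real.norm_of_nonneg (Real.exp_pos _).le, mul_comm c, Real.exp_nat_mul, mul_pow]
    ring
  exact h.comp_fst _

/-- The generating functional of the Poisson point process. -/
lemma integral_prod_points (hL : 0 < L) [IsProbabilityMeasure ρ] {h : Space d → ℂ}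
    (hh : Measurable h) {c : ℝ} (hc : ∀ y, ‖h y‖ ≤ Real.exp c) :
    ∫ ω, ∏ γ ∈ Finset.range ω.1, h (ω.2.1 γ) ∂(configLaw d L ρ)
      = Complex.exp (boxVolume d L * ((∫ y, h y ∂(uniformLaw d L)) - 1)) := by
  have := isProbabilityMeasure_uniformLaw (d := d) hL
  have hint : Integrable (fun ω : Config d => ∏ γ ∈ Finset.range ω.1, h (ω.2.1 γ))
      (configLaw d L ρ) := by
    refine (integrable_exp_card hL c).mono' (Measurable.aestronglyMeasurable
      (measurable_prod_points measurable_fst fun γ => by fun_prop))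
      (Filter.Eventually.of_forall fun ω => ?_)
    rw [norm_prod, mul_comm, Real.exp_nat_mul]
    exact (Finset.prod_le_prod (fun _ _ => norm_nonneg _) fun γ _ => hc _).trans_eq (by simp)
  set m := ∫ y, h y ∂(uniformLaw d L)
  set r := (boxVolume d L).toNNReal
  have hr : (r : ℝ) = boxVolume d L := Real.coe_toNNReal _ (boxVolume_pos hL).le
  have hinner : ∀ M : ℕ, ∫ q : (ℕ → Space d) × (ℕ → ℝ), ∏ γ ∈ Finset.range M, h (q.1 γ)
      ∂((Measure.infinitePi fun _ : ℕ => uniformLaw d L).prod (Measure.infinitePi fun _ : ℕ => ρ))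
      = m ^ M := by
    intro M
    rw [integral_fun_fst (fun y : ℕ → Space d => ∏ γ ∈ Finset.range M, h (y γ)),
      integral_prod_range_infinitePi _ M (fun _ => h) fun _ => hh]
    simp [m]
  rw [configLaw] at hint ⊢
  rw [integral_prod _ hint]
  simp only [hinner]
  rw [ProbabilityTheory.integral_poissonMeasure, ← hr]
  have h1 : ∀ n : ℕ, (Real.exp (-(r : ℝ)) * (r : ℝ) ^ n / n.factorial) • m ^ n
      = Complex.exp (-(r : ℝ)) * (((r : ℝ) * m) ^ n / n.factorial) := by
    intro n
    rw [Complex.real_smul]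
    push_cast
    rw [mul_pow]
    ring
  rw [Real.toNNReal_coe, tsum_congr h1, tsum_mul_left, (NormedSpace.expSeries_div_hasSum_exp ((r : ℝ) * m : ℂ)).tsum_eq,
    ← Complex.exp_eq_exp_ℂ, ← Complex.exp_add]
  congr 1
  ring

lemma integral_exp_card (hL : 0 < L) [IsProbabilityMeasure ρ] (c : ℝ) :
    ∫ ω : Config d, Real.exp (c * ω.1) ∂(configLaw d L ρ)
      = Real.exp (boxVolume d L * (Real.exp c - 1)) := by
  have := isProbabilityMeasure_uniformLaw (d := d) hL
  have h := integral_prod_points (d := d) (ρ := ρ) hL (h := fun _ => (Real.exp c : ℂ)) (c := c)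
    measurable_const fun y => by rw [Complex.norm_real, Real.norm_of_nonneg (Real.exp_pos _).le]
  have h1 : ∀ ω : Config d, ∏ γ ∈ Finset.range ω.1, (Real.exp c : ℂ)
      = ((Real.exp (c * ω.1) : ℝ) : ℂ) := by
    intro ω
    rw [Finset.prod_const, Finset.card_range, mul_comm, Real.exp_nat_mul]
    push_cast
    rfl
  simp only [h1] at h
  rw [integral_complex_ofReal, integral_const, probReal_univ, one_smul] at h
  exact_mod_cast h

/-- Uniformly bounded moments force the weights to take values in `[-1, 1]`. -/
lemma HasUniformlyBoundedMoments.ae_abs_le_one [IsProbabilityMeasure ρ]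
    (hρ : HasUniformlyBoundedMoments ρ) : ∀ᵐ v ∂ρ, |v| ≤ 1 := by
  obtain ⟨C, hC⟩ := hρ
  have hk : ∀ k : ℕ, ∀ᵐ v ∂ρ, ¬ (1 + 1 / ((k : ℝ) + 1) ≤ |v|) := by
    intro k
    set q := 1 + 1 / ((k : ℝ) + 1)
    have hq : 1 < q := by
      have : (0 : ℝ) < 1 / ((k : ℝ) + 1) := by positivity
      simp only [q]; linarith
    -- Markov's inequality for the `n`-th moment, with `q > 1` and `n → ∞`
    have hbd : ∀ n : ℕ, q ^ n * ρ.real {v | q ≤ |v|} ≤ C := by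
      intro n
      refine le_trans ?_ ((mul_meas_ge_le_integral_of_nonneg
        (Filter.Eventually.of_forall fun v => by positivity) (hC n).1 (q ^ n)).trans (hC n).2)
      refine mul_le_mul_of_nonneg_left ?_ (by positivity)
      exact measureReal_mono fun v (hv : q ≤ |v|) => pow_le_pow_left₀ (by linarith) hv n
    have h0 : ρ.real {v | q ≤ |v|} = 0 := by
      by_contra hne
      have hpos : 0 < ρ.real {v | q ≤ |v|} := lt_of_le_of_ne measureReal_nonneg (Ne.symm hne)
      obtain ⟨n, hn⟩ := ((tendsto_pow_atTop_atTop_of_one_lt hq).eventually_gt_atTop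
        (C / ρ.real {v | q ≤ |v|})).exists
      rw [div_lt_iff₀ hpos] at hn
      exact absurd (hbd n) (not_le.2 hn)
    rw [ae_iff]
    simpa [measureReal_eq_zero_iff] using h0
  filter_upwards [ae_all_iff.2 hk] with v hv
  by_contra hlt
  push Not at hlt
  obtain ⟨k, hk⟩ := exists_nat_one_div_lt (sub_pos.2 hlt)
  exact hv k (by linarith)

lemma ae_weights_le_one (hL : 0 < L) [IsProbabilityMeasure ρ]
    (hρ : HasUniformlyBoundedMoments ρ) : ∀ᵐ ω ∂(configLaw d L ρ), ∀ γ, |ω.2.2 γ| ≤ 1 := by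
  have := isProbabilityMeasure_uniformLaw (d := d) hL
  rw [ae_all_iff]
  intro γ
  have h1 : ∀ᵐ v ∂(Measure.infinitePi fun _ : ℕ => ρ), |v γ| ≤ 1 :=
    (measurePreserving_eval_infinitePi (fun _ : ℕ => ρ) γ).quasiMeasurePreserving.ae
      hρ.ae_abs_le_one
  exact Measure.quasiMeasurePreserving_snd.ae (Measure.quasiMeasurePreserving_snd.ae h1)

end Law

/-! ### Correlations of the Fourier modes of the random points -/

section Modes

variable {d : ℕ} {L : ℝ} {ρ : Measure ℝ}

/-- The Fourier mode `∑_γ v_γ e^{-2πi p·y_γ}`, `p = m / L`, of the weighted random points. -/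
def weightedMode (L : ℝ) (m : Fin d → ℤ) (ω : Config d) : ℂ :=
  ∑ γ ∈ Finset.range ω.1, (ω.2.2 γ : ℂ) * planeWave (dualPoint L m) (-ω.2.1 γ)

/-- The Fourier mode `∑_γ e^{-2πi p·y_γ}`, `p = m / L`, of the random points. -/
def pointMode (L : ℝ) (m : Fin d → ℤ) (ω : Config d) : ℂ :=
  ∑ γ ∈ Finset.range ω.1, planeWave (dualPoint L m) (-ω.2.1 γ)

lemma measurable_planeWave (p : Space d) : Measurable (planeWave p) :=
  (continuous_planeWave p).measurable

lemma measurable_weightedMode (m : Fin d → ℤ) :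
    Measurable (weightedMode L m : Config d → ℂ) := by
  refine measurable_sum_points measurable_fst fun γ => ?_
  have h1 : Measurable fun ω : Config d => ω.2.2 γ := by fun_prop
  have h2 : Measurable fun ω : Config d => -ω.2.1 γ := by fun_prop
  exact (Complex.measurable_ofReal.comp h1).mul ((measurable_planeWave _).comp h2)

lemma measurable_pointMode (m : Fin d → ℤ) : Measurable (pointMode L m : Config d → ℂ) := by
  refine measurable_sum_points measurable_fst fun γ => ?_
  have h2 : Measurable fun ω : Config d => -ω.2.1 γ := by fun_prop
  exact (measurable_planeWave _).comp h2

lemma norm_pointMode_le (m : Fin d → ℤ) (ω : Config d) : ‖pointMode L m ω‖ ≤ ω.1 := by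
  refine (norm_sum_le _ _).trans ?_
  simp [norm_planeWave]

lemma norm_weightedMode_le (m : Fin d → ℤ) {ω : Config d} (hω : ∀ γ, |ω.2.2 γ| ≤ 1) :
    ‖weightedMode L m ω‖ ≤ ω.1 := by
  refine (norm_sum_le _ _).trans ?_
  refine (Finset.sum_le_sum (g := fun _ => (1 : ℝ)) fun γ _ => ?_).trans (by simp)
  rw [norm_mul, norm_planeWave, mul_one, Complex.norm_real]
  exact hω γ

lemma card_pow_le_exp (n : ℕ) (M : ℕ) : (M : ℝ) ^ n ≤ Real.exp (n * M) := by
  rw [Real.exp_nat_mul]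
  refine pow_le_pow_left₀ M.cast_nonneg ?_ n
  linarith [Real.add_one_le_exp (M : ℝ)]

lemma integrable_card_pow (hL : 0 < L) [IsProbabilityMeasure ρ] (n : ℕ) :
    Integrable (fun ω : Config d => (ω.1 : ℝ) ^ n) (configLaw d L ρ) := by
  refine (integrable_exp_card hL n).mono' (Measurable.aestronglyMeasurable ?_)
    (Filter.Eventually.of_forall fun ω => ?_)
  · exact (measurable_from_top (f := fun n : ℕ => (n : ℝ))).comp measurable_fst |>.pow_const n
  · rw [Real.norm_of_nonneg (by positivity)]
    exact card_pow_le_exp n ω.1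

lemma integrable_prod_pointMode (hL : 0 < L) [IsProbabilityMeasure ρ] {n : ℕ}
    (κ : Fin n → Fin d → ℤ) :
    Integrable (fun ω => ∏ i, pointMode L (κ i) ω) (configLaw d L ρ) := by
  refine (integrable_card_pow hL n).mono' (Measurable.aestronglyMeasurable
    (Finset.measurable_fun_prod _ fun i _ => measurable_pointMode _))
    (Filter.Eventually.of_forall fun ω => ?_)
  rw [norm_prod]
  exact (Finset.prod_le_prod (fun _ _ => norm_nonneg _)
    fun i _ => norm_pointMode_le (κ i) ω).trans_eq (by simp)

lemma integrable_prod_weightedMode (hL : 0 < L) [IsProbabilityMeasure ρ]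
    (hρ : HasUniformlyBoundedMoments ρ) {n : ℕ} (κ : Fin n → Fin d → ℤ) :
    Integrable (fun ω => ∏ i, weightedMode L (κ i) ω) (configLaw d L ρ) := by
  refine (integrable_card_pow hL n).mono' (Measurable.aestronglyMeasurable
    (Finset.measurable_fun_prod _ fun i _ => measurable_weightedMode _)) ?_
  filter_upwards [ae_weights_le_one hL hρ] with ω hω
  rw [norm_prod]
  exact (Finset.prod_le_prod (fun _ _ => norm_nonneg _)
    fun i _ => norm_weightedMode_le (κ i) hω).trans_eq (by simp)

lemma prod_planeWave {ι : Type*} (s : Finset ι) (κ : ι → Fin d → ℤ) (x : Space d) :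
    ∏ i ∈ s, planeWave (dualPoint L (κ i)) x = planeWave (dualPoint L (∑ i ∈ s, κ i)) x := by
  simp only [planeWave]
  rw [← Complex.exp_sum, ← Finset.mul_sum]
  congr 2
  simp only [inner_dualPoint, ← Complex.ofReal_sum]
  rw [Finset.sum_comm]
  congr 1
  refine Finset.sum_congr rfl fun j _ => ?_
  rw [← Finset.sum_mul, Finset.sum_apply, Int.cast_sum, Finset.sum_div]

lemma planeWave_dualPoint_zero (x : Space d) : planeWave (dualPoint L (0 : Fin d → ℤ)) x = 1 := by
  simp [planeWave, inner_dualPoint]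

lemma integral_uniformLaw (f : Space d → ℂ) :
    ∫ y, f y ∂(uniformLaw d L) = (boxVolume d L : ℂ)⁻¹ * ∫ y in box d L, f y := by
  rw [uniformLaw, ProbabilityTheory.cond, integral_smul_measure, Complex.real_smul,
    ENNReal.toReal_inv]
  push_cast
  rfl

/-- A plane wave with momentum in the dual lattice has mean zero, unless the momentum vanishes. -/
lemma integral_planeWave_neg (hL : 0 < L) (m : Fin d → ℤ) :
    ∫ y, planeWave (dualPoint L m) (-y) ∂(uniformLaw d L) = if m = 0 then 1 else 0 := by
  have hv : (boxVolume d L : ℂ) ≠ 0 := by exact_mod_cast (boxVolume_pos hL).ne'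
  have h : ∫ y in box d L, planeWave (dualPoint L m) (-y)
      = inner ℂ (planeWaveLp L (dualPoint L m)) (planeWaveLp L (dualPoint L 0)) := by
    rw [L2.inner_def]
    refine integral_congr_ae ?_
    filter_upwards [(memLp_planeWave L (dualPoint L m)).coeFn_toLp,
      (memLp_planeWave L (dualPoint L 0)).coeFn_toLp] with x hx hy
    rw [planeWaveLp, planeWaveLp, hx, hy, RCLike.inner_apply, planeWave_dualPoint_zero,
      planeWave_neg, one_mul]
  rw [integral_uniformLaw, h]
  split_ifs with hm
  · rw [hm, inner_planeWaveLp_self, inv_mul_cancel₀ hv]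
  · rw [inner_planeWaveLp hL hm, mul_zero]

/-- The mean of a product of plane waves evaluated at i.i.d. uniform points is `0` or `1`; only its
positivity matters. -/
lemma exists_integral_prod_planeWave (hL : 0 < L) {M n : ℕ} (κ : Fin n → Fin d → ℤ)
    {g : Fin n → ℕ} (hg : ∀ i, g i ∈ Finset.range M) :
    ∃ r : ℝ, 0 ≤ r ∧ ∫ y, ∏ i, planeWave (dualPoint L (κ i)) (-y (g i))
      ∂(Measure.infinitePi fun _ : ℕ => uniformLaw d L) = r := by
  have := isProbabilityMeasure_uniformLaw (d := d) hL
  have h1 : ∀ y : ℕ → Space d, ∏ i, planeWave (dualPoint L (κ i)) (-y (g i))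
      = ∏ γ ∈ Finset.range M,
        planeWave (dualPoint L (∑ i with g i = γ, κ i)) (-y γ) := by
    intro y
    rw [← Finset.prod_fiberwise_of_maps_to (fun i _ => hg i)]
    refine Finset.prod_congr rfl fun γ _ => ?_
    rw [← prod_planeWave]
    refine Finset.prod_congr rfl fun i hi => ?_
    rw [(Finset.mem_filter.1 hi).2]
  simp only [h1]
  rw [integral_prod_range_infinitePi _ M
    (fun γ s => planeWave (dualPoint L (∑ i with g i = γ, κ i)) (-s))
    fun γ => (measurable_planeWave _).comp measurable_neg]
  simp only [integral_planeWave_neg hL]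
  refine ⟨∏ γ ∈ Finset.range M, if ∑ i with g i = γ, κ i = 0 then 1 else 0,
    Finset.prod_nonneg fun γ _ => by split_ifs <;> norm_num, ?_⟩
  push_cast
  refine Finset.prod_congr rfl fun γ _ => ?_
  split_ifs <;> simp

/-- The correlations of the modes of the random points are nonnegative, and dominate the
correlations of the weighted modes. -/
lemma exists_integral_prod_mode (hL : 0 < L) [IsProbabilityMeasure ρ]
    (hρ : HasUniformlyBoundedMoments ρ) {n : ℕ} (κ : Fin n → Fin d → ℤ) :
    ∃ r : ℝ, 0 ≤ r ∧ ∫ ω, ∏ i, pointMode L (κ i) ω ∂(configLaw d L ρ) = r ∧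
      ‖∫ ω, ∏ i, weightedMode L (κ i) ω ∂(configLaw d L ρ)‖ ≤ r := by
  have := isProbabilityMeasure_uniformLaw (d := d) hL
  set P := Measure.infinitePi fun _ : ℕ => uniformLaw d L
  set W := Measure.infinitePi fun _ : ℕ => ρ
  have hW : ∀ᵐ v ∂W, ∀ γ, |v γ| ≤ 1 := ae_all_iff.2 fun γ =>
    (measurePreserving_eval_infinitePi (fun _ : ℕ => ρ) γ).quasiMeasurePreserving.ae
      hρ.ae_abs_le_one
  -- For a fixed number `M` of points the product of the sums is expanded over all assignments `g`
  -- of a point to each factor. The mean over the points is nonnegative for each `g`, and the mean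
  -- over the weights is at most one in absolute value.
  have key : ∀ M : ℕ, ∃ r : ℝ, 0 ≤ r ∧
      ∫ q, ∏ i, pointMode L (κ i) (M, q) ∂(P.prod W) = r ∧
      ‖∫ q, ∏ i, weightedMode L (κ i) (M, q) ∂(P.prod W)‖ ≤ r := by
    intro M
    set G := Fintype.piFinset fun _ : Fin n => Finset.range M
    have hG : ∀ g ∈ G, ∀ i, g i ∈ Finset.range M := fun g hg i => Fintype.mem_piFinset.1 hg i
    have hmy : ∀ g : Fin n → ℕ, Measurable fun y : ℕ → Space d =>
        ∏ i, planeWave (dualPoint L (κ i)) (-y (g i)) := fun g =>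
      Finset.measurable_fun_prod _ fun i _ => by
        have h2 : Measurable fun y : ℕ → Space d => -y (g i) := by fun_prop
        exact (measurable_planeWave _).comp h2
    have hmv : ∀ g : Fin n → ℕ, Measurable fun v : ℕ → ℝ => ∏ i, (v (g i) : ℂ) := fun g =>
      Finset.measurable_fun_prod _ fun i _ => Complex.measurable_ofReal.comp (measurable_pi_apply _)
    have hny : ∀ (g : Fin n → ℕ) (y : ℕ → Space d),
        ‖∏ i, planeWave (dualPoint L (κ i)) (-y (g i))‖ ≤ 1 := fun g y => by
      rw [norm_prod]
      simp [norm_planeWave]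
    have hnv : ∀ g : Fin n → ℕ, ∀ᵐ v ∂W, ‖∏ i, (v (g i) : ℂ)‖ ≤ 1 := fun g => by
      filter_upwards [hW] with v hv
      rw [norm_prod]
      exact Finset.prod_le_one (fun _ _ => norm_nonneg _) fun i _ => by
        rw [Complex.norm_real]; exact hv _
    have hiy : ∀ g : Fin n → ℕ, Integrable (fun y : ℕ → Space d =>
        ∏ i, planeWave (dualPoint L (κ i)) (-y (g i))) P := fun g =>
      Integrable.of_bound (hmy g).aestronglyMeasurable 1 (Filter.Eventually.of_forall (hny g))
    have hiv : ∀ g : Fin n → ℕ, Integrable (fun v : ℕ → ℝ => ∏ i, (v (g i) : ℂ)) W := fun g =>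
      Integrable.of_bound (hmv g).aestronglyMeasurable 1 (hnv g)
    choose r hr0 hr using fun g : G => exists_integral_prod_planeWave hL κ (hG g.1 g.2)
    refine ⟨∑ g : G, r g, Finset.sum_nonneg fun g _ => hr0 g, ?_, ?_⟩
    · have h1 : ∀ q : (ℕ → Space d) × (ℕ → ℝ), ∏ i, pointMode L (κ i) (M, q)
          = ∑ g ∈ G, ∏ i, planeWave (dualPoint L (κ i)) (-q.1 (g i)) := by
        intro q
        simp only [pointMode]
        rw [Finset.prod_univ_sum]
      simp only [h1]
      rw [integral_finsetSum _ fun g _ => (hiy g).comp_fst W, ← Finset.sum_coe_sort]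
      push_cast
      refine Finset.sum_congr rfl fun g _ => ?_
      rw [integral_fun_fst (fun y : ℕ → Space d =>
        ∏ i, planeWave (dualPoint L (κ i)) (-y (g.1 i))), probReal_univ, one_smul, hr]
    · have h1 : ∀ q : (ℕ → Space d) × (ℕ → ℝ), ∏ i, weightedMode L (κ i) (M, q)
          = ∑ g ∈ G, (∏ i, planeWave (dualPoint L (κ i)) (-q.1 (g i)))
              * ∏ i, (q.2 (g i) : ℂ) := by
        intro q
        simp only [weightedMode]
        rw [Finset.prod_univ_sum]
        refine Finset.sum_congr rfl fun g _ => ?_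
        rw [← Finset.prod_mul_distrib]
        exact Finset.prod_congr rfl fun i _ => mul_comm _ _
      simp only [h1]
      rw [integral_finsetSum _ fun g _ => (hiy g).mul_prod (hiv g), ← Finset.sum_coe_sort]
      refine (norm_sum_le _ _).trans (Finset.sum_le_sum fun g _ => ?_)
      rw [integral_prod_mul (fun y : ℕ → Space d =>
        ∏ i, planeWave (dualPoint L (κ i)) (-y (g.1 i))) (fun v : ℕ → ℝ => ∏ i, (v (g.1 i) : ℂ)),
        hr, norm_mul, Complex.norm_real, Real.norm_of_nonneg (hr0 g)]
      refine mul_le_of_le_one_right (hr0 g) ?_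
      refine (norm_integral_le_of_norm_le (integrable_const (1 : ℝ)) (hnv g.1)).trans ?_
      simp
  choose r hr0 hr hrw using key
  have hi := integrable_prod_pointMode (ρ := ρ) hL κ
  have hiw := integrable_prod_weightedMode hL hρ κ
  rw [configLaw] at hi hiw ⊢
  have hri : Integrable r (ProbabilityTheory.poissonMeasure (boxVolume d L).toNNReal) := by
    refine hi.integral_prod_left.re.congr (Filter.Eventually.of_forall fun M => ?_)
    change RCLike.re (∫ q, ∏ i, pointMode L (κ i) (M, q) ∂(P.prod W)) = r M
    rw [hr]
    rfl
  refine ⟨∫ M, r M ∂(ProbabilityTheory.poissonMeasure (boxVolume d L).toNNReal),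
    integral_nonneg hr0, ?_, ?_⟩
  · rw [integral_prod _ hi]
    refine Eq.trans ?_ integral_complex_ofReal
    exact integral_congr_ae (Filter.Eventually.of_forall fun M => hr M)
  · rw [integral_prod _ hiw]
    exact norm_integral_le_of_norm_le hri (Filter.Eventually.of_forall fun M => hrw M)

end Modes

section ExponentialMoment

variable {d : ℕ} {L : ℝ} {ρ : Measure ℝ}

/-- The trigonometric polynomial `y ↦ ∑_m w_m e^{-2πi p·y}`, `p = m / L`. -/
def trigPoly (L : ℝ) (F : Finset (Fin d → ℤ)) (w : (Fin d → ℤ) → ℝ) (y : Space d) : ℂ :=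
  ∑ m ∈ F, (w m : ℂ) * planeWave (dualPoint L m) (-y)

variable {F : Finset (Fin d → ℤ)} {w : (Fin d → ℤ) → ℝ}

lemma measurable_trigPoly : Measurable (trigPoly L F w) := by
  refine Finset.measurable_fun_sum _ fun m _ => ?_
  exact ((measurable_planeWave _).comp measurable_neg).const_mul _

lemma norm_trigPoly_le (hw : ∀ m, 0 ≤ w m) (y : Space d) : ‖trigPoly L F w y‖ ≤ ∑ m ∈ F, w m := by
  refine (norm_sum_le _ _).trans (Finset.sum_le_sum fun m _ => ?_)
  rw [norm_mul, norm_planeWave, mul_one, Complex.norm_real, Real.norm_of_nonneg (hw m)]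

lemma integrable_planeWave_neg_uniformLaw (hL : 0 < L) (p : Space d) :
    Integrable (fun y => planeWave p (-y)) (uniformLaw d L) := by
  have := isProbabilityMeasure_uniformLaw (d := d) hL
  exact Integrable.of_bound ((measurable_planeWave _).comp measurable_neg).aestronglyMeasurable 1
    (Filter.Eventually.of_forall fun y => (norm_planeWave _ _).le)

lemma integral_trigPoly (hL : 0 < L) :
    ∫ y, trigPoly L F w y ∂(uniformLaw d L) = if 0 ∈ F then (w 0 : ℂ) else 0 := by
  simp only [trigPoly]
  rw [integral_finsetSum _ fun m _ => (integrable_planeWave_neg_uniformLaw hL _).const_mul _]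
  simp only [integral_const_mul, integral_planeWave_neg hL, mul_ite, mul_one, mul_zero,
    Finset.sum_ite_eq']

/-- Parseval's identity for trigonometric polynomials. -/
lemma integral_norm_trigPoly_sq (hL : 0 < L) :
    ∫ y, ‖trigPoly L F w y‖ ^ 2 ∂(uniformLaw d L) = ∑ m ∈ F, w m ^ 2 := by
  have h1 : ∀ y : Space d, ((‖trigPoly L F w y‖ ^ 2 : ℝ) : ℂ)
      = ∑ m ∈ F, ∑ k ∈ F, ((w m * w k : ℝ) : ℂ) * planeWave (dualPoint L (m - k)) (-y) := by
    intro y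
    push_cast
    rw [← Complex.mul_conj', trigPoly, map_sum, Finset.sum_mul_sum]
    refine Finset.sum_congr rfl fun m _ => Finset.sum_congr rfl fun k _ => ?_
    have h2 : planeWave (dualPoint L (m - k)) (-y)
        = planeWave (dualPoint L m) (-y) * (starRingEnd ℂ) (planeWave (dualPoint L k) (-y)) := by
      rw [conj_planeWave, planeWave, planeWave, ← Complex.exp_add]
      congr 1
      simp only [inner_dualPoint, Pi.sub_apply, Int.cast_sub, sub_div, sub_mul,
        Finset.sum_sub_distrib]
      push_cast
      ring
    rw [h2, map_mul, Complex.conj_ofReal]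
    ring
  have h3 : ((∫ y, ‖trigPoly L F w y‖ ^ 2 ∂(uniformLaw d L) : ℝ) : ℂ)
      = ((∑ m ∈ F, w m ^ 2 : ℝ) : ℂ) := by
    rw [← integral_complex_ofReal]
    simp only [h1]
    rw [integral_finsetSum _ fun m _ => integrable_finsetSum _ fun k _ =>
      (integrable_planeWave_neg_uniformLaw hL _).const_mul _]
    push_cast
    refine Finset.sum_congr rfl fun m hm => ?_
    rw [integral_finsetSum _ fun k _ => (integrable_planeWave_neg_uniformLaw hL _).const_mul _]
    simp only [integral_const_mul, integral_planeWave_neg hL, sub_eq_zero, mul_ite, mul_one,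
      mul_zero]
    rw [Finset.sum_ite_eq, if_pos hm, sq]
  exact_mod_cast h3

/-- The exponent of the generating functional is bounded uniformly in the volume: the mean of the
trigonometric polynomial and of its square are both of the order of the inverse volume. -/
lemma norm_integral_exp_trigPoly_sub_one_le (hL : 0 < L) (hw : ∀ m, 0 ≤ w m) {K : ℝ}
    (hK : ∑ m ∈ F, w m ≤ K) (hKv : ∀ m, w m ≤ K / boxVolume d L) {s : ℝ} (hs : 0 ≤ s) :
    boxVolume d L * ‖(∫ y, Complex.exp (s * trigPoly L F w y) ∂(uniformLaw d L)) - 1‖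
      ≤ s * K + s ^ 2 * K ^ 2 * Real.exp (s * K) := by
  have := isProbabilityMeasure_uniformLaw (d := d) hL
  have hv := boxVolume_pos (d := d) hL
  have hK0 : 0 ≤ K := (Finset.sum_nonneg fun m _ => hw m).trans hK
  have hb : ∀ y, ‖trigPoly L F w y‖ ≤ K := fun y => (norm_trigPoly_le hw y).trans hK
  have hbs : ∀ y, ‖(s : ℂ) * trigPoly L F w y‖ ≤ s * K := fun y => by
    rw [norm_mul, Complex.norm_real, Real.norm_of_nonneg hs]
    exact mul_le_mul_of_nonneg_left (hb y) hs
  have hi1 : Integrable (fun y => (s : ℂ) * trigPoly L F w y) (uniformLaw d L) :=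
    Integrable.of_bound (measurable_trigPoly.const_mul _).aestronglyMeasurable _
      (Filter.Eventually.of_forall hbs)
  have hi2 : Integrable (fun y => Complex.exp (s * trigPoly L F w y)) (uniformLaw d L) := by
    refine Integrable.of_bound (C := Real.exp (s * K))
      (Complex.measurable_exp.comp (measurable_trigPoly.const_mul _)).aestronglyMeasurable
      (Filter.Eventually.of_forall fun y => ?_)
    exact (Complex.norm_exp_le_exp_norm _).trans (Real.exp_le_exp.2 (hbs y))
  have hi3 : Integrable (fun y => ‖trigPoly L F w y‖ ^ 2) (uniformLaw d L) := by
    refine Integrable.of_bound (C := K ^ 2)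
      (measurable_trigPoly.norm.pow_const 2).aestronglyMeasurable
      (Filter.Eventually.of_forall fun y => ?_)
    rw [Real.norm_of_nonneg (by positivity)]
    exact pow_le_pow_left₀ (norm_nonneg _) (hb y) 2
  have hsplit : (∫ y, Complex.exp (s * trigPoly L F w y) ∂(uniformLaw d L)) - 1
      = (∫ y, (Complex.exp (s * trigPoly L F w y) - 1 - s * trigPoly L F w y) ∂(uniformLaw d L))
        + s * ∫ y, trigPoly L F w y ∂(uniformLaw d L) := by
    have e1 := integral_sub (hi2.sub (integrable_const (1 : ℂ))) hi1
    have e2 := integral_sub hi2 (integrable_const (1 : ℂ))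
    simp only [Pi.sub_apply] at e1
    rw [e1, e2, integral_const, probReal_univ, one_smul, integral_const_mul]
    ring
  have h1 : ‖∫ y, (Complex.exp (s * trigPoly L F w y) - 1 - s * trigPoly L F w y)
      ∂(uniformLaw d L)‖ ≤ s ^ 2 * Real.exp (s * K) * ∑ m ∈ F, w m ^ 2 := by
    rw [← integral_norm_trigPoly_sq hL, ← integral_const_mul]
    refine norm_integral_le_of_norm_le (hi3.const_mul _) (Filter.Eventually.of_forall fun y => ?_)
    have h2 := Complex.norm_exp_sub_sum_le_norm_mul_exp ((s : ℂ) * trigPoly L F w y) 2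
    simp only [Finset.sum_range_succ, Finset.range_zero, Finset.sum_empty, pow_zero, pow_one,
      Nat.factorial, Nat.cast_one, div_one, zero_add, mul_one] at h2
    rw [sub_sub]
    refine h2.trans ?_
    rw [norm_mul, Complex.norm_real, Real.norm_of_nonneg hs, mul_pow]
    have h3 : Real.exp (s * ‖trigPoly L F w y‖) ≤ Real.exp (s * K) :=
      Real.exp_le_exp.2 (mul_le_mul_of_nonneg_left (hb y) hs)
    calc _ ≤ s ^ 2 * ‖trigPoly L F w y‖ ^ 2 * Real.exp (s * K) := by gcongr
      _ = _ := by ring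
  have h2 : ‖∫ y, trigPoly L F w y ∂(uniformLaw d L)‖ ≤ K / boxVolume d L := by
    rw [integral_trigPoly hL]
    split_ifs
    · rw [Complex.norm_real, Real.norm_of_nonneg (hw 0)]
      exact hKv 0
    · rw [norm_zero]
      positivity
  have h3 : ∑ m ∈ F, w m ^ 2 ≤ K * (K / boxVolume d L) := by
    calc ∑ m ∈ F, w m ^ 2 ≤ ∑ m ∈ F, w m * (K / boxVolume d L) :=
          Finset.sum_le_sum fun m _ => by
            rw [sq]
            exact mul_le_mul_of_nonneg_left (hKv m) (hw m)
      _ = (∑ m ∈ F, w m) * (K / boxVolume d L) := by rw [Finset.sum_mul]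
      _ ≤ _ := by gcongr
  rw [hsplit]
  calc boxVolume d L * _ ≤ boxVolume d L * (s ^ 2 * Real.exp (s * K) * (K * (K / boxVolume d L))
        + s * (K / boxVolume d L)) := by
        refine mul_le_mul_of_nonneg_left ((norm_add_le _ _).trans (add_le_add (h1.trans ?_) ?_)) hv.le
        · gcongr
        · rw [norm_mul, Complex.norm_real, Real.norm_of_nonneg hs]
          gcongr
    _ = _ := by
        field_simp
        ring

/-- The moments of the modes of the weighted random points obey an exponential bound which is
uniform in the size of the box. As the correlations of the unweighted modes are nonnegative, it
follows from the generating functional of the point process. -/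
lemma sum_norm_integral_weightedMode_le (hL : 0 < L) [IsProbabilityMeasure ρ]
    (hρ : HasUniformlyBoundedMoments ρ) (hw : ∀ m, 0 ≤ w m) {K : ℝ}
    (hK : ∑ m ∈ F, w m ≤ K) (hKv : ∀ m, w m ≤ K / boxVolume d L) {s : ℝ} (hs : 0 ≤ s) (n : ℕ) :
    s ^ n / n.factorial * ∑ κ ∈ Fintype.piFinset fun _ : Fin n => F, (∏ i, w (κ i)) *
        ‖∫ ω, ∏ i, weightedMode L (κ i) ω ∂(configLaw d L ρ)‖
      ≤ Real.exp (s * K + s ^ 2 * K ^ 2 * Real.exp (s * K)) := by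
  have := isProbabilityMeasure_configLaw (d := d) (ρ := ρ) hL
  have hK0 : 0 ≤ K := (Finset.sum_nonneg fun m _ => hw m).trans hK
  choose r hr0 hr hrw using fun (n : ℕ) (κ : Fin n → Fin d → ℤ) =>
    exists_integral_prod_mode (ρ := ρ) hL hρ κ
  set c : ℕ → ℝ := fun n => ∑ κ ∈ Fintype.piFinset fun _ : Fin n => F, (∏ i, w (κ i)) * r n κ
  have hc0 : ∀ n, 0 ≤ c n := fun n => Finset.sum_nonneg fun κ _ =>
    mul_nonneg (Finset.prod_nonneg fun i _ => hw _) (hr0 n κ)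
  -- `Y` is the linear statistic `∑_γ b(y_γ)` of the trigonometric polynomial `b` with weights `w`
  set Y : Config d → ℂ := fun ω => ∑ m ∈ F, (w m : ℂ) * pointMode L m ω
  have hYm : Measurable Y := Finset.measurable_fun_sum _ fun m _ =>
    (measurable_pointMode m).const_mul _
  have hYb : ∀ ω, ‖Y ω‖ ≤ K * ω.1 := by
    intro ω
    refine (norm_sum_le _ _).trans ?_
    calc _ ≤ ∑ m ∈ F, w m * ω.1 := Finset.sum_le_sum fun m _ => by
            rw [norm_mul, Complex.norm_real, Real.norm_of_nonneg (hw m)]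
            exact mul_le_mul_of_nonneg_left (norm_pointMode_le m ω) (hw m)
      _ = (∑ m ∈ F, w m) * ω.1 := by rw [Finset.sum_mul]
      _ ≤ _ := by gcongr
  have hYs : ∀ ω, ‖(s : ℂ) * Y ω‖ ≤ s * K * ω.1 := fun ω => by
    rw [norm_mul, Complex.norm_real, Real.norm_of_nonneg hs, mul_assoc]
    exact mul_le_mul_of_nonneg_left (hYb ω) hs
  have hYn : ∀ n : ℕ, ∫ ω, Y ω ^ n ∂(configLaw d L ρ) = c n := by
    intro n
    have h1 : ∀ ω, Y ω ^ n = ∑ κ ∈ Fintype.piFinset fun _ : Fin n => F,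
        ((∏ i, w (κ i) : ℝ) : ℂ) * ∏ i, pointMode L (κ i) ω := by
      intro ω
      have h2 := Finset.prod_univ_sum (fun _ : Fin n => F)
        (fun _ m => (w m : ℂ) * pointMode L m ω)
      rw [Finset.prod_const, Finset.card_univ, Fintype.card_fin] at h2
      rw [h2]
      refine Finset.sum_congr rfl fun κ _ => ?_
      rw [Finset.prod_mul_distrib]
      push_cast
      rfl
    simp only [h1]
    rw [integral_finsetSum _ fun κ _ => (integrable_prod_pointMode hL κ).const_mul _]
    simp only [integral_const_mul, hr, c]
    push_cast
    rfl
  have hsum : HasSum (fun n : ℕ => ((s ^ n / n.factorial * c n : ℝ) : ℂ))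
      (∫ ω, Complex.exp (s * Y ω) ∂(configLaw d L ρ)) := by
    have h := hasSum_integral_of_dominated_convergence (μ := configLaw d L ρ)
      (F := fun (n : ℕ) ω => ((s : ℂ) * Y ω) ^ n / n.factorial)
      (f := fun ω => Complex.exp (s * Y ω))
      (fun n ω => (s * K * ω.1) ^ n / n.factorial)
      (fun n => (((hYm.const_mul _).pow_const n).div_const _).aestronglyMeasurable)
      (fun n => Filter.Eventually.of_forall fun ω => by
        rw [norm_div, norm_pow, RCLike.norm_natCast]
        gcongr
        exact hYs ω)
      (Filter.Eventually.of_forall fun ω => Real.summable_pow_div_factorial _)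
      (by
        refine (integrable_exp_card hL (s * K)).congr (Filter.Eventually.of_forall fun ω => ?_)
        change _ = ∑' n : ℕ, (s * K * ω.1) ^ n / n.factorial
        rw [(NormedSpace.expSeries_div_hasSum_exp (s * K * ω.1 : ℝ)).tsum_eq, Real.exp_eq_exp_ℝ])
      (Filter.Eventually.of_forall fun ω => by
        rw [Complex.exp_eq_exp_ℂ]
        exact NormedSpace.expSeries_div_hasSum_exp _)
    refine h.congr_fun fun n => ?_
    simp only [mul_pow, mul_div_right_comm]
    rw [integral_const_mul, hYn]
    push_cast
    rfl
  have hprod : ∫ ω, Complex.exp (s * Y ω) ∂(configLaw d L ρ)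
      = Complex.exp (boxVolume d L *
        ((∫ y, Complex.exp (s * trigPoly L F w y) ∂(uniformLaw d L)) - 1)) := by
    rw [← integral_prod_points (ρ := ρ) hL (c := s * K)
      (h := fun y => Complex.exp (s * trigPoly L F w y))
      (Complex.measurable_exp.comp (measurable_trigPoly.const_mul _)) fun y => ?_]
    · refine integral_congr_ae (Filter.Eventually.of_forall fun ω => ?_)
      change Complex.exp (s * Y ω) = ∏ γ ∈ Finset.range ω.1, Complex.exp (s * trigPoly L F w (ω.2.1 γ))
      rw [← Complex.exp_sum, ← Finset.mul_sum]
      congr 2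
      simp only [Y, pointMode, trigPoly, Finset.mul_sum]
      exact Finset.sum_comm
    · refine (Complex.norm_exp_le_exp_norm _).trans (Real.exp_le_exp.2 ?_)
      rw [norm_mul, Complex.norm_real, Real.norm_of_nonneg hs]
      exact mul_le_mul_of_nonneg_left ((norm_trigPoly_le hw y).trans hK) hs
  have hbound : s ^ n / n.factorial * c n
      ≤ Real.exp (s * K + s ^ 2 * K ^ 2 * Real.exp (s * K)) := by
    have hre := Complex.hasSum_re hsum
    simp only [Complex.ofReal_re] at hre
    -- all terms of the exponential series are nonnegative, so each is bounded by the sum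
    refine (le_hasSum hre n fun k _ => mul_nonneg (by positivity) (hc0 k)).trans ?_
    refine (Complex.re_le_norm _).trans ?_
    rw [hprod]
    refine (Complex.norm_exp_le_exp_norm _).trans (Real.exp_le_exp.2 ?_)
    rw [norm_mul, Complex.norm_real, Real.norm_of_nonneg (boxVolume_pos hL).le]
    exact norm_integral_exp_trigPoly_sub_one_le hL hw hK hKv hs
  refine le_trans ?_ hbound
  refine mul_le_mul_of_nonneg_left (Finset.sum_le_sum fun κ _ => ?_) (by positivity)
  exact mul_le_mul_of_nonneg_left (hrw n κ) (Finset.prod_nonneg fun i _ => hw _)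

end ExponentialMoment

/-! ### The potential as an operator -/

section Potential

variable {d : ℕ} {L : ℝ}

lemma opNorm_le_of_ae {T : BoxL2 d L →L[ℂ] BoxL2 d L} {C : ℝ} (hC : 0 ≤ C)
    (h : ∀ f, ∀ᵐ x ∂(volume : Measure (Space d)).restrict (box d L), ‖T f x‖ ≤ C * ‖f x‖) :
    ‖T‖ ≤ C :=
  T.opNorm_le_bound hC fun f => Lp.norm_le_mul_norm_of_ae_le_mul (h f)

lemma potentialOp_ae (B : 𝓢(Space d, ℝ)) (ω : Config d) (f : BoxL2 d L) :
    ∀ᵐ x ∂(volume : Measure (Space d)).restrict (box d L),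
      potentialOp L B ω f x = (randomPotential L B ω x : ℂ) * f x := by
  filter_upwards [(ContinuousLinearMap.mul ℂ ℂ).coeFn_holder (r := 2)
    ((memLp_randomPotential L B ω).toLp _) f, (memLp_randomPotential L B ω).coeFn_toLp] with x h1 h2
  rw [h2] at h1
  exact h1

lemma potentialOp_symmetric (B : 𝓢(Space d, ℝ)) (ω : Config d) (f g : BoxL2 d L) :
    inner ℂ (potentialOp L B ω f) g = inner ℂ f (potentialOp L B ω g) := by
  rw [L2.inner_def, L2.inner_def]
  refine integral_congr_ae ?_
  filter_upwards [potentialOp_ae B ω f, potentialOp_ae B ω g] with x hf hg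
  rw [hf, hg, RCLike.inner_apply, RCLike.inner_apply, map_mul, Complex.conj_ofReal]
  ring

lemma norm_potentialOp_le (B : 𝓢(Space d, ℝ)) {ω : Config d} (hω : ∀ γ, |ω.2.2 γ| ≤ 1) :
    ‖potentialOp L B ω‖ ≤ ‖B.toBoundedContinuousFunction‖ * ω.1 := by
  refine opNorm_le_of_ae (by positivity) fun f => ?_
  filter_upwards [potentialOp_ae B ω f] with x hx
  rw [hx, norm_mul, Complex.norm_real]
  refine mul_le_mul_of_nonneg_right ?_ (norm_nonneg _)
  refine (norm_sum_le _ _).trans ((Finset.sum_le_sum (g := fun _ =>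
    ‖B.toBoundedContinuousFunction‖) fun γ _ => ?_).trans_eq (by simp [mul_comm]))
  rw [norm_mul]
  exact (mul_le_of_le_one_left (norm_nonneg _) (hω γ)).trans
    (B.toBoundedContinuousFunction.norm_coe_le_norm _)

/-- Multiplication by the plane wave of momentum `m / L`. -/
def waveOp (L : ℝ) (m : Fin d → ℤ) : BoxL2 d L →L[ℂ] BoxL2 d L :=
  (ContinuousLinearMap.mul ℂ ℂ).holderL ((volume : Measure (Space d)).restrict (box d L)) ∞ 2 2
    ((memLp_top_of_bound (continuous_planeWave (dualPoint L m)).aestronglyMeasurable 1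
      (Filter.Eventually.of_forall fun x => (norm_planeWave _ x).le)).toLp _)

lemma waveOp_ae (m : Fin d → ℤ) (f : BoxL2 d L) :
    ∀ᵐ x ∂(volume : Measure (Space d)).restrict (box d L),
      waveOp L m f x = planeWave (dualPoint L m) x * f x := by
  have h : MemLp (planeWave (dualPoint L m)) ∞
      ((volume : Measure (Space d)).restrict (box d L)) :=
    memLp_top_of_bound (continuous_planeWave (dualPoint L m)).aestronglyMeasurable 1
      (Filter.Eventually.of_forall fun x => (norm_planeWave _ x).le)
  filter_upwards [(ContinuousLinearMap.mul ℂ ℂ).coeFn_holder (r := 2) (h.toLp _) f,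
    h.coeFn_toLp] with x h1 h2
  rw [h2] at h1
  exact h1

lemma norm_waveOp_le (m : Fin d → ℤ) : ‖waveOp L m‖ ≤ 1 := by
  refine opNorm_le_of_ae zero_le_one fun f => ?_
  filter_upwards [waveOp_ae m f] with x hx
  rw [hx, norm_mul, norm_planeWave]

/-- The contribution to the potential of the Fourier modes of the profile in the finite set `F`. -/
def truncatedOp (L : ℝ) (B : 𝓢(Space d, ℝ)) (F : Finset (Fin d → ℤ)) (ω : Config d) :
    BoxL2 d L →L[ℂ] BoxL2 d L :=
  ∑ m ∈ F, (profileCoeff L B m * weightedMode L m ω) • waveOp L m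

lemma truncatedOp_ae (B : 𝓢(Space d, ℝ)) (F : Finset (Fin d → ℤ)) (ω : Config d) (f : BoxL2 d L) :
    ∀ᵐ x ∂(volume : Measure (Space d)).restrict (box d L),
      truncatedOp L B F ω f x = (∑ γ ∈ Finset.range ω.1, (ω.2.2 γ : ℂ) *
        ∑ m ∈ F, profileCoeff L B m * planeWave (dualPoint L m) (x - ω.2.1 γ)) * f x := by
  have h : truncatedOp L B F ω f
      = ∑ m ∈ F, (profileCoeff L B m * weightedMode L m ω) • waveOp L m f := by
    simp [truncatedOp]
  have h1 : ∀ᵐ x ∂(volume : Measure (Space d)).restrict (box d L), ∀ m : Fin d → ℤ,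
      waveOp L m f x = planeWave (dualPoint L m) x * f x := ae_all_iff.2 fun m => waveOp_ae m f
  have h2 : ∀ᵐ x ∂(volume : Measure (Space d)).restrict (box d L), ∀ m : Fin d → ℤ,
      ((profileCoeff L B m * weightedMode L m ω) • waveOp L m f : BoxL2 d L) x
        = (profileCoeff L B m * weightedMode L m ω) • waveOp L m f x := ae_all_iff.2 fun m =>
    Lp.coeFn_smul _ _
  rw [h]
  filter_upwards [h1, h2, Lp.coeFn_finsetSum F
    (fun m => (profileCoeff L B m * weightedMode L m ω) • waveOp L m f)] with x h1 h2 h3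
  rw [h3]
  simp only [Finset.sum_apply, h2, h1, smul_eq_mul]
  simp only [weightedMode, sub_eq_add_neg, planeWave_add, Finset.mul_sum, Finset.sum_mul]
  rw [Finset.sum_comm]
  refine Finset.sum_congr rfl fun γ _ => Finset.sum_congr rfl fun m _ => ?_
  ring

section

variable {B : 𝓢(Space d, ℝ)}

lemma norm_truncatedOp_le {F : Finset (Fin d → ℤ)} {K : ℝ}
    (hK : ∑ m ∈ F, ‖profileCoeff L B m‖ ≤ K) {ω : Config d} (hω : ∀ γ, |ω.2.2 γ| ≤ 1) :
    ‖truncatedOp L B F ω‖ ≤ K * ω.1 := by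
  refine (norm_sum_le _ _).trans ?_
  calc _ ≤ ∑ m ∈ F, ‖profileCoeff L B m‖ * ω.1 := Finset.sum_le_sum fun m _ => by
        rw [norm_smul, norm_mul]
        refine (mul_le_of_le_one_right (by positivity) (norm_waveOp_le m)).trans ?_
        exact mul_le_mul_of_nonneg_left (norm_weightedMode_le m hω) (norm_nonneg _)
    _ = (∑ m ∈ F, ‖profileCoeff L B m‖) * ω.1 := by rw [Finset.sum_mul]
    _ ≤ _ := by gcongr

/-- The truncation converges to the potential in operator norm. -/
lemma norm_potentialOp_sub_truncatedOp_le (hL : 0 < L)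
    (hs : Summable fun m => ‖profileCoeff L B m‖) (F : Finset (Fin d → ℤ)) {ω : Config d}
    (hω : ∀ γ, |ω.2.2 γ| ≤ 1) :
    ‖potentialOp L B ω - truncatedOp L B F ω‖
      ≤ ((∑' m, ‖profileCoeff L B m‖) - ∑ m ∈ F, ‖profileCoeff L B m‖) * ω.1 := by
  set δ := (∑' m, ‖profileCoeff L B m‖) - ∑ m ∈ F, ‖profileCoeff L B m‖
  have hδ : δ = ∑' m : { m // m ∉ F }, ‖profileCoeff L B m‖ := by
    simp only [δ]
    rw [← hs.sum_add_tsum_subtype_compl F, add_sub_cancel_left]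
  have hδ0 : 0 ≤ δ := hδ ▸ tsum_nonneg fun m => norm_nonneg _
  have htail : ∀ z : Space d, ‖profileSeries L B z
      - ∑ m ∈ F, profileCoeff L B m * planeWave (dualPoint L m) z‖ ≤ δ := by
    intro z
    rw [profileSeries, ← (hasSum_profileSeries hs z).summable.sum_add_tsum_subtype_compl F,
      add_sub_cancel_left, hδ]
    refine tsum_of_norm_bounded (hs.subtype _).hasSum fun m => ?_
    exact (norm_profileCoeff_mul L B m z).le
  refine opNorm_le_of_ae (by positivity) fun f => ?_
  have hper : ∀ᵐ x ∂(volume : Measure (Space d)).restrict (box d L), ∀ γ,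
      ((periodize L B (x - ω.2.1 γ) : ℝ) : ℂ) = profileSeries L B (x - ω.2.1 γ) :=
    ae_all_iff.2 fun γ => ae_restrict_of_ae <|
      (measurePreserving_sub_right volume (ω.2.1 γ)).quasiMeasurePreserving.ae
        (ae_periodize_eq_profileSeries hs hL)
  filter_upwards [potentialOp_ae B ω f, truncatedOp_ae B F ω f, hper,
    Lp.coeFn_sub (potentialOp L B ω f) (truncatedOp L B F ω f)] with x h1 h2 h3 h4
  rw [sub_apply, h4, Pi.sub_apply, h1, h2, ← sub_mul, norm_mul]
  refine mul_le_mul_of_nonneg_right ?_ (norm_nonneg _)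
  rw [randomPotential]
  push_cast
  rw [← Finset.sum_sub_distrib]
  refine (norm_sum_le _ _).trans ((Finset.sum_le_sum (g := fun _ => δ) fun γ _ => ?_).trans_eq
    (by simp [mul_comm]))
  rw [← mul_sub, norm_mul, h3, Complex.norm_real]
  exact (mul_le_of_le_one_left (norm_nonneg _) (hω γ)).trans (htail _)

end

end Potential

/-! ### Measurability in the random configuration -/

section Measurability

variable {X ι : Type*} [NormedAddCommGroup X] [InnerProductSpace ℂ X] [Countable ι]
  {Ω : Type*} [MeasurableSpace Ω]

lemma stronglyMeasurable_of_inner (b : HilbertBasis ι ℂ X) {u : Ω → X}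
    (h : ∀ i, StronglyMeasurable fun ω => inner ℂ (b i) (u ω)) : StronglyMeasurable u := by
  refine stronglyMeasurable_of_tendsto (f := fun (s : Finset ι) ω =>
    ∑ i ∈ s, inner ℂ (b i) (u ω) • b i) Filter.atTop (fun s => ?_) ?_
  · exact Finset.stronglyMeasurable_fun_sum _ fun i _ => (h i).smul_const _
  · rw [tendsto_pi_nhds]
    intro ω
    have := b.hasSum_repr (u ω)
    simpa only [HasSum, SummationFilter.unconditional_filter, b.repr_apply_apply] using this

/-- A random bounded operator applied to a random vector. -/
lemma stronglyMeasurable_clm_apply (b : HilbertBasis ι ℂ X) {T : Ω → X →L[ℂ] X} {u : Ω → X}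
    (hT : ∀ f, StronglyMeasurable fun ω => T ω f) (hu : StronglyMeasurable u) :
    StronglyMeasurable fun ω => T ω (u ω) := by
  refine stronglyMeasurable_of_tendsto (f := fun (s : Finset ι) ω =>
    ∑ i ∈ s, inner ℂ (b i) (u ω) • T ω (b i)) Filter.atTop (fun s => ?_) ?_
  · exact Finset.stronglyMeasurable_fun_sum _ fun i _ =>
      (stronglyMeasurable_const.inner hu).smul (hT _)
  · rw [tendsto_pi_nhds]
    intro ω
    have := (b.hasSum_repr (u ω)).mapL (T ω)
    simpa only [HasSum, SummationFilter.unconditional_filter, b.repr_apply_apply, map_smul]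
      using this

lemma stronglyMeasurable_resolventProd (b : HilbertBasis ι ℂ X) {R V : Ω → X →L[ℂ] X}
    (hR : ∀ f, StronglyMeasurable fun ω => R ω f) (hV : ∀ f, StronglyMeasurable fun ω => V ω f)
    (n : ℕ) (y : X) :
    StronglyMeasurable fun ω => resolventProd (R ω) (List.replicate n (V ω)) y := by
  induction n with
  | zero => exact hR y
  | succ n ih =>
    exact stronglyMeasurable_clm_apply (u := fun ω => V ω (resolventProd (R ω)
      (List.replicate n (V ω)) y)) b hR (stronglyMeasurable_clm_apply b hV ih)

end Measurability

section PotentialMeasurability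

variable {d : ℕ} {L : ℝ}

lemma measurable_randomPotential_uncurry (B : 𝓢(Space d, ℝ)) :
    Measurable fun q : Config d × Space d => randomPotential L B q.1 q.2 := by
  refine measurable_sum_points (N := fun q : Config d × Space d => q.1.1)
    (measurable_fst.comp measurable_fst)
    (f := fun γ q => q.1.2.2 γ * periodize L B (q.2 - q.1.2.1 γ)) fun γ => ?_
  have h1 : Measurable fun q : Config d × Space d => q.1.2.2 γ := by fun_prop
  have h2 : Measurable fun q : Config d × Space d => q.2 - q.1.2.1 γ := by fun_prop
  exact h1.mul (B.continuous.measurable.comp ((measurable_wrap L).comp h2))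

lemma stronglyMeasurable_potentialOp (hL : 0 < L) (B : 𝓢(Space d, ℝ)) (f : BoxL2 d L) :
    StronglyMeasurable fun ω : Config d => potentialOp L B ω f := by
  refine stronglyMeasurable_of_inner (boxBasis d hL) fun m => ?_
  have h : (fun ω : Config d => inner ℂ (boxBasis d hL m) (potentialOp L B ω f))
      = fun ω : Config d => ∫ x in box d L, (randomPotential L B ω x : ℂ) * f x
        * (starRingEnd ℂ) (boxBasis d hL m x) := by
    funext ω
    rw [L2.inner_def]
    refine integral_congr_ae ?_
    filter_upwards [potentialOp_ae B ω f] with x hx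
    rw [hx, RCLike.inner_apply]
  rw [h]
  refine StronglyMeasurable.integral_prod_right (f := fun (ω : Config d) (x : Space d) =>
    (randomPotential L B ω x : ℂ) * f x * (starRingEnd ℂ) (boxBasis d hL m x)) ?_
  have h1 := (Complex.measurable_ofReal.comp
    (measurable_randomPotential_uncurry (L := L) B)).stronglyMeasurable
  have h2 := (Lp.stronglyMeasurable f).comp_measurable
    (measurable_snd : Measurable (Prod.snd : Config d × Space d → Space d))
  have h3 := (Complex.continuous_conj.comp_stronglyMeasurable
    (Lp.stronglyMeasurable (boxBasis d hL m))).comp_measurable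
    (measurable_snd : Measurable (Prod.snd : Config d × Space d → Space d))
  exact (h1.mul h2).mul h3

end PotentialMeasurability

/-! ### Expectations of the smeared terms -/

section Expectation

variable {d : ℕ} {L : ℝ}

/-- The smeared term `∫ φ(α) ⟨x, R(z + 2πα) [V_L R(z + 2πα)]^n y⟩ dα` of the Neumann series for a
given configuration, where `R` is the resolvent of the free Hamiltonian. -/
def smearedTerm (hL : 0 < L) (B : 𝓢(Space d, ℝ)) (φ : ℝ → ℂ) (z : ℂ) (x y : BoxL2 d L) (n : ℕ)
    (ω : Config d) : ℂ :=
  ∫ α, smearedProdIntegrand (boxBasis d hL) (fun m => energy (dualPoint L m)) φ z x y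
    (List.replicate n (potentialOp L B ω)) α

lemma stronglyMeasurable_inner_resolventProd (hL : 0 < L) (B : 𝓢(Space d, ℝ)) {z : ℂ}
    (hz : 0 < z.im) (x y : BoxL2 d L) (n : ℕ) :
    StronglyMeasurable fun q : Config d × ℝ => inner ℂ x (resolventProd
      (diagResolvent (boxBasis d hL) (fun m => energy (dualPoint L m)) (z + 2 * Real.pi * q.2))
      (List.replicate n (potentialOp L B q.1)) y) := by
  refine stronglyMeasurable_const.inner (stronglyMeasurable_resolventProd (boxBasis d hL)
    (R := fun q : Config d × ℝ => diagResolvent (boxBasis d hL) (fun m => energy (dualPoint L m))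
      (z + 2 * Real.pi * q.2)) (V := fun q => potentialOp L B q.1) (fun f => ?_) (fun f => ?_) n y)
  · exact (((continuous_diagResolvent (boxBasis d hL) (fun m => energy (dualPoint L m)) hz).clm_apply
      continuous_const).stronglyMeasurable).comp_measurable measurable_snd
  · exact (stronglyMeasurable_potentialOp hL B f).comp_measurable measurable_fst

variable {ρ : Measure ℝ} [IsProbabilityMeasure ρ]

lemma integrable_inner_resolventProd (hL : 0 < L) (B : 𝓢(Space d, ℝ))
    (hρ : HasUniformlyBoundedMoments ρ) {z : ℂ} (hz : 0 < z.im) (x y : BoxL2 d L) (n : ℕ) (α : ℝ) :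
    Integrable (fun ω => inner ℂ x (resolventProd
      (diagResolvent (boxBasis d hL) (fun m => energy (dualPoint L m)) (z + 2 * Real.pi * α))
      (List.replicate n (potentialOp L B ω)) y)) (configLaw d L ρ) := by
  have hm := (stronglyMeasurable_inner_resolventProd hL B hz x y n).comp_measurable
    (measurable_id.prodMk measurable_const : Measurable fun ω : Config d => (ω, α))
  refine ((integrable_card_pow hL n).const_mul (‖x‖ * (z.im⁻¹ ^ (n + 1) *
    ‖B.toBoundedContinuousFunction‖ ^ n * ‖y‖))).mono' hm.aestronglyMeasurable ?_
  filter_upwards [ae_weights_le_one hL hρ] with ω hω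
  refine (norm_inner_resolventProd_le _ _ hz x y _ α).trans ?_
  have h := pow_le_pow_left₀ (norm_nonneg _) (norm_potentialOp_le (L := L) B hω) n
  simp only [List.length_replicate, List.map_replicate, List.prod_replicate]
  calc _ ≤ ‖x‖ * (z.im⁻¹ ^ (n + 1) * (‖B.toBoundedContinuousFunction‖ * ω.1) ^ n * ‖y‖) := by
        gcongr
    _ = _ := by ring

/-- Joint integrability, which justifies exchanging the expectation and the smearing. -/
lemma integrable_smearedProdIntegrand_prod (hL : 0 < L) (B : 𝓢(Space d, ℝ))
    (hρ : HasUniformlyBoundedMoments ρ) {φ : ℝ → ℂ} (hφ : Integrable φ) {z : ℂ} (hz : 0 < z.im)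
    (x y : BoxL2 d L) (n : ℕ) :
    Integrable (fun q : Config d × ℝ => smearedProdIntegrand (boxBasis d hL)
      (fun m => energy (dualPoint L m)) φ z x y (List.replicate n (potentialOp L B q.1)) q.2)
      ((configLaw d L ρ).prod volume) := by
  have := isProbabilityMeasure_configLaw (d := d) (ρ := ρ) hL
  refine (((integrable_card_pow hL n).const_mul (‖x‖ * (z.im⁻¹ ^ (n + 1) *
    ‖B.toBoundedContinuousFunction‖ ^ n * ‖y‖))).mul_prod hφ.norm).mono'
    (hφ.aestronglyMeasurable.comp_snd.mul
      (stronglyMeasurable_inner_resolventProd hL B hz x y n).aestronglyMeasurable) ?_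
  filter_upwards [Measure.quasiMeasurePreserving_fst.ae (ae_weights_le_one hL hρ)] with q hq
  rw [smearedProdIntegrand, norm_mul, mul_comm]
  refine mul_le_mul_of_nonneg_right ?_ (norm_nonneg _)
  refine (norm_inner_resolventProd_le _ _ hz x y _ q.2).trans ?_
  have h := pow_le_pow_left₀ (norm_nonneg _) (norm_potentialOp_le (L := L) B hq) n
  simp only [List.length_replicate, List.map_replicate, List.prod_replicate]
  calc _ ≤ ‖x‖ * (z.im⁻¹ ^ (n + 1) * (‖B.toBoundedContinuousFunction‖ * q.1.1) ^ n * ‖y‖) := by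
        gcongr
    _ = _ := by ring

lemma integrable_smearedTerm (hL : 0 < L) (B : 𝓢(Space d, ℝ))
    (hρ : HasUniformlyBoundedMoments ρ) {φ : ℝ → ℂ} (hφ : Integrable φ) {z : ℂ} (hz : 0 < z.im)
    (x y : BoxL2 d L) (n : ℕ) :
    Integrable (smearedTerm hL B φ z x y n) (configLaw d L ρ) := by
  have := isProbabilityMeasure_configLaw (d := d) (ρ := ρ) hL
  exact (integrable_smearedProdIntegrand_prod hL B hρ hφ hz x y n).integral_prod_left

variable {χ : ℝ → ℝ} {a : ℝ}

lemma norm_smearedTerm_le (hL : 0 < L) (B : 𝓢(Space d, ℝ)) (hχ : IsCutoff χ) (ha : 0 < a) {z : ℂ}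
    (hz : 0 < z.im) (x y : BoxL2 d L) (n : ℕ) {ω : Config d} (hω : ∀ γ, |ω.2.2 γ| ≤ 1) :
    ‖smearedTerm hL B (cutoffHat χ a) z x y n ω‖
      ≤ (2 / a) ^ (n + 1) * (‖x‖ * ‖y‖) *
        ((‖B.toBoundedContinuousFunction‖ * ω.1) ^ n / n.factorial) := by
  refine (norm_integral_smearedProdIntegrand_le _ _ hχ ha hz x y _).trans ?_
  have h := pow_le_pow_left₀ (norm_nonneg _) (norm_potentialOp_le (L := L) B hω) n
  simp only [List.length_replicate, List.map_replicate, List.prod_replicate]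
  calc _ ≤ (2 / a) ^ (n + 1) / n.factorial *
        ((‖B.toBoundedContinuousFunction‖ * ω.1) ^ n * (‖x‖ * ‖y‖)) := by gcongr
    _ = _ := by ring

/-- The crude bound on the expectation of a smeared term, which deteriorates with the volume. -/
lemma norm_integral_smearedTerm_le_exp_boxVolume (hL : 0 < L) (B : 𝓢(Space d, ℝ))
    (hρ : HasUniformlyBoundedMoments ρ) (hχ : IsCutoff χ) (ha : 0 < a) {z : ℂ} (hz : 0 < z.im)
    (x y : BoxL2 d L) {s : ℝ} (hs : 0 < s) (n : ℕ) :
    ‖∫ ω, smearedTerm hL B (cutoffHat χ a) z x y n ω ∂(configLaw d L ρ)‖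
      ≤ (2 / a) ^ (n + 1) * (‖x‖ * ‖y‖) * (s⁻¹ ^ n * Real.exp (boxVolume d L *
        (Real.exp (s * ‖B.toBoundedContinuousFunction‖) - 1))) := by
  set b := ‖B.toBoundedContinuousFunction‖
  rw [← integral_exp_card (ρ := ρ) hL, ← integral_const_mul, ← integral_const_mul]
  refine norm_integral_le_of_norm_le (((integrable_exp_card hL _).const_mul _).const_mul _) ?_
  filter_upwards [ae_weights_le_one hL hρ] with ω hω
  refine (norm_smearedTerm_le hL B hχ ha hz x y n hω).trans ?_
  refine mul_le_mul_of_nonneg_left ?_ (by positivity)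
  have h := Real.pow_div_factorial_le_exp (x := s * b * ω.1) (by positivity) n
  rw [inv_pow, ← div_eq_inv_mul, le_div_iff₀ (by positivity)]
  refine le_trans (le_of_eq ?_) h
  rw [mul_assoc s, mul_pow s]
  ring

/-- The expectation of a smeared term is bounded uniformly in the size of the box, if the Fourier
coefficients of the periodized profile are summable and of the order of the inverse volume. The
potential is truncated to finitely many Fourier modes, the term is expanded by multilinearity, and
the truncation is removed by dominated convergence. -/
lemma norm_integral_smearedTerm_le_of_profileCoeff (hL : 0 < L) {B : 𝓢(Space d, ℝ)}
    (hρ : HasUniformlyBoundedMoments ρ) (hχ : IsCutoff χ) (ha : 0 < a) {z : ℂ} (hz : 0 < z.im)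
    (x y : BoxL2 d L) {K : ℝ} (hK : ∀ F : Finset (Fin d → ℤ), ∑ m ∈ F, ‖profileCoeff L B m‖ ≤ K)
    (hKv : ∀ m, ‖profileCoeff L B m‖ ≤ K / boxVolume d L) {s : ℝ} (hs : 0 < s) (n : ℕ) :
    ‖∫ ω, smearedTerm hL B (cutoffHat χ a) z x y n ω ∂(configLaw d L ρ)‖
      ≤ (2 / a) ^ (n + 1) * (‖x‖ * ‖y‖) * (s⁻¹ ^ n *
        Real.exp (s * K + s ^ 2 * K ^ 2 * Real.exp (s * K))) := by
  have hK0 : 0 ≤ K := by simpa using hK ∅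
  have hsum : Summable fun m => ‖profileCoeff L B m‖ :=
    summable_of_sum_le (fun m => norm_nonneg _) hK
  have hφ := hχ.integrable_cutoffHat ha
  set T := smearedMultilinear (boxBasis d hL) (fun m => energy (dualPoint L m)) hφ hz x y n
  set D := (2 / a) ^ (n + 1) * (‖x‖ * ‖y‖)
  have hD : 0 ≤ D := by positivity
  have hT : ∀ V : Fin n → BoxL2 d L →L[ℂ] BoxL2 d L,
      ‖T V‖ ≤ D / n.factorial * ∏ i, ‖V i‖ := by
    intro V
    refine (norm_integral_smearedProdIntegrand_le _ _ hχ ha hz x y (List.ofFn V)).trans_eq ?_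
    rw [List.length_ofFn, List.map_ofFn, List.prod_ofFn]
    simp only [D, Function.comp_apply]
    ring
  have hTerm : ∀ ω, smearedTerm hL B (cutoffHat χ a) z x y n ω = T fun _ => potentialOp L B ω := by
    intro ω
    change _ = ∫ α, smearedProdIntegrand (boxBasis d hL) (fun m => energy (dualPoint L m))
      (cutoffHat χ a) z x y (List.ofFn fun _ => potentialOp L B ω) α
    rw [List.ofFn_const]
    rfl
  have hTc : Continuous fun V : BoxL2 d L →L[ℂ] BoxL2 d L => T fun _ => V :=
    (T.mkContinuous _ hT).cont.comp (continuous_pi fun _ => continuous_id)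
  -- expansion of the truncated term into plane waves
  have hexp : ∀ (F : Finset (Fin d → ℤ)) (ω : Config d), (T fun _ => truncatedOp L B F ω)
      = ∑ κ ∈ Fintype.piFinset fun _ : Fin n => F, (∏ i, weightedMode L (κ i) ω) *
        ((∏ i, profileCoeff L B (κ i)) * T fun i => waveOp L (κ i)) := by
    intro F ω
    simp only [truncatedOp]
    rw [T.map_sum_finset]
    refine Finset.sum_congr rfl fun κ _ => ?_
    rw [T.map_smul_univ, Finset.prod_mul_distrib, smul_eq_mul]
    ring
  have hint : ∀ F : Finset (Fin d → ℤ), ‖∫ ω, (T fun _ => truncatedOp L B F ω) ∂(configLaw d L ρ)‖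
      ≤ D * (s⁻¹ ^ n * Real.exp (s * K + s ^ 2 * K ^ 2 * Real.exp (s * K))) := by
    intro F
    simp only [hexp]
    rw [integral_finsetSum _ fun κ _ => (integrable_prod_weightedMode hL hρ κ).mul_const _]
    simp only [integral_mul_const]
    have hmain := sum_norm_integral_weightedMode_le (F := F) hL hρ
      (fun m => norm_nonneg (profileCoeff L B m)) (hK F) hKv hs.le n
    calc _ ≤ ∑ κ ∈ Fintype.piFinset fun _ : Fin n => F, D / n.factorial *
          ((∏ i, ‖profileCoeff L B (κ i)‖) *
            ‖∫ ω, ∏ i, weightedMode L (κ i) ω ∂(configLaw d L ρ)‖) := by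
          refine (norm_sum_le _ _).trans (Finset.sum_le_sum fun κ _ => ?_)
          rw [norm_mul, norm_mul, norm_prod]
          have h1 : ‖T fun i => waveOp L (κ i)‖ ≤ D / n.factorial := by
            refine (hT _).trans (mul_le_of_le_one_right (by positivity) ?_)
            exact Finset.prod_le_one (fun _ _ => norm_nonneg _) fun i _ => norm_waveOp_le _
          calc _ ≤ ‖∫ ω, ∏ i, weightedMode L (κ i) ω ∂(configLaw d L ρ)‖ *
                ((∏ i, ‖profileCoeff L B (κ i)‖) * (D / n.factorial)) := by gcongr
            _ = _ := by ring
      _ = D * (s⁻¹ ^ n * (s ^ n / n.factorial * ∑ κ ∈ Fintype.piFinset fun _ : Fin n => F,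
            (∏ i, ‖profileCoeff L B (κ i)‖) *
              ‖∫ ω, ∏ i, weightedMode L (κ i) ω ∂(configLaw d L ρ)‖)) := by
          rw [← Finset.mul_sum, inv_pow]
          field_simp
      _ ≤ _ := by gcongr
  have hlim : Filter.Tendsto
      (fun F : Finset (Fin d → ℤ) => ∫ ω, (T fun _ => truncatedOp L B F ω) ∂(configLaw d L ρ))
      Filter.atTop (nhds (∫ ω, (T fun _ => potentialOp L B ω) ∂(configLaw d L ρ))) := by
    refine tendsto_integral_filter_of_dominated_convergence
      (fun ω => D / n.factorial * (K ^ n * (ω.1 : ℝ) ^ n))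
      (Filter.Eventually.of_forall fun F => ?_) (Filter.Eventually.of_forall fun F => ?_)
      (((integrable_card_pow hL n).const_mul _).const_mul _) ?_
    · simp only [hexp]
      exact (Finset.measurable_fun_sum _ fun κ _ => (Finset.measurable_fun_prod _ fun i _ =>
        measurable_weightedMode _).mul_const _).aestronglyMeasurable
    · filter_upwards [ae_weights_le_one hL hρ] with ω hω
      refine (hT _).trans (mul_le_mul_of_nonneg_left ?_ (by positivity))
      rw [Finset.prod_const, Finset.card_univ, Fintype.card_fin, ← mul_pow]
      exact pow_le_pow_left₀ (norm_nonneg _) (norm_truncatedOp_le (hK F) hω) n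
    · filter_upwards [ae_weights_le_one hL hρ] with ω hω
      refine (hTc.tendsto _).comp (tendsto_iff_norm_sub_tendsto_zero.2 ?_)
      refine squeeze_zero (fun _ => norm_nonneg _) (fun F => ?_) (g := fun F =>
        ((∑' m, ‖profileCoeff L B m‖) - ∑ m ∈ F, ‖profileCoeff L B m‖) * ω.1) ?_
      · rw [norm_sub_rev]
        exact norm_potentialOp_sub_truncatedOp_le hL hsum F hω
      · have h : Filter.Tendsto (fun F : Finset (Fin d → ℤ) => ∑ m ∈ F, ‖profileCoeff L B m‖)
            Filter.atTop (nhds (∑' m, ‖profileCoeff L B m‖)) := by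
          simpa only [HasSum, SummationFilter.unconditional_filter] using hsum.hasSum
        simpa using (h.const_sub (∑' m, ‖profileCoeff L B m‖)).mul_const (ω.1 : ℝ)
  simp only [hTerm]
  exact le_of_tendsto hlim.norm (Filter.Eventually.of_forall hint)

/-- The expectation of the `n`-th smeared term decays like an arbitrarily large power `s⁻ⁿ`,
uniformly in the size of the box. -/
lemma exists_norm_integral_smearedTerm_le {B : 𝓢(Space d, ℝ)} (hB : IsAdmissibleProfile B)
    (hρ : HasUniformlyBoundedMoments ρ) {s : ℝ} (hs : 0 < s) :
    ∃ G : ℝ, 0 < G ∧ ∀ (χ : ℝ → ℝ), IsCutoff χ → ∀ a : ℝ, 0 < a → ∀ (L : ℝ) (hL : 1 ≤ L) (z : ℂ),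
      0 < z.im → ∀ (x y : BoxL2 d L) (n : ℕ),
        ‖∫ ω, smearedTerm (one_pos.trans_le hL) B (cutoffHat χ a) z x y n ω ∂(configLaw d L ρ)‖
          ≤ (2 / a) ^ (n + 1) * (‖x‖ * ‖y‖) * (s⁻¹ ^ n * G) := by
  obtain ⟨L₀, K, hL₀, hK, hbound⟩ := hB.exists_bounds
  set G₁ := Real.exp (L₀ ^ d * (Real.exp (s * ‖B.toBoundedContinuousFunction‖) - 1))
  set G₂ := Real.exp (s * K + s ^ 2 * K ^ 2 * Real.exp (s * K))
  refine ⟨max G₁ G₂, lt_max_of_lt_left (Real.exp_pos _), fun χ hχ a ha L hL z hz x y n => ?_⟩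
  have hL' : 0 < L := one_pos.trans_le hL
  rcases le_total L L₀ with h | h
  · refine (norm_integral_smearedTerm_le_exp_boxVolume hL' B hρ hχ ha hz x y hs n).trans ?_
    have h1 : boxVolume d L ≤ L₀ ^ d := by
      rw [boxVolume_eq hL']
      exact pow_le_pow_left₀ hL'.le h d
    have h2 : 0 ≤ Real.exp (s * ‖B.toBoundedContinuousFunction‖) - 1 :=
      sub_nonneg.2 (Real.one_le_exp (by positivity))
    gcongr
    refine le_trans ?_ (le_max_left _ _)
    exact Real.exp_le_exp.2 (mul_le_mul_of_nonneg_right h1 h2)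
  · refine (norm_integral_smearedTerm_le_of_profileCoeff hL' hρ hχ ha hz x y (hbound L h).1
      (hbound L h).2 hs n).trans ?_
    gcongr
    exact le_max_right _ _

end Expectation

/-! ### The expansion of the averaged resolvent -/

section Resolvents

variable {d : ℕ} {L : ℝ} (hL : 0 < L) (B : 𝓢(Space d, ℝ)) (lam : ℝ) {z : ℂ}
  (ψ₁ ψ₂ : Lp ℂ 2 (volume : Measure (Space d)))

lemma inResolventSet_freeHamiltonian (hz : 0 < z.im) : InResolventSet (freeHamiltonian d hL) z :=
  ⟨_, (isDiagonal_freeHamiltonian hL).isResolvent hz⟩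

lemma inResolventSet_hamiltonian (hz : 0 < z.im) (ω : Config d) :
    InResolventSet (hamiltonian hL B lam ω) z := by
  obtain ⟨S, hS, -⟩ := (isDiagonal_freeHamiltonian hL).exists_isResolvent_vadd
    (potentialOp_symmetric B ω) lam hz
  exact ⟨S, hS⟩

/-- The resolvent of the random Hamiltonian is the Laplace transform of its Dyson series. -/
lemma resolventElement_eq (hz : 0 < z.im) (ω : Config d) :
    resolventElement hL B lam z ψ₁ ψ₂ ω = inner ℂ (toBox L ψ₁)
      (perturbedLaplace (boxBasis d hL) (fun m => energy (dualPoint L m)) (potentialOp L B ω) lam z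
        (toBox L ψ₂)) := by
  obtain ⟨S, hS, hSy⟩ := (isDiagonal_freeHamiltonian hL).exists_isResolvent_vadd
    (potentialOp_symmetric B ω) lam hz
  have h : resolventOp (hamiltonian hL B lam ω) z = S := IsResolvent.resolventOp_eq hS
  rw [resolventElement, h, hSy]

lemma neumannElement_eq (hz : 0 < z.im) (n : ℕ) (ω : Config d) :
    neumannElement hL B n z ψ₁ ψ₂ ω = inner ℂ (toBox L ψ₁) (resolventProd
      (diagResolvent (boxBasis d hL) (fun m => energy (dualPoint L m)) z)
      (List.replicate n (potentialOp L B ω)) (toBox L ψ₂)) := by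
  rw [neumannElement, ((isDiagonal_freeHamiltonian hL).isResolvent hz).resolventOp_eq,
    resolventProd_replicate]

lemma im_add_two_pi_mul (z : ℂ) (α : ℝ) : (z + 2 * Real.pi * α).im = z.im := by simp

variable {ρ : Measure ℝ} {χ : ℝ → ℝ} {E η ε : ℝ}

lemma im_add_mul_I : ((E : ℂ) + η * Complex.I).im = η := by simp

lemma cutoffScale_pos (hη : 0 < η) : 0 < cutoffScale η ε := by
  unfold cutoffScale
  positivity

/-- The choice of the cutoff scale makes the cutoff error at most half of `ε`. -/
lemma exp_div_cutoffScale_le (hη : 0 < η) (hε : 0 < ε) :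
    Real.exp (-η / cutoffScale η ε) / η ≤ ε / 2 := by
  have hu : 0 < η * ε / 2 := by positivity
  have h1 : -η / cutoffScale η ε = -(|Real.log (η * ε / 2)| + 1) := by
    unfold cutoffScale
    have : |Real.log (η * ε / 2)| + 1 ≠ 0 := by positivity
    field_simp
  have h2 : -(|Real.log (η * ε / 2)| + 1) ≤ Real.log (η * ε / 2) := by
    linarith [neg_abs_le (Real.log (η * ε / 2))]
  rw [h1, div_le_iff₀ hη]
  calc _ ≤ Real.exp (Real.log (η * ε / 2)) := Real.exp_le_exp.2 h2
    _ = ε / 2 * η := by rw [Real.exp_log hu]; ring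

lemma smearedIntegrand_eq (hη : 0 < η) (n : ℕ) (α : ℝ) :
    smearedIntegrand hL B ρ χ n E η ε ψ₁ ψ₂ α = ∫ ω, smearedProdIntegrand (boxBasis d hL)
      (fun m => energy (dualPoint L m)) (cutoffHat χ (cutoffScale η ε)) (E + η * Complex.I)
      (toBox L ψ₁) (toBox L ψ₂) (List.replicate n (potentialOp L B ω)) α ∂(configLaw d L ρ) := by
  simp only [smearedIntegrand, coeffT, smearedProdIntegrand]
  rw [integral_const_mul]
  congr 1
  refine integral_congr_ae (Filter.Eventually.of_forall fun ω => ?_)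
  exact neumannElement_eq hL B ψ₁ ψ₂ (by rwa [im_add_two_pi_mul, im_add_mul_I]) n ω

variable {B} [IsProbabilityMeasure ρ] (hρ : HasUniformlyBoundedMoments ρ)

include hρ

lemma integrable_neumannElement (hη : 0 < η) (n : ℕ) (α : ℝ) :
    Integrable (neumannElement hL B n (E + η * Complex.I + 2 * Real.pi * α) ψ₁ ψ₂)
      (configLaw d L ρ) := by
  refine (integrable_inner_resolventProd hL B hρ (z := E + η * Complex.I)
    (by rwa [im_add_mul_I]) (toBox L ψ₁) (toBox L ψ₂) n α).congr
    (Filter.Eventually.of_forall fun ω => ?_)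
  exact (neumannElement_eq hL B ψ₁ ψ₂ (by rwa [im_add_two_pi_mul, im_add_mul_I]) n ω).symm

lemma integrable_smearedIntegrand (hχ : IsCutoff χ) (hη : 0 < η) (n : ℕ) :
    Integrable (smearedIntegrand hL B ρ χ n E η ε ψ₁ ψ₂) := by
  have := isProbabilityMeasure_configLaw (d := d) (ρ := ρ) hL
  refine ((integrable_smearedProdIntegrand_prod hL B hρ
    (hχ.integrable_cutoffHat (cutoffScale_pos (ε := ε) hη)) (z := E + η * Complex.I)
    (by rwa [im_add_mul_I]) (toBox L ψ₁) (toBox L ψ₂) n).integral_prod_right).congr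
    (Filter.Eventually.of_forall fun α => ?_)
  exact (smearedIntegrand_eq hL B ψ₁ ψ₂ hη n α).symm

/-- Fubini's theorem: the coefficient is the expectation of the smeared term. -/
lemma coeffS_eq (hχ : IsCutoff χ) (hη : 0 < η) (n : ℕ) :
    coeffS hL B ρ χ n E η ε ψ₁ ψ₂ = (-1) ^ n * ∫ ω, smearedTerm hL B
      (cutoffHat χ (cutoffScale η ε)) (E + η * Complex.I) (toBox L ψ₁) (toBox L ψ₂) n ω
      ∂(configLaw d L ρ) := by
  have := isProbabilityMeasure_configLaw (d := d) (ρ := ρ) hL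
  rw [coeffS]
  congr 1
  simp only [smearedIntegrand_eq hL B ψ₁ ψ₂ hη, smearedTerm]
  exact (integral_integral_swap (integrable_smearedProdIntegrand_prod hL B hρ
    (hχ.integrable_cutoffHat (cutoffScale_pos (ε := ε) hη)) (z := E + η * Complex.I)
    (by rwa [im_add_mul_I]) (toBox L ψ₁) (toBox L ψ₂) n)).symm

/-- The regularized expansion of the resolvent matrix element, at an arbitrary cutoff scale. -/
lemma exists_hasSum_smearedTerm (hχ : IsCutoff χ) {a : ℝ} (ha : 0 < a) (hz : 0 < z.im) :
    ∃ Q : Config d → ℂ, AEStronglyMeasurable Q (configLaw d L ρ) ∧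
      HasSum (fun n : ℕ => (-lam : ℂ) ^ n * ∫ ω, smearedTerm hL B (cutoffHat χ a) z
        (toBox L ψ₁) (toBox L ψ₂) n ω ∂(configLaw d L ρ)) (∫ ω, Q ω ∂(configLaw d L ρ)) ∧
      ∀ ω, ‖resolventElement hL B lam z ψ₁ ψ₂ ω - Q ω‖
        ≤ Real.exp (-z.im / a) / z.im * (‖toBox L ψ₁‖ * ‖toBox L ψ₂‖) := by
  choose Q hQ hQb using fun ω : Config d => exists_hasSum_smeared (boxBasis d hL)
    (fun m => energy (dualPoint L m)) hχ ha (potentialOp_symmetric (L := L) B ω) lam hz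
    (toBox L ψ₁) (toBox L ψ₂)
  set f : ℕ → Config d → ℂ := fun n ω => (-lam : ℂ) ^ n *
    smearedTerm hL B (cutoffHat χ a) z (toBox L ψ₁) (toBox L ψ₂) n ω
  have hf : ∀ n, AEStronglyMeasurable (f n) (configLaw d L ρ) := fun n =>
    ((integrable_smearedTerm hL B hρ (hχ.integrable_cutoffHat ha) hz _ _ n).const_mul
      _).aestronglyMeasurable
  have hQf : ∀ ω, HasSum (fun n => f n ω) (Q ω) := hQ
  refine ⟨Q, ?_, ?_, fun ω => ?_⟩
  · refine aestronglyMeasurable_of_tendsto_ae Filter.atTop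
      (f := fun N ω => ∑ n ∈ Finset.range N, f n ω)
      (fun N => Finset.aestronglyMeasurable_fun_sum _ fun n _ => hf n)
      (Filter.Eventually.of_forall fun ω => (hQf ω).tendsto_sum_nat)
  · set b := ‖B.toBoundedContinuousFunction‖
    set D := 2 / a * (‖toBox L ψ₁‖ * ‖toBox L ψ₂‖)
    have h := hasSum_integral_of_dominated_convergence (μ := configLaw d L ρ) (F := f) (f := Q)
      (fun n ω => D * ((|lam| * (2 / a) * b * ω.1) ^ n / n.factorial)) hf
      (fun n => by
        filter_upwards [ae_weights_le_one hL hρ] with ω hω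
        rw [norm_mul, norm_pow, norm_neg, Complex.norm_real, Real.norm_eq_abs]
        refine (mul_le_mul_of_nonneg_left (norm_smearedTerm_le hL B hχ ha hz _ _ n hω)
          (by positivity)).trans_eq ?_
        simp only [D, b, pow_succ, mul_pow]
        ring)
      (Filter.Eventually.of_forall fun ω => (Real.summable_pow_div_factorial _).mul_left _)
      (by
        refine ((integrable_exp_card hL (|lam| * (2 / a) * b)).const_mul D).congr
          (Filter.Eventually.of_forall fun ω => ?_)
        change _ = ∑' n : ℕ, D * ((|lam| * (2 / a) * b * ω.1) ^ n / n.factorial)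
        rw [tsum_mul_left, (NormedSpace.expSeries_div_hasSum_exp
          (|lam| * (2 / a) * b * ω.1 : ℝ)).tsum_eq, Real.exp_eq_exp_ℝ])
      (Filter.Eventually.of_forall hQf)
    simpa only [f, integral_const_mul] using h
  · rw [resolventElement_eq hL B lam ψ₁ ψ₂ hz]
    exact hQb ω

lemma integrable_resolventElement (hχ : IsCutoff χ) (hz : 0 < z.im) :
    Integrable (resolventElement hL B lam z ψ₁ ψ₂) (configLaw d L ρ) := by
  have := isProbabilityMeasure_configLaw (d := d) (ρ := ρ) hL
  -- the cutoff at scale `1 / (k + 1)` is removed as `k → ∞`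
  choose Q hQm _ hQb using fun k : ℕ => exists_hasSum_smearedTerm (B := B) hL lam ψ₁ ψ₂ hρ hχ
    (a := 1 / ((k : ℝ) + 1)) (by positivity) hz
  have hm : AEStronglyMeasurable (resolventElement hL B lam z ψ₁ ψ₂) (configLaw d L ρ) := by
    refine aestronglyMeasurable_of_tendsto_ae Filter.atTop hQm
      (Filter.Eventually.of_forall fun ω => tendsto_iff_norm_sub_tendsto_zero.2 ?_)
    refine squeeze_zero (fun _ => norm_nonneg _) (fun k => (norm_sub_rev _ _).trans_le (hQb k ω)) ?_
    have h1 : Filter.Tendsto (fun k : ℕ => -z.im / (1 / ((k : ℝ) + 1))) Filter.atTop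
        Filter.atBot := by
      have h2 : ∀ k : ℕ, -z.im / (1 / ((k : ℝ) + 1)) = -z.im * ((k : ℝ) + 1) := fun k => by
        rw [div_div_eq_mul_div, div_one]
      simp only [h2]
      exact (Filter.tendsto_atTop_add_const_right _ 1
        tendsto_natCast_atTop_atTop).const_mul_atTop_of_neg (neg_lt_zero.2 hz)
    simpa using ((Real.tendsto_exp_atBot.comp h1).div_const z.im).mul_const
      (‖toBox L ψ₁‖ * ‖toBox L ψ₂‖)
  refine Integrable.of_bound hm (‖toBox L ψ₁‖ * (z.im⁻¹ * ‖toBox L ψ₂‖))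
    (Filter.Eventually.of_forall fun ω => ?_)
  rw [resolventElement_eq hL B lam ψ₁ ψ₂ hz]
  exact (norm_inner_le_norm _ _).trans
    (mul_le_mul_of_nonneg_left (norm_perturbedLaplace_le _ _ (potentialOp_symmetric B ω) lam hz _)
      (norm_nonneg _))

end Resolvents

end PoissonSchrodinger

end

theorem mainTheorem1 {d : ℕ} (hd : 0 < d) (B : 𝓢(Space d, ℝ)) (hB : IsAdmissibleProfile B)
    (ρ : Measure ℝ) [IsProbabilityMeasure ρ] (hρ : HasUniformlyBoundedMoments ρ)
    (η ε lam₀ : ℝ) (hη : 0 < η) (hε : 0 < ε) (hlam₀ : 0 < lam₀) :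
    ∃ N : ℕ, ∀ (χ : ℝ → ℝ), IsCutoff χ →
      ∀ (ψ₁ ψ₂ : Lp ℂ 2 (volume : Measure (Space d))) (E lam : ℝ), lam ∈ Set.Icc (-lam₀) lam₀ →
      ∀ (L : ℝ) (hL : 1 ≤ L),
        -- the resolvents, expectations and integrals below are well defined
        (∀ᵐ ω ∂(configLaw d L ρ),
          InResolventSet (hamiltonian (one_pos.trans_le hL) B lam ω) (E + η * Complex.I)) ∧
        (∀ α : ℝ, InResolventSet (freeHamiltonian d (one_pos.trans_le hL))
          (E + η * Complex.I + 2 * Real.pi * α)) ∧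
        Integrable (resolventElement (one_pos.trans_le hL) B lam (E + η * Complex.I) ψ₁ ψ₂)
          (configLaw d L ρ) ∧
        (∀ (n : ℕ) (α : ℝ), Integrable
          (neumannElement (one_pos.trans_le hL) B n (E + η * Complex.I + 2 * Real.pi * α) ψ₁ ψ₂)
          (configLaw d L ρ)) ∧
        (∀ n : ℕ, Integrable (smearedIntegrand (one_pos.trans_le hL) B ρ χ n E η ε ψ₁ ψ₂)) ∧
        -- the estimate
        ‖(∫ ω, resolventElement (one_pos.trans_le hL) B lam (E + η * Complex.I) ψ₁ ψ₂ ω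
              ∂(configLaw d L ρ))
            - ∑ n ∈ Finset.range (N + 1),
                (lam : ℂ) ^ n * coeffS (one_pos.trans_le hL) B ρ χ n E η ε ψ₁ ψ₂‖
          ≤ ε * ‖toBox L ψ₁‖ * ‖toBox L ψ₂‖ := by 
  have ha : 0 < cutoffScale η ε := cutoffScale_pos hη
  set a := cutoffScale η ε
  -- the `n`-th term is at most `(2 / a) G 2⁻ⁿ`, with this value of `s`
  set s := 2 * (lam₀ * (2 / a))
  have hs : 0 < s := by positivity
  obtain ⟨G, hG, hbound⟩ := exists_norm_integral_smearedTerm_le hB hρ hs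
  obtain ⟨N, hN⟩ : ∃ N : ℕ, (2 / a * G) * (1 / 2) ^ N < ε / 2 := by
    obtain ⟨N, hN⟩ := exists_pow_lt_of_lt_one (x := ε / 2 / (2 / a * G)) (by positivity)
      (show (1 / 2 : ℝ) < 1 by norm_num)
    exact ⟨N, by rwa [lt_div_iff₀' (by positivity)] at hN⟩
  refine ⟨N, fun χ hχ ψ₁ ψ₂ E lam hlam L hL => ?_⟩
  have hL0 : 0 < L := one_pos.trans_le hL
  have hz : 0 < ((E : ℂ) + η * Complex.I).im := by rwa [im_add_mul_I]
  have hres := integrable_resolventElement (B := B) hL0 lam ψ₁ ψ₂ hρ hχ hz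
  refine ⟨Filter.Eventually.of_forall fun ω => inResolventSet_hamiltonian hL0 B lam hz ω,
    fun α => inResolventSet_freeHamiltonian hL0 (by rwa [im_add_two_pi_mul]), hres,
    fun n α => integrable_neumannElement hL0 ψ₁ ψ₂ hρ hη n α,
    fun n => integrable_smearedIntegrand hL0 ψ₁ ψ₂ hρ hχ hη n, ?_⟩
  have := isProbabilityMeasure_configLaw (d := d) (ρ := ρ) hL0
  obtain ⟨Q, hQm, hQsum, hQb⟩ := exists_hasSum_smearedTerm (B := B) hL0 lam ψ₁ ψ₂ hρ hχ ha hz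
  set D := ‖toBox L ψ₁‖ * ‖toBox L ψ₂‖
  set t : ℕ → ℂ := fun n => (-lam : ℂ) ^ n * ∫ ω, smearedTerm hL0 B (cutoffHat χ a)
    (E + η * Complex.I) (toBox L ψ₁) (toBox L ψ₂) n ω ∂(configLaw d L ρ)
  have hS : ∀ n, (lam : ℂ) ^ n * coeffS hL0 B ρ χ n E η ε ψ₁ ψ₂ = t n := fun n => by
    rw [coeffS_eq hL0 ψ₁ ψ₂ hρ hχ hη, ← mul_assoc, ← mul_pow, mul_neg_one]
  have ht : ∀ n, ‖t n‖ ≤ 2 / a * G * D * (1 / 2) ^ n := by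
    intro n
    have hl : |lam| ≤ lam₀ := abs_le.2 hlam
    rw [norm_mul, norm_pow, norm_neg, Complex.norm_real, Real.norm_eq_abs]
    calc _ ≤ lam₀ ^ n * ((2 / a) ^ (n + 1) * D * (s⁻¹ ^ n * G)) :=
          mul_le_mul (pow_le_pow_left₀ (abs_nonneg _) hl n)
            (hbound χ hχ a ha L hL _ hz _ _ n) (norm_nonneg _) (by positivity)
      _ = 2 / a * G * D * (lam₀ * (2 / a) * s⁻¹) ^ n := by
          rw [mul_pow, mul_pow]
          ring
      _ = _ := by
          congr 2
          simp only [s]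
          field_simp
  have htail : ‖(∫ ω, Q ω ∂(configLaw d L ρ)) - ∑ n ∈ Finset.range (N + 1), t n‖ ≤ ε / 2 * D := by
    have h1 := (hasSum_nat_add_iff' (N + 1)).2 hQsum
    rw [← h1.tsum_eq]
    have h2 : HasSum (fun n : ℕ => 2 / a * G * D * (1 / 2) ^ (n + (N + 1)))
        (2 / a * G * D * ((1 / 2) ^ (N + 1) * 2)) := by
      have := (hasSum_geometric_two.mul_left ((1 / 2 : ℝ) ^ (N + 1))).mul_left (2 / a * G * D)
      refine this.congr_fun fun n => ?_
      rw [pow_add]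
      ring
    refine (tsum_of_norm_bounded h2 fun n => ht _).trans ?_
    calc _ = (2 / a * G) * (1 / 2) ^ N * D := by
          rw [pow_succ]
          ring
      _ ≤ _ := by gcongr
  have hcut : ‖(∫ ω, resolventElement hL0 B lam (E + η * Complex.I) ψ₁ ψ₂ ω ∂(configLaw d L ρ))
      - ∫ ω, Q ω ∂(configLaw d L ρ)‖ ≤ ε / 2 * D := by
    have hQi : Integrable Q (configLaw d L ρ) := by
      have hdiff : Integrable (fun ω => resolventElement hL0 B lam (E + η * Complex.I) ψ₁ ψ₂ ω - Q ω)
          (configLaw d L ρ) :=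
        Integrable.of_bound (hres.aestronglyMeasurable.sub hQm) _ (Filter.Eventually.of_forall hQb)
      refine (hres.sub hdiff).congr (Filter.Eventually.of_forall fun ω => ?_)
      simp
    rw [← integral_sub hres hQi]
    refine (norm_integral_le_of_norm_le (integrable_const _)
      (Filter.Eventually.of_forall hQb)).trans ?_
    rw [integral_const, probReal_univ, one_smul, im_add_mul_I]
    exact mul_le_mul_of_nonneg_right (exp_div_cutoffScale_le hη hε) (by positivity)
  simp only [hS]
  calc _ ≤ ‖(∫ ω, resolventElement hL0 B lam (E + η * Complex.I) ψ₁ ψ₂ ω ∂(configLaw d L ρ))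
        - ∫ ω, Q ω ∂(configLaw d L ρ)‖
        + ‖(∫ ω, Q ω ∂(configLaw d L ρ)) - ∑ n ∈ Finset.range (N + 1), t n‖ :=
        norm_sub_le_norm_sub_add_norm_sub _ _ _
    _ ≤ ε / 2 * D + ε / 2 * D := add_le_add hcut htail
    _ = ε * ‖toBox L ψ₁‖ * ‖toBox L ψ₂‖ := by
        simp only [D]
        ring
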